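/- Let $d\in\mathbb N$, $0<k<d-1$, $V(x)=|x|^{-k}$ on $\mathbb R^d$, and $\max\{\tfrac d{2k},1\}<p<\tfrac dk<q<\infty$. Let $\zeta\in C^\infty(\mathbb R^d)$ with $0\le\zeta\le1$, $\zeta=0$ on $B_1(0)$, $\zeta=1$ off $B_2(0)$, put $\zeta_\delta(x)=\zeta(x/\delta)$, and let $r\in\mathbb N$. Let $\|f\|_{L^p+L^q}=\inf\{\|f_1\|_p+\|f_2\|_q : f=f_1+f_2\}$. A *regularization of $V$* (with rate $\eta$ and constant $c$) is a family $(V_\varepsilon)_{0<\varepsilon<1}\subset C^r(\mathbb R^d)$ such that, for all $\varepsilon,\delta\in(0,1)$: (i) $\widehat{V_\varepsilon}\ge0$ (as a tempered distribution); (ii) $\|V_\varepsilon-V\|_{L^p+L^q}\le\eta(\varepsilon)$, where $\eta\ge 0$ and $\eta(\varepsilon)\to0$ as $\varepsilon\to0$; (iii) $\|\zeta_\delta(V_\varepsilon-V)\|_{L^p+L^q}\le c\big(\varepsilon\,\delta^{-(k+1-d/q)}+\delta^{d/p-k}\big)$; (iv) $V_\varepsilon(x)\le V(x)+\varepsilon$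 for $x\neq0$; (v) $\|V_\varepsilon\|_\infty\le1/\Theta(\varepsilon)$, where $\Theta>0$ on $(0,1)$ and $\Theta(\varepsilon)\to0$ as $\varepsilon\to0$. There is a constant $c>0$, depending only on $d,k,p,q$, such that regularizations with constant $c$ exist for every $r$ and $\zeta$. For a probability measure $\mu$ with bounded density, or a finite combination of Dirac masses, let $h[\mu]$ be the signed measure $h[\mu](dx)=\big(\int S(x-y)\,\mu(dy)\big)\mu(dx)$. Let $S\in\mathcal S(\mathbb R^d)$ be real-valued and odd, and let $K>0$. Then there is a constant $C>0$, depending only on $d,k,p,q,S,K$, with the following property. For every regularization $(V_\varepsilon)$ (with any $r,\zeta,\eta,c$) and every $\sigma>2d$ there is a function $\omega$ with $\omega(t)\to0$ as $t\to0^+$ such that, with $$\mathcal O(\varepsilon,\delta,N)=\frac{\varepsilon}{\delta^{k+1-d/q}}+\delta^{d-k-\sigma/2}\,\omega(\varepsilon/\delta)+\frac{M\|V_\varepsilon\|_\infty}{N}+\delta^{d/p-k},$$ the following holds. (a) For every probability density $\mu$ with $\|\mu\|_\infty\le K$, every $N\ge1$, all pairwise distinct points $x_1,\dots,x_N\in\mathbb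 R^d$, all weights $0\le m_i\le M$ with $\sum_{i=1}^N m_i=N$, and $\mu_N=\frac1N\sum_{i=1}^N m_i\delta_{x_i}$, the two integrals below converge absolutely and, for all $\varepsilon,\delta\in(0,1)$, $$\int_{x\ne y}V(x-y)\,(\mu_N-\mu)(dx)\,(h[\mu_N]-h[\mu])(dy)\le C\big(\mathcal E_N(\mu,\mu_N)+\eta(\varepsilon)+\mathcal O(\varepsilon,\delta,N)\big),$$ where $\mathcal E_N(\mu,\mu_N)=\int_{x\ne y}V(x-y)\,(\mu_N-\mu)^{\otimes2}(dx\,dy)$. (b) The error terms can be made $o_N(1)$: there are $\varepsilon_N,\delta_N\in(0,1)$ with $\varepsilon_N,\delta_N\to0$ such that, for every $M>0$, $\eta(\varepsilon_N)+\mathcal O(\varepsilon_N,\delta_N,N)\to0$ as $N\to\infty$. -/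

import Mathlib

open MeasureTheory Filter Topology Set
open scoped ENNReal SchwartzMap FourierTransform ComplexOrder

noncomputable section

/-- The space `ℝᵈ` with its Euclidean norm. -/
abbrev Space (d : ℕ) : Type := EuclideanSpace ℝ (Fin d)

/-- The interaction potential `V(x) = |x|^{-k}`. (At the origin, where `V = +∞`, the code gives the
value `0`; every use below either avoids the origin or ignores null sets.) -/
def rieszPotential (d : ℕ) (k : ℝ) (x : Space d) : ℝ := ‖x‖ ^ (-k)

/-- A smooth cutoff `0 ≤ ζ ≤ 1` with `ζ = 0` on the unit ball and `ζ = 1` outside the ball of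
radius `2`. -/
structure IsCutoff {d : ℕ} (ζ : Space d → ℝ) : Prop where
  smooth : ContDiff ℝ (⊤ : ℕ∞) ζ
  mem_Icc : ∀ x, ζ x ∈ Icc (0 : ℝ) 1
  eq_zero : ∀ x ∈ Metric.ball (0 : Space d) 1, ζ x = 0
  eq_one : ∀ x ∉ Metric.ball (0 : Space d) 2, ζ x = 1

/-- The norm of `L^p + L^q`: the infimum of `‖f₁‖_p + ‖f₂‖_q` over all splittings `f = f₁ + f₂`
(almost everywhere) with `f₁ ∈ L^p` and `f₂ ∈ L^q`; it is `∞` if there is none. -/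
def sumSpaceNorm {d : ℕ} (p q : ℝ) (f : Space d → ℝ) : ℝ≥0∞ :=
  ⨅ (f₁ : Space d → ℝ) (f₂ : Space d → ℝ) (_ : MemLp f₁ (ENNReal.ofReal p) volume)
    (_ : MemLp f₂ (ENNReal.ofReal q) volume) (_ : f =ᵐ[volume] f₁ + f₂),
    eLpNorm f₁ (ENNReal.ofReal p) volume + eLpNorm f₂ (ENNReal.ofReal q) volume

/-- `f̂ ≥ 0` in the sense of tempered distributions: `⟨f̂, φ⟩ = ∫ f φ̂ ≥ 0` for every nonnegative
Schwartz function `φ`. (The order is the one on `ℂ` for which `0 ≤ z` means that `z` is real and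
nonnegative.) -/
def HasNonnegFourierTransform {d : ℕ} (f : Space d → ℝ) : Prop :=
  ∀ φ : 𝓢(Space d, ℂ), (∀ ξ, 0 ≤ φ ξ) → 0 ≤ ∫ x, (f x : ℂ) * (𝓕 φ) x

/-- The supremum norm. -/
def supNorm {d : ℕ} (f : Space d → ℝ) : ℝ := ⨆ x, |f x|

/-- `(V_ε)_{0 < ε < 1}` is a family of `C^r` approximations of `V(x) = |x|^{-k}`, with nonnegative
Fourier transforms, with rate `η` in `L^p + L^q`, with constant `c` in the bound away from the
origin, below `V + ε`, and bounded by `1 / Θ(ε)` for some `Θ(ε) → 0`. -/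
structure IsRegularization {d : ℕ} (k p q : ℝ) (r : ℕ) (ζ : Space d → ℝ) (c : ℝ)
    (Vε : ℝ → Space d → ℝ) (η : ℝ → ℝ) : Prop where
  contDiff : ∀ ε ∈ Ioo (0 : ℝ) 1, ContDiff ℝ r (Vε ε)
  fourier_nonneg : ∀ ε ∈ Ioo (0 : ℝ) 1, HasNonnegFourierTransform (Vε ε)
  rate_nonneg : ∀ ε ∈ Ioo (0 : ℝ) 1, 0 ≤ η ε
  rate_tendsto : Tendsto η (𝓝[>] 0) (𝓝 0)
  norm_sub_le : ∀ ε ∈ Ioo (0 : ℝ) 1,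
    sumSpaceNorm p q (fun x => Vε ε x - rieszPotential d k x) ≤ ENNReal.ofReal (η ε)
  norm_cutoff_le : ∀ ε ∈ Ioo (0 : ℝ) 1, ∀ δ ∈ Ioo (0 : ℝ) 1,
    sumSpaceNorm p q (fun x => ζ (δ⁻¹ • x) * (Vε ε x - rieszPotential d k x)) ≤
      ENNReal.ofReal (c * (ε / δ ^ (k + 1 - d / q) + δ ^ (d / p - k)))
  le_add : ∀ ε ∈ Ioo (0 : ℝ) 1, ∀ x, x ≠ 0 → Vε ε x ≤ rieszPotential d k x + ε
  bounded : ∃ Θ : ℝ → ℝ, Tendsto Θ (𝓝[>] 0) (𝓝 0) ∧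
    ∀ ε ∈ Ioo (0 : ℝ) 1, 0 < Θ ε ∧ ∀ x, |Vε ε x| ≤ 1 / Θ ε

/-- `μ` has a density with respect to Lebesgue measure whose `L^∞` norm is at most `K`. -/
def HasDensityLE {d : ℕ} (μ : Measure (Space d)) (K : ℝ) : Prop :=
  ∃ ρ : Space d → ℝ, Measurable ρ ∧ (∀ x, 0 ≤ ρ x) ∧ (∀ᵐ x ∂volume, ρ x ≤ K) ∧
    μ = volume.withDensity fun x => ENNReal.ofReal (ρ x)

/-- The weighted empirical measure `μ_N = (1/N) ∑ mᵢ δ_{xᵢ}`. -/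
def empiricalMeasure {d N : ℕ} (x : Fin N → Space d) (m : Fin N → ℝ) : Measure (Space d) :=
  ∑ i, ENNReal.ofReal (m i / N) • Measure.dirac (x i)

instance {d N : ℕ} (x : Fin N → Space d) (m : Fin N → ℝ) :
    IsFiniteMeasure (empiricalMeasure x m) := by
  have (i : Fin N) : IsFiniteMeasure (ENNReal.ofReal (m i / N) • Measure.dirac (x i)) :=
    Measure.smul_finite _ ENNReal.ofReal_ne_top
  unfold empiricalMeasure
  infer_instance

/-- The source term `h[μ] = μ(x) ∫ S(x - y) μ(dy)`, a signed measure. -/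
def sourceTerm {d : ℕ} (S : Space d → ℝ) (μ : Measure (Space d)) : SignedMeasure (Space d) :=
  μ.withDensityᵥ fun x => ∫ y, S (x - y) ∂μ

/-- The product `α ⊗ β` of two signed measures. -/
def signedProd {d : ℕ} (α β : SignedMeasure (Space d)) : SignedMeasure (Space d × Space d) :=
  VectorMeasure.prod α β (ContinuousLinearMap.mul ℝ ℝ)

/-- The set `{x ≠ y}`. -/
def offDiagonal (d : ℕ) : Set (Space d × Space d) := {z | z.1 ≠ z.2}

/-- The integral `∫_{x ≠ y} V(x - y) α(dx) β(dy)` against a product of signed measures. -/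
def interaction {d : ℕ} (V : Space d → ℝ) (α β : SignedMeasure (Space d)) : ℝ :=
  VectorMeasure.integral ((signedProd α β).restrict (offDiagonal d)) (fun z => V (z.1 - z.2))
    (ContinuousLinearMap.lsmul ℝ ℝ).flip

/-- Absolute convergence of the integral `∫_{x ≠ y} V(x - y) α(dx) β(dy)`. -/
def InteractionConverges {d : ℕ} (V : Space d → ℝ) (α β : SignedMeasure (Space d)) : Prop :=
  VectorMeasure.IntegrableOn (signedProd α β) (fun z => V (z.1 - z.2)) (offDiagonal d)

/-- The error term
`𝒪(ε, δ, N) = ε / δ^{k+1-d/q} + δ^{d-k-σ/2} ω(ε/δ) + M ‖V_ε‖_∞ / N + δ^{d/p-k}`. -/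
def errorTerm {d : ℕ} (k p q σ M : ℝ) (Vε : ℝ → Space d → ℝ) (ω : ℝ → ℝ) (ε δ : ℝ) (N : ℕ) : ℝ :=
  ε / δ ^ (k + 1 - d / q) + δ ^ (d - k - σ / 2) * ω (ε / δ) + M * supNorm (Vε ε) / N +
    δ ^ (d / p - k)

end

/-! Write ν = μ_N − μ, so that h[μ_N] − h[μ] = (S∗μ_N) ν + (S∗ν) μ. For a bounded positive definite
potential W in place of V, energies are weighted L² norms of Fourier transforms, with weight Ŵ.
Multiplication by S∗μ_N is then a convolution in frequency against a function dominated by |Ŝ|, and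
it is bounded as long as the weight varies at most polynomially away from the origin and is
integrable near it (`IsModerate.lintegral_sq_lintegral_le`, `exists_spectralEnergy_mul_le`). The
same weight controls sup |S∗ν|² by the energy (`exists_enorm_convolution_sq_le`). Cauchy–Schwarz
gives the inequality for W with no error at all (`exists_regularized_energy_le`).

The potentials W = W_a, 0 < a ≤ 1, come from |x|^{-k} = Γ(k/2)⁻¹ ∫ t^{k/2-1} exp(-t|x|²) dt by
damping the range t > a⁻² polynomially. Then Ŵ_a ≥ 0 is moderate uniformly in a, W_a ≤ V, W_a(0) is
O(a^{-k}), and V − W_a is O(a^{d-k}) in L¹. In passing back to V off the diagonal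
(`offDiagonal_energy_le`), the nonnegative V − W_a acting on pairs of atoms is absorbed by the
energy, pairs that meet μ cost O(a^{d-k}) because μ has bounded density, and the diagonal costs
W_a(0) times a mass of at most min(1, M/N).

The given family V_ε serves to choose a, of order ‖V_ε‖_∞^{-1/k} (`exists_scale`): the error becomes
M‖V_ε‖_∞/N plus a multiple of max(1, ‖V_ε‖_∞)^{-(d-k)/k}. Since V_ε → V in L^p + L^q and V is
unbounded, ‖V_ε‖_∞ → ∞ (`IsRegularization.tendsto_supNorm`), so the last quantity tends to 0. It can
be hidden in δ^{d-k-σ/2} ω(ε/δ), because δ < 1 and the exponent is negative.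

Regularizations exist because (|x|² + ε²)^{-k/2} is one; the vanishing of the errors is a diagonal
extraction (`exists_vanishing_scales`). -/

noncomputable section

/-! ### Signed measures with densities and their interaction integrals -/

lemma measurableSet_offDiagonal (d : ℕ) : MeasurableSet (offDiagonal d) :=
  (measurableSet_eq_fun measurable_fst measurable_snd).compl

lemma signedProd_withDensityᵥ {d : ℕ} {P : Measure (Space d)} [IsFiniteMeasure P]
    {u v : Space d → ℝ} (hu : Integrable u P) (hv : Integrable v P) :
    signedProd (P.withDensityᵥ u) (P.withDensityᵥ v) =
      (P.prod P).withDensityᵥ fun z => u z.1 * v z.2 := by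
  refine VectorMeasure.prod_eq_of_forall_apply_prod fun s t hs ht => ?_
  rw [withDensityᵥ_apply (hu.mul_prod hv) (hs.prod ht), withDensityᵥ_apply hu hs,
    withDensityᵥ_apply hv ht, setIntegral_prod_mul]
  rfl

lemma variation_restrict_signedProd {d : ℕ} {P : Measure (Space d)} [IsFiniteMeasure P]
    {u v : Space d → ℝ} (hu : Integrable u P) (hv : Integrable v P) :
    ((signedProd (P.withDensityᵥ u) (P.withDensityᵥ v)).restrict (offDiagonal d)).variation =
      ((P.prod P).restrict (offDiagonal d)).withDensity fun z => ‖u z.1 * v z.2‖ₑ := by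
  rw [VectorMeasure.variation_restrict (measurableSet_offDiagonal d), signedProd_withDensityᵥ hu hv,
    Measure.variation_withDensityᵥ (hu.mul_prod hv),
    restrict_withDensity (measurableSet_offDiagonal d)]

/-- Integration against a signed measure with a density. -/
lemma integral_withDensityᵥ {X : Type*} [MeasurableSpace X] {ρ : Measure X} {h f : X → ℝ}
    (hh : Integrable h ρ) (hf : Integrable f (ρ.withDensity fun x => ‖h x‖ₑ)) :
    (ρ.withDensityᵥ h).integral f (ContinuousLinearMap.lsmul ℝ ℝ).flip = ∫ x, f x * h x ∂ρ := by
  -- The positive and negative parts of the density are both below |h|, so integrability against the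
  -- variation passes to each of them.
  have hle : ∀ g : X → ℝ, (∀ x, |g x| ≤ |h x|) →
      (ρ.withDensity fun x => ENNReal.ofReal (g x)) ≤ ρ.withDensity fun x => ‖h x‖ₑ := fun g hg =>
    withDensity_mono <| Eventually.of_forall fun x => by
      simp only [Real.enorm_eq_ofReal_abs]
      exact ENNReal.ofReal_le_ofReal ((le_abs_self _).trans (hg x))
  have hp := hf.mono_measure (hle h fun x => le_rfl)
  have hn := hf.mono_measure (hle (fun x => -h x) fun x => (abs_neg _).le)
  have h1 : IsFiniteMeasure (ρ.withDensity fun x => ENNReal.ofReal (h x)) :=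
    isFiniteMeasure_withDensity_ofReal hh.2
  have h2 : IsFiniteMeasure (ρ.withDensity fun x => ENNReal.ofReal (-h x)) :=
    isFiniteMeasure_withDensity_ofReal hh.neg.2
  have key : ∀ g : X → ℝ, AEMeasurable g ρ →
      (Integrable f (ρ.withDensity fun x => ENNReal.ofReal (g x)) →
      Integrable (fun x => max (g x) 0 * f x) ρ ∧
      ∫ x, f x ∂(ρ.withDensity fun x => ENNReal.ofReal (g x)) = ∫ x, max (g x) 0 * f x ∂ρ) := by
    intro g hg hfi
    have hlt : ∀ᵐ x ∂ρ, ENNReal.ofReal (g x) < ∞ := by simp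
    constructor
    · have := (integrable_withDensity_iff_integrable_smul₀' hg.ennreal_ofReal hlt).1 hfi
      simpa [ENNReal.toReal_ofReal'] using this
    · rw [integral_withDensity_eq_integral_toReal_smul₀ hg.ennreal_ofReal hlt]
      simp [ENNReal.toReal_ofReal']
  obtain ⟨ip, ep⟩ := key h hh.aemeasurable hp
  obtain ⟨iN, eN⟩ := key (fun x => -h x) hh.aemeasurable.neg hn
  rw [withDensityᵥ_eq_withDensity_pos_part_sub_withDensity_neg_part hh,
    VectorMeasure.integral_sub_vectorMeasure, VectorMeasure.integral_toSignedMeasure,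
    VectorMeasure.integral_toSignedMeasure, ep, eN, ← integral_sub ip iN]
  · refine integral_congr_ae (Eventually.of_forall fun x => ?_)
    rcases le_total (h x) 0 with hx | hx
    · simp [hx]; ring
    · simp [hx]; ring
  · simpa [VectorMeasure.Integrable] using hp
  · simpa [VectorMeasure.Integrable] using hn

/-- Bounded densities make the variation at most B times P ⊗ P, so that only the integrability of V
itself is at stake. -/
lemma interactionConverges_withDensityᵥ {d : ℕ} {P : Measure (Space d)} [IsFiniteMeasure P]
    {V u v : Space d → ℝ} (hu : Integrable u P) (hv : Integrable v P) {B : ℝ}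
    (hB : ∀ z : Space d × Space d, |u z.1 * v z.2| ≤ B)
    (hV : IntegrableOn (fun z : Space d × Space d => V (z.1 - z.2)) (offDiagonal d) (P.prod P)) :
    InteractionConverges V (P.withDensityᵥ u) (P.withDensityᵥ v) := by
  unfold InteractionConverges VectorMeasure.IntegrableOn VectorMeasure.Integrable
  rw [variation_restrict_signedProd hu hv]
  refine (hV.smul_measure (c := ENNReal.ofReal B) ENNReal.ofReal_ne_top).mono_measure ?_
  rw [← withDensity_const]
  refine withDensity_mono <| Eventually.of_forall fun z => ?_
  simp only [Real.enorm_eq_ofReal_abs]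
  exact ENNReal.ofReal_le_ofReal (hB z)

lemma interaction_withDensityᵥ {d : ℕ} {P : Measure (Space d)} [IsFiniteMeasure P]
    {V u v : Space d → ℝ} (hu : Integrable u P) (hv : Integrable v P) {B : ℝ}
    (hB : ∀ z : Space d × Space d, |u z.1 * v z.2| ≤ B)
    (hV : IntegrableOn (fun z : Space d × Space d => V (z.1 - z.2)) (offDiagonal d) (P.prod P)) :
    interaction V (P.withDensityᵥ u) (P.withDensityᵥ v) =
      ∫ z in offDiagonal d, V (z.1 - z.2) * (u z.1 * v z.2) ∂(P.prod P) := by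
  have hc := interactionConverges_withDensityᵥ hu hv hB hV
  have huv := hu.mul_prod hv
  have hr : (signedProd (P.withDensityᵥ u) (P.withDensityᵥ v)).restrict (offDiagonal d) =
      ((P.prod P).restrict (offDiagonal d)).withDensityᵥ fun z => u z.1 * v z.2 := by
    ext s hs
    rw [VectorMeasure.restrict_apply _ (measurableSet_offDiagonal d) hs,
      signedProd_withDensityᵥ hu hv, withDensityᵥ_apply huv (hs.inter (measurableSet_offDiagonal d)),
      withDensityᵥ_apply huv.restrict hs, Measure.restrict_restrict hs]
  unfold InteractionConverges VectorMeasure.IntegrableOn VectorMeasure.Integrable at hc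
  rw [variation_restrict_signedProd hu hv] at hc
  rw [interaction, hr, integral_withDensityᵥ huv.restrict hc]

/-- A difference of measures concentrated on complementary sets, as a density on their sum. -/
lemma withDensityᵥ_sub_eq {X : Type*} [MeasurableSpace X] {Q μ : Measure X}
    {A : Set X} (hQ : ∀ᵐ x ∂Q, x ∈ A) (hμ : ∀ᵐ x ∂μ, x ∉ A)
    {f g : X → ℝ} (hf : Integrable f Q) (hg : Integrable g μ) [DecidablePred (· ∈ A)] :
    Q.withDensityᵥ f - μ.withDensityᵥ g =
      (Q + μ).withDensityᵥ fun x => if x ∈ A then f x else -g x := by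
  have h1 : (fun x => if x ∈ A then f x else -g x) =ᵐ[Q] f := by
    filter_upwards [hQ] with x hx using if_pos hx
  have h2 : (fun x => if x ∈ A then f x else -g x) =ᵐ[μ] fun x => -g x := by
    filter_upwards [hμ] with x hx using if_neg hx
  have i1 := hf.congr h1.symm
  have i2 := hg.neg.congr h2.symm
  ext s hs
  rw [withDensityᵥ_apply (i1.add_measure i2) hs, Measure.restrict_add,
    integral_add_measure i1.restrict i2.restrict, integral_congr_ae (ae_restrict_of_ae h1),
    integral_congr_ae (ae_restrict_of_ae h2), integral_neg]
  simp only [FunLike.coe_sub, Pi.sub_apply]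
  rw [withDensityᵥ_apply hf hs, withDensityᵥ_apply hg hs, sub_eq_add_neg]

lemma toSignedMeasure_eq_withDensityᵥ_one {X : Type*} [MeasurableSpace X] (Q : Measure X)
    [IsFiniteMeasure Q] : Q.toSignedMeasure = Q.withDensityᵥ fun _ => (1 : ℝ) := by
  ext s hs
  rw [withDensityᵥ_apply (integrable_const _) hs, Measure.toSignedMeasure_apply_measurable hs]
  simp

/-! ### Gaussian mixtures and energies in Fourier variables -/

/-- The Fourier transform of the Gaussian `exp (-t ‖x‖²)`. -/
def gaussDensity {d : ℕ} (t : ℝ) (ξ : Space d) : ℝ :=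
  (Real.pi / t) ^ ((d : ℝ) / 2) * Real.exp (-Real.pi ^ 2 * ‖ξ‖ ^ 2 / t)

/-- The superposition `∫ exp (-t ‖x‖²) Λ(dt)` of Gaussians. -/
def gaussMix {d : ℕ} (Λ : Measure ℝ) (x : Space d) : ℝ := ∫ t, Real.exp (-t * ‖x‖ ^ 2) ∂Λ

/-- The Fourier transform of `gaussMix Λ`, as a density. -/
def spectralDensity {d : ℕ} (Λ : Measure ℝ) (ξ : Space d) : ℝ≥0∞ :=
  ∫⁻ t, ENNReal.ofReal (gaussDensity t ξ) ∂Λ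

/-- The Fourier transform of `gaussMix Λ`, as a measure. -/
def spectralMeasure (d : ℕ) (Λ : Measure ℝ) : Measure (Space d) :=
  volume.withDensity (spectralDensity Λ)

/-- The character `x ↦ exp (2 π i ⟨x, ξ⟩)`. -/
def character {d : ℕ} (x ξ : Space d) : ℂ := Complex.exp (2 * Real.pi * Complex.I * inner ℝ x ξ)

section
variable {d : ℕ}

lemma norm_character (x ξ : Space d) : ‖character x ξ‖ = 1 := by
  rw [character, show (2 * Real.pi * Complex.I * (inner ℝ x ξ : ℝ) : ℂ) =
    ((2 * Real.pi * inner ℝ x ξ : ℝ) : ℂ) * Complex.I by push_cast; ring]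
  exact Complex.norm_exp_ofReal_mul_I _

@[fun_prop]
lemma measurable_character {X : Type*} [MeasurableSpace X] {f g : X → Space d}
    (hf : Measurable f) (hg : Measurable g) : Measurable fun z => character (f z) (g z) := by
  unfold character
  fun_prop

lemma character_sub_left (x y ξ : Space d) :
    character (x - y) ξ = character x ξ * (starRingEnd ℂ) (character y ξ) := by
  simp only [character, ← Complex.exp_conj, ← Complex.exp_add, inner_sub_left]
  congr 1
  simp only [map_mul, Complex.conj_ofReal, Complex.conj_I, map_ofNat]
  push_cast
  ring

lemma character_add_right (x ξ η : Space d) :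
    character x (ξ + η) = character x ξ * character x η := by
  simp only [character, ← Complex.exp_add, inner_add_right]
  congr 1
  push_cast
  ring

lemma gaussDensity_nonneg {t : ℝ} (ht : 0 < t) (ξ : Space d) : 0 ≤ gaussDensity t ξ := by
  unfold gaussDensity
  positivity

@[fun_prop]
lemma measurable_gaussDensity {X : Type*} [MeasurableSpace X] {f : X → ℝ} {g : X → Space d}
    (hf : Measurable f) (hg : Measurable g) : Measurable fun z => gaussDensity (f z) (g z) := by
  unfold gaussDensity
  fun_prop

lemma integral_gaussDensity_mul_character {t : ℝ} (ht : 0 < t) (x : Space d) :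
    ∫ ξ : Space d, (gaussDensity t ξ : ℂ) * character x ξ = Real.exp (-t * ‖x‖ ^ 2) := by
  have hpt : 0 < Real.pi ^ 2 / t := by positivity
  have h := GaussianFourier.integral_cexp_neg_mul_sq_norm_add (V := Space d)
    (b := ((Real.pi ^ 2 / t : ℝ) : ℂ)) (by simpa only [Complex.ofReal_re] using hpt)
    (2 * Real.pi * Complex.I) x
  have e : ∀ ξ : Space d, (gaussDensity t ξ : ℂ) * character x ξ =
      (((Real.pi / t) ^ ((d : ℝ) / 2) : ℝ) : ℂ) *
        Complex.exp (-((Real.pi ^ 2 / t : ℝ) : ℂ) * ‖ξ‖ ^ 2 +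
          2 * Real.pi * Complex.I * inner ℝ x ξ) := by
    intro ξ
    rw [gaussDensity, character, Complex.exp_add]
    push_cast
    rw [show -(Real.pi : ℂ) ^ 2 * ‖ξ‖ ^ 2 / t = -((Real.pi : ℂ) ^ 2 / t) * ‖ξ‖ ^ 2 by ring]
    ring
  simp_rw [e]
  rw [integral_const_mul, h, ← mul_assoc]
  have hc : ((Real.pi : ℂ) / ((Real.pi ^ 2 / t : ℝ) : ℂ)) ^ ((Module.finrank ℝ (Space d) : ℂ) / 2) =
      ((((Real.pi / t) ^ ((d : ℝ) / 2))⁻¹ : ℝ) : ℂ) := by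
    rw [← Complex.ofReal_div, show Real.pi / (Real.pi ^ 2 / t) = (Real.pi / t)⁻¹ by
      field_simp, finrank_euclideanSpace_fin, ← Real.inv_rpow (by positivity),
      Complex.ofReal_cpow (by positivity)]
    push_cast
    rfl
  rw [hc, ← Complex.ofReal_mul, mul_inv_cancel₀ (by positivity), Complex.ofReal_one, one_mul,
    Complex.ofReal_exp]
  congr 1
  push_cast
  have : (Real.pi : ℂ) ≠ 0 := by simp [Real.pi_ne_zero]
  have : (t : ℂ) ≠ 0 := by exact_mod_cast ht.ne'
  rw [mul_pow, mul_pow, Complex.I_sq]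
  field_simp
  ring

lemma integral_gaussDensity {t : ℝ} (ht : 0 < t) : ∫ ξ : Space d, gaussDensity t ξ = 1 := by
  have h := integral_gaussDensity_mul_character ht (0 : Space d)
  simp only [character, inner_zero_left, Complex.ofReal_zero, mul_zero, Complex.exp_zero, mul_one,
    norm_zero] at h
  rw [integral_complex_ofReal] at h
  simpa using h

lemma lintegral_gaussDensity {t : ℝ} (ht : 0 < t) :
    ∫⁻ ξ : Space d, ENNReal.ofReal (gaussDensity t ξ) = 1 := by
  have h := integral_gaussDensity (d := d) ht
  rw [← ofReal_integral_eq_lintegral_ofReal, h, ENNReal.ofReal_one]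
  · exact Integrable.of_integral_ne_zero (by rw [h]; exact one_ne_zero)
  · exact Eventually.of_forall fun ξ => gaussDensity_nonneg ht ξ

@[fun_prop]
lemma measurable_spectralDensity (Λ : Measure ℝ) [SFinite Λ] :
    Measurable (spectralDensity Λ : Space d → ℝ≥0∞) := by
  unfold spectralDensity
  exact Measurable.lintegral_prod_right' (f := fun z : Space d × ℝ =>
    ENNReal.ofReal (gaussDensity z.2 z.1)) (by fun_prop)

/-- Seen as a marginal of a measure in (t, ξ), the spectral measure has its total mass and its
Fourier transform computed by Fubini from those of a single Gaussian. -/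
lemma spectralMeasure_eq_map (Λ : Measure ℝ) [SFinite Λ] :
    spectralMeasure d Λ = ((Λ.prod (volume : Measure (Space d))).withDensity
      fun z => ENNReal.ofReal (gaussDensity z.1 z.2)).map Prod.snd := by
  ext s hs
  rw [Measure.map_apply measurable_snd hs, withDensity_apply _ (measurable_snd hs),
    spectralMeasure, withDensity_apply _ hs, ← lintegral_indicator hs,
    ← lintegral_indicator (measurable_snd hs), lintegral_prod_symm _
      (Measurable.aemeasurable <| Measurable.indicator (by fun_prop) (measurable_snd hs))]
  refine lintegral_congr fun ξ => ?_
  by_cases h : ξ ∈ s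
  · simp [indicator, h, spectralDensity]
  · simp [indicator, h]

lemma spectralMeasure_univ {Λ : Measure ℝ} [SFinite Λ] (hΛ : ∀ᵐ t ∂Λ, 0 < t) :
    spectralMeasure d Λ univ = Λ univ := by
  rw [spectralMeasure_eq_map, Measure.map_apply measurable_snd .univ, preimage_univ,
    withDensity_apply _ .univ, Measure.restrict_univ, lintegral_prod _ (by fun_prop)]
  rw [lintegral_congr_ae (g := fun _ => 1)]
  · simp
  · filter_upwards [hΛ] with t ht using lintegral_gaussDensity ht

lemma integral_character_spectralMeasure {Λ : Measure ℝ} [IsFiniteMeasure Λ]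
    (hΛ : ∀ᵐ t ∂Λ, 0 < t) (x : Space d) :
    ∫ ξ, character x ξ ∂(spectralMeasure d Λ) = (gaussMix Λ x : ℂ) := by
  have hfin : IsFiniteMeasure (spectralMeasure d Λ) := ⟨by
    rw [spectralMeasure_univ hΛ]; exact measure_lt_top _ _⟩
  have hI : Integrable (character x) (spectralMeasure d Λ) :=
    (integrable_const (1 : ℝ)).mono' (by fun_prop) (Eventually.of_forall fun ξ =>
      (norm_character x ξ).le)
  rw [spectralMeasure_eq_map] at hI ⊢
  have hm : AEMeasurable (Prod.snd : ℝ × Space d → Space d) ((Λ.prod volume).withDensity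
      fun z => ENNReal.ofReal (gaussDensity z.1 z.2)) := by fun_prop
  have hI' := hI.comp_aemeasurable hm
  have hpos : ∀ᵐ z ∂(Λ.prod (volume : Measure (Space d))), 0 < z.1 :=
    Measure.quasiMeasurePreserving_fst.ae hΛ
  rw [integral_map hm (by fun_prop), integral_withDensity_eq_integral_toReal_smul (by fun_prop)
    (by simp), integral_prod]
  · rw [gaussMix, ← integral_complex_ofReal]
    refine integral_congr_ae ?_
    filter_upwards [hΛ] with t ht
    rw [← integral_gaussDensity_mul_character ht x]
    refine integral_congr_ae (Eventually.of_forall fun ξ => ?_)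
    simp [ENNReal.toReal_ofReal (gaussDensity_nonneg ht ξ)]
  · exact (integrable_withDensity_iff_integrable_smul' (by fun_prop) (by simp)).1 hI'

/-- The Fourier transform of the signed measure `f P`. -/
def transform (P : Measure (Space d)) (f : Space d → ℝ) (ξ : Space d) : ℂ :=
  ∫ x, character x ξ * f x ∂P

lemma measurable_transform (P : Measure (Space d)) [SFinite P] {f : Space d → ℝ}
    (hf : Measurable f) : Measurable (transform P f) := by
  unfold transform
  exact (StronglyMeasurable.integral_prod_right (f := fun ξ x => character x ξ * (f x : ℂ))
    (Measurable.stronglyMeasurable (by fun_prop))).measurable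

lemma norm_transform_le (P : Measure (Space d)) (f : Space d → ℝ) (ξ : Space d) :
    ‖transform P f ξ‖ ≤ ∫ x, |f x| ∂P :=
  (norm_integral_le_integral_norm _).trans_eq <| by simp [norm_character]

/-- The interaction energy, in Fourier variables. -/
lemma energy_eq_integral_transform {P Γ : Measure (Space d)} [IsFiniteMeasure P]
    [IsFiniteMeasure Γ] {W : Space d → ℝ} (hW : ∀ x, ∫ ξ, character x ξ ∂Γ = (W x : ℂ))
    {u v : Space d → ℝ} (hu : Integrable u P) (hv : Integrable v P) :
    ((∫ z, W (z.1 - z.2) * (u z.1 * v z.2) ∂(P.prod P) : ℝ) : ℂ) =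
      ∫ ξ, transform P u ξ * (starRingEnd ℂ) (transform P v ξ) ∂Γ := by
  have h1 : ∀ ξ, transform P u ξ * (starRingEnd ℂ) (transform P v ξ) =
      ∫ z, character (z.1 - z.2) ξ * ((u z.1 * v z.2 : ℝ) : ℂ) ∂(P.prod P) := by
    intro ξ
    rw [transform, transform, ← integral_conj, ← integral_prod_mul]
    refine integral_congr_ae (Eventually.of_forall fun z => ?_)
    simp only [character_sub_left, map_mul, Complex.conj_ofReal]
    push_cast
    ring
  simp_rw [h1]
  rw [integral_integral_swap, ← integral_complex_ofReal]
  · refine integral_congr_ae (Eventually.of_forall fun z => ?_)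
    simp only
    rw [integral_mul_const, hW]
    push_cast
    ring
  · have hi : Integrable (fun z : Space d × Space d × Space d => u z.2.1 * v z.2.2)
        (Γ.prod (P.prod P)) := by
      simpa using! (integrable_const (1 : ℝ) (μ := Γ)).mul_prod (hu.mul_prod hv)
    refine hi.mono ?_ (Eventually.of_forall fun z => ?_)
    · exact AEStronglyMeasurable.mul (Measurable.aestronglyMeasurable (by fun_prop))
        (Complex.continuous_ofReal.comp_aestronglyMeasurable hi.aestronglyMeasurable)
    · simp [Function.uncurry, norm_character]

/-- Quadratic energy with respect to a spectral measure `Γ`. -/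
def spectralEnergy (Γ P : Measure (Space d)) (f : Space d → ℝ) : ℝ≥0∞ :=
  ∫⁻ ξ, ‖transform P f ξ‖ₑ ^ 2 ∂Γ

lemma integrable_transform_mul_conj {P Γ : Measure (Space d)} [IsFiniteMeasure P]
    [IsFiniteMeasure Γ] {f g : Space d → ℝ} (hf : Measurable f) (hg : Measurable g) :
    Integrable (fun ξ => transform P f ξ * (starRingEnd ℂ) (transform P g ξ)) Γ := by
  refine (integrable_const ((∫ x, |f x| ∂P) * ∫ x, |g x| ∂P)).mono'
    ((measurable_transform P hf).mul
      (Complex.continuous_conj.measurable.comp (measurable_transform P hg))).aestronglyMeasurable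
    (Eventually.of_forall fun ξ => ?_)
  rw [norm_mul, RCLike.norm_conj]
  exact mul_le_mul (norm_transform_le P f ξ) (norm_transform_le P g ξ) (norm_nonneg _)
    (integral_nonneg fun _ => abs_nonneg _)

lemma integrable_sq_norm_transform {P Γ : Measure (Space d)} [IsFiniteMeasure P]
    [IsFiniteMeasure Γ] {f : Space d → ℝ} (hf : Measurable f) :
    Integrable (fun ξ => ‖transform P f ξ‖ ^ 2) Γ := by
  refine (integrable_transform_mul_conj (P := P) (Γ := Γ) hf hf).re.congr
    (Eventually.of_forall fun ξ => ?_)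
  simp only [Complex.mul_conj, Complex.normSq_eq_norm_sq, RCLike.re_eq_complex_re,
    Complex.ofReal_re]

lemma energy_eq_integral_sq_transform {P Γ : Measure (Space d)} [IsFiniteMeasure P]
    [IsFiniteMeasure Γ] {W : Space d → ℝ} (hW : ∀ x, ∫ ξ, character x ξ ∂Γ = (W x : ℂ))
    {u : Space d → ℝ} (hu : Integrable u P) :
    ∫ z, W (z.1 - z.2) * (u z.1 * u z.2) ∂(P.prod P) = ∫ ξ, ‖transform P u ξ‖ ^ 2 ∂Γ := by
  rw [← Complex.ofReal_inj, energy_eq_integral_transform hW hu hu, ← integral_complex_ofReal]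
  refine integral_congr_ae (Eventually.of_forall fun ξ => ?_)
  simp only [Complex.mul_conj, Complex.normSq_eq_norm_sq]

lemma energy_nonneg {P Γ : Measure (Space d)} [IsFiniteMeasure P]
    [IsFiniteMeasure Γ] {W : Space d → ℝ} (hW : ∀ x, ∫ ξ, character x ξ ∂Γ = (W x : ℂ))
    {u : Space d → ℝ} (hu : Integrable u P) :
    0 ≤ ∫ z, W (z.1 - z.2) * (u z.1 * u z.2) ∂(P.prod P) := by
  rw [energy_eq_integral_sq_transform hW hu]
  exact integral_nonneg fun ξ => by positivity

lemma ofReal_energy_eq {P Γ : Measure (Space d)} [IsFiniteMeasure P]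
    [IsFiniteMeasure Γ] {W : Space d → ℝ} (hW : ∀ x, ∫ ξ, character x ξ ∂Γ = (W x : ℂ))
    {u : Space d → ℝ} (hum : Measurable u) (hu : Integrable u P) :
    ENNReal.ofReal (∫ z, W (z.1 - z.2) * (u z.1 * u z.2) ∂(P.prod P)) = spectralEnergy Γ P u := by
  rw [energy_eq_integral_sq_transform hW hu, ofReal_integral_eq_lintegral_ofReal
    (integrable_sq_norm_transform hum) (Eventually.of_forall fun ξ => by positivity)]
  refine lintegral_congr fun ξ => ?_
  rw [ENNReal.ofReal_pow (norm_nonneg _), ofReal_norm]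

/-- The polarized energy is controlled by the quadratic ones. -/
lemma two_mul_energy_le {P Γ : Measure (Space d)} [IsFiniteMeasure P]
    [IsFiniteMeasure Γ] {W : Space d → ℝ} (hW : ∀ x, ∫ ξ, character x ξ ∂Γ = (W x : ℂ))
    {u v : Space d → ℝ} (hum : Measurable u) (hu : Integrable u P) (hvm : Measurable v)
    (hv : Integrable v P) :
    2 * ∫ z, W (z.1 - z.2) * (u z.1 * v z.2) ∂(P.prod P) ≤
      ∫ z, W (z.1 - z.2) * (u z.1 * u z.2) ∂(P.prod P) +
        ∫ z, W (z.1 - z.2) * (v z.1 * v z.2) ∂(P.prod P) := by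
  have h := congrArg Complex.re (energy_eq_integral_transform hW hu hv)
  have hint := integrable_transform_mul_conj (P := P) (Γ := Γ) hum hvm
  rw [Complex.ofReal_re] at h
  rw [h, ← RCLike.re_eq_complex_re, ← integral_re hint, ← integral_const_mul,
    energy_eq_integral_sq_transform hW hu, energy_eq_integral_sq_transform hW hv,
    ← integral_add (integrable_sq_norm_transform hum) (integrable_sq_norm_transform hvm)]
  refine integral_mono (hint.re.const_mul 2) ((integrable_sq_norm_transform hum).add
    (integrable_sq_norm_transform hvm)) fun ξ => ?_
  have h1 := Complex.abs_re_le_norm (transform P u ξ * (starRingEnd ℂ) (transform P v ξ))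
  rw [norm_mul, RCLike.norm_conj] at h1
  have h2 := (le_abs_self _).trans h1
  simp only [RCLike.re_eq_complex_re]
  nlinarith [sq_nonneg (‖transform P u ξ‖ - ‖transform P v ξ‖)]
end

/-! ### Regularized Riesz potentials as Gaussian mixtures -/

/-- The density of `rieszMixture`: the Gaussian superposition of `|x|^{-k}`, damped at the
scales below `a`. -/
def rieszWeight (d : ℕ) (k a t : ℝ) : ℝ :=
  t ^ (k / 2 - 1) / Real.Gamma (k / 2) * min 1 (((a ^ 2 * t) ^ d)⁻¹)

/-- The mixing measure of a regularized Riesz potential at scale `a`. -/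
def rieszMixture (d : ℕ) (k a : ℝ) : Measure ℝ :=
  (volume.restrict (Ioi 0)).withDensity fun t => ENNReal.ofReal (rieszWeight d k a t)

section
variable {d : ℕ} {k a : ℝ}

lemma setLIntegral_Ioc_rpow {r T : ℝ} (hr : -1 < r) (hT : 0 < T) :
    ∫⁻ t in Ioc 0 T, ENNReal.ofReal (t ^ r) = ENNReal.ofReal (T ^ (r + 1) / (r + 1)) := by
  rw [← ofReal_integral_eq_lintegral_ofReal]
  · rw [← intervalIntegral.integral_of_le hT.le, integral_rpow (Or.inl hr),
      Real.zero_rpow (by linarith), sub_zero]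
  · exact (intervalIntegrable_iff_integrableOn_Ioc_of_le hT.le).1
      (intervalIntegral.intervalIntegrable_rpow' hr)
  · exact ae_restrict_of_forall_mem measurableSet_Ioc fun t ht => Real.rpow_nonneg ht.1.le _

lemma setLIntegral_Ioi_rpow {r T : ℝ} (hr : r < -1) (hT : 0 < T) :
    ∫⁻ t in Ioi T, ENNReal.ofReal (t ^ r) = ENNReal.ofReal (T ^ (r + 1) / -(r + 1)) := by
  rw [← ofReal_integral_eq_lintegral_ofReal]
  · rw [integral_Ioi_rpow_of_lt hr hT, neg_div, div_neg]
  · exact integrableOn_Ioi_rpow_of_lt hr hT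
  · exact ae_restrict_of_forall_mem measurableSet_Ioi fun t ht => Real.rpow_nonneg (hT.le.trans ht.le) _

/-- The common pattern of the estimates on the mixture. The split is at T = a⁻², where the damping
sets in, or at T = 1 when the bound has to be uniform in a. -/
lemma setLIntegral_Ioi_zero_le {f : ℝ → ℝ≥0∞} {r s A B T : ℝ} (hA : 0 ≤ A) (hB : 0 ≤ B)
    (hr : -1 < r) (hs : s < -1) (hT : 0 < T)
    (h1 : ∀ t, 0 < t → t ≤ T → f t ≤ ENNReal.ofReal (A * t ^ r))
    (h2 : ∀ t, T < t → f t ≤ ENNReal.ofReal (B * t ^ s)) :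
    ∫⁻ t in Ioi 0, f t ≤
      ENNReal.ofReal (A * (T ^ (r + 1) / (r + 1)) + B * (T ^ (s + 1) / -(s + 1))) := by
  rw [← Ioc_union_Ioi_eq_Ioi hT.le]
  refine (lintegral_union_le _ _ _).trans ?_
  have hr' : 0 < r + 1 := by linarith
  have hs' : 0 < -(s + 1) := by linarith
  rw [ENNReal.ofReal_add (by positivity) (by positivity), ENNReal.ofReal_mul hA,
    ENNReal.ofReal_mul hB, ← setLIntegral_Ioc_rpow hr hT, ← setLIntegral_Ioi_rpow hs hT,
    ← lintegral_const_mul' _ _ ENNReal.ofReal_ne_top,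
    ← lintegral_const_mul' _ _ ENNReal.ofReal_ne_top]
  gcongr ?_ + ?_
  · refine setLIntegral_mono' measurableSet_Ioc fun t ht => ?_
    rw [← ENNReal.ofReal_mul hA]
    exact h1 t ht.1 ht.2
  · refine setLIntegral_mono' measurableSet_Ioi fun t ht => ?_
    rw [← ENNReal.ofReal_mul hB]
    exact h2 t ht

@[fun_prop]
lemma measurable_rieszWeight : Measurable (rieszWeight d k a) := by
  unfold rieszWeight
  fun_prop

lemma rieszWeight_nonneg (hk : 0 < k) {t : ℝ} (ht : 0 < t) : 0 ≤ rieszWeight d k a t := by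
  unfold rieszWeight
  have := Real.Gamma_pos_of_pos (half_pos hk)
  positivity

lemma rieszWeight_le (hk : 0 < k) {t : ℝ} (ht : 0 < t) :
    rieszWeight d k a t ≤ t ^ (k / 2 - 1) / Real.Gamma (k / 2) := by
  unfold rieszWeight
  have := Real.Gamma_pos_of_pos (half_pos hk)
  exact mul_le_of_le_one_right (by positivity) (min_le_left _ _)

lemma rieszWeight_eq (ha : 0 < a) {t : ℝ} (ht : 0 < t) (hta : t ≤ (a ^ 2)⁻¹) :
    rieszWeight d k a t = t ^ (k / 2 - 1) / Real.Gamma (k / 2) := by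
  unfold rieszWeight
  have h : a ^ 2 * t ≤ 1 := by
    calc a ^ 2 * t ≤ a ^ 2 * (a ^ 2)⁻¹ := by gcongr
      _ = 1 := mul_inv_cancel₀ (by positivity)
  rw [min_eq_left, mul_one]
  exact (one_le_inv₀ (by positivity)).2 (pow_le_one₀ (by positivity) h)

lemma ae_rieszMixture_pos : ∀ᵐ t ∂(rieszMixture d k a), 0 < t :=
  (withDensity_absolutelyContinuous _ _).ae_le (ae_restrict_mem measurableSet_Ioi)

lemma lintegral_rieszMixture {f : ℝ → ℝ≥0∞} :
    ∫⁻ t, f t ∂(rieszMixture d k a) =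
      ∫⁻ t in Ioi 0, ENNReal.ofReal (rieszWeight d k a t) * f t :=
  lintegral_withDensity_eq_lintegral_mul_non_measurable _ (by fun_prop) (by simp) _

instance : SFinite (rieszMixture d k a) := by
  unfold rieszMixture
  infer_instance

/-- The total mass `W_a(0)` is of order `a^{-k}`. -/
lemma rieszMixture_univ_le (hk : 0 < k) (hkd : k < d) (ha : 0 < a) :
    rieszMixture d k a univ ≤
      ENNReal.ofReal ((1 / (k / 2) + 1 / (d - k / 2)) / Real.Gamma (k / 2) * a ^ (-k)) := by
  have hΓ := Real.Gamma_pos_of_pos (half_pos hk)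
  rw [← setLIntegral_one, Measure.restrict_univ, lintegral_rieszMixture]
  -- Beyond t = a⁻² the damped weight decays like t^{k/2-1-d}, which is integrable because k/2 < d.
  refine (setLIntegral_Ioi_zero_le (r := k / 2 - 1) (s := k / 2 - 1 - d) (T := (a ^ 2)⁻¹)
    (A := 1 / Real.Gamma (k / 2)) (B := (a ^ (2 * (d : ℝ)))⁻¹ / Real.Gamma (k / 2)) (by positivity)
    (by positivity) (by linarith) (by linarith) (by positivity) ?_ ?_).trans
    (ENNReal.ofReal_le_ofReal (le_of_eq ?_))
  · intro t ht _
    rw [mul_one]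
    refine ENNReal.ofReal_le_ofReal ((rieszWeight_le hk ht).trans_eq (by ring))
  · intro t ht
    have ht0 : 0 < t := lt_trans (by positivity) ht
    rw [mul_one]
    refine ENNReal.ofReal_le_ofReal ?_
    unfold rieszWeight
    refine (mul_le_mul_of_nonneg_left (min_le_right _ _) (by positivity)).trans_eq ?_
    rw [Real.rpow_sub ht0 (k / 2 - 1), Real.rpow_natCast, Real.rpow_mul ha.le, Real.rpow_two,
      Real.rpow_natCast, mul_pow, mul_inv]
    ring
  · have e1 : ((a ^ 2)⁻¹ : ℝ) = a ^ (-2 : ℝ) := by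
      rw [Real.rpow_neg ha.le, Real.rpow_two]
    rw [e1, ← Real.rpow_neg ha.le, ← Real.rpow_mul ha.le, ← Real.rpow_mul ha.le,
      show -2 * (k / 2 - 1 + 1) = -k by ring,
      show -2 * (k / 2 - 1 - d + 1) = -k + 2 * (d : ℝ) by ring, Real.rpow_add ha,
      show -(k / 2 - 1 - d + 1) = d - k / 2 by ring, show k / 2 - 1 + 1 = k / 2 by ring]
    have : a ^ (-(2 * (d : ℝ))) * a ^ (2 * (d : ℝ)) = 1 := by
      rw [← Real.rpow_add ha]; simp
    linear_combination (1 / Real.Gamma (k / 2) * a ^ (-k) / (d - k / 2)) * this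

lemma isFiniteMeasure_rieszMixture (hk : 0 < k) (hkd : k < d) (ha : 0 < a) :
    IsFiniteMeasure (rieszMixture d k a) :=
  ⟨(rieszMixture_univ_le hk hkd ha).trans_lt ENNReal.ofReal_lt_top⟩

/-- The damping factor is at most one and is dropped, which frees the bound from a. Small t converge
because k > 0; the decay t^{-d/2}, that of Gaussians integrated against a bounded density, makes
large t converge because k < d. -/
lemma lintegral_rieszMixture_le (hk : 0 < k) (hkd : k < d) {f : ℝ → ℝ≥0∞} {B : ℝ} (hB : 0 ≤ B)
    (h1 : ∀ t, 0 < t → f t ≤ 1)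
    (h2 : ∀ t, 0 < t → f t ≤ ENNReal.ofReal (B * t ^ (-(d : ℝ) / 2))) :
    ∫⁻ t, f t ∂(rieszMixture d k a) ≤
      ENNReal.ofReal ((1 / (k / 2) + B / ((d - k) / 2)) / Real.Gamma (k / 2)) := by
  have hΓ := Real.Gamma_pos_of_pos (half_pos hk)
  rw [lintegral_rieszMixture]
  refine (setLIntegral_Ioi_zero_le (r := k / 2 - 1) (s := k / 2 - 1 + -(d : ℝ) / 2) (T := 1)
    (A := 1 / Real.Gamma (k / 2)) (B := B / Real.Gamma (k / 2)) (by positivity)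
    (by positivity) (by linarith) (by linarith) (by positivity) ?_ ?_).trans
    (ENNReal.ofReal_le_ofReal (le_of_eq ?_))
  · intro t ht _
    refine (mul_le_mul' (ENNReal.ofReal_le_ofReal (rieszWeight_le hk ht)) (h1 t ht)).trans_eq ?_
    rw [mul_one, div_mul_eq_mul_div, one_mul]
  · intro t ht
    have ht0 : 0 < t := lt_trans one_pos ht
    refine (mul_le_mul' (ENNReal.ofReal_le_ofReal (rieszWeight_le hk ht0)) (h2 t ht0)).trans_eq ?_
    rw [← ENNReal.ofReal_mul (by positivity), Real.rpow_add ht0]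
    congr 1
    ring
  · rw [Real.one_rpow, Real.one_rpow]
    rw [show -(k / 2 - 1 + -(d : ℝ) / 2 + 1) = (d - k) / 2 by ring,
      show k / 2 - 1 + 1 = k / 2 by ring]
    ring

lemma gaussDensity_le {t : ℝ} (ht : 0 < t) (ξ : Space d) :
    gaussDensity t ξ ≤ Real.pi ^ ((d : ℝ) / 2) * t ^ (-(d : ℝ) / 2) := by
  unfold gaussDensity
  rw [Real.div_rpow Real.pi_pos.le ht.le, neg_div, Real.rpow_neg ht.le, ← div_eq_mul_inv]
  refine mul_le_of_le_one_right (by positivity) (Real.exp_le_one_iff.2 ?_)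
  rw [neg_mul, neg_div]
  have : 0 ≤ Real.pi ^ 2 * ‖ξ‖ ^ 2 / t := by positivity
  linarith

/-- The low frequencies carry a bounded mass, uniformly in `a`. -/
lemma setLIntegral_ball_spectralDensity_le (hk : 0 < k) (hkd : k < d) :
    ∃ C : ℝ, ∀ a, ∫⁻ ξ in Metric.ball (0 : Space d) 1, spectralDensity (rieszMixture d k a) ξ ≤
      ENNReal.ofReal C := by
  refine ⟨(1 / (k / 2) + Real.pi ^ ((d : ℝ) / 2) * (volume (Metric.ball (0 : Space d) 1)).toReal /
    ((d - k) / 2)) / Real.Gamma (k / 2), fun a => ?_⟩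
  unfold spectralDensity
  rw [lintegral_lintegral_swap (by fun_prop)]
  refine lintegral_rieszMixture_le hk hkd (B := Real.pi ^ ((d : ℝ) / 2) *
    (volume (Metric.ball (0 : Space d) 1)).toReal) (by positivity) (fun t ht => ?_) fun t ht => ?_
  · rw [← lintegral_gaussDensity (d := d) ht]
    exact setLIntegral_le_lintegral _ _
  · refine (lintegral_mono fun ξ => ENNReal.ofReal_le_ofReal (gaussDensity_le ht ξ)).trans ?_
    rw [setLIntegral_const, mul_right_comm, ENNReal.ofReal_mul (q := ENNReal.toReal _)
      (by positivity), ENNReal.ofReal_toReal measure_ball_lt_top.ne]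

lemma integrable_exp_neg_mul_norm_sq {Λ : Measure ℝ} [IsFiniteMeasure Λ] (hΛ : ∀ᵐ t ∂Λ, 0 < t)
    (x : Space d) : Integrable (fun t => Real.exp (-t * ‖x‖ ^ 2)) Λ := by
  refine (integrable_const (1 : ℝ)).mono' (by fun_prop) ?_
  filter_upwards [hΛ] with t ht
  rw [Real.norm_of_nonneg (Real.exp_nonneg _), Real.exp_le_one_iff]
  nlinarith [sq_nonneg ‖x‖]

lemma ofReal_gaussMix {Λ : Measure ℝ} [IsFiniteMeasure Λ] (hΛ : ∀ᵐ t ∂Λ, 0 < t) (x : Space d) :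
    ENNReal.ofReal (gaussMix Λ x) = ∫⁻ t, ENNReal.ofReal (Real.exp (-t * ‖x‖ ^ 2)) ∂Λ :=
  ofReal_integral_eq_lintegral_ofReal (integrable_exp_neg_mul_norm_sq hΛ x)
    (Eventually.of_forall fun _ => Real.exp_nonneg _)

lemma gaussMix_nonneg (Λ : Measure ℝ) (x : Space d) : 0 ≤ gaussMix Λ x :=
  integral_nonneg fun _ => Real.exp_nonneg _

lemma gaussMix_le {Λ : Measure ℝ} [IsFiniteMeasure Λ] (hΛ : ∀ᵐ t ∂Λ, 0 < t) (x : Space d) :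
    gaussMix Λ x ≤ Λ.real univ := by
  have h : ∫ _, (1 : ℝ) ∂Λ = Λ.real univ := by simp
  rw [← h]
  refine integral_mono_ae (integrable_exp_neg_mul_norm_sq hΛ x) (integrable_const _) ?_
  filter_upwards [hΛ] with t ht
  rw [Real.exp_le_one_iff]
  nlinarith [sq_nonneg ‖x‖]

@[fun_prop]
lemma measurable_gaussMix (Λ : Measure ℝ) [SFinite Λ] :
    Measurable (gaussMix Λ : Space d → ℝ) := by
  unfold gaussMix
  exact (StronglyMeasurable.integral_prod_right (f := fun (x : Space d) t =>
    Real.exp (-t * ‖x‖ ^ 2)) (Measurable.stronglyMeasurable (by fun_prop))).measurable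

lemma lintegral_exp_neg_mul_sq {t : ℝ} (ht : 0 < t) (x : Space d) :
    ∫⁻ y : Space d, ENNReal.ofReal (Real.exp (-t * ‖x - y‖ ^ 2)) =
      ENNReal.ofReal (Real.pi ^ ((d : ℝ) / 2) * t ^ (-(d : ℝ) / 2)) := by
  rw [lintegral_sub_left_eq_self (fun y : Space d => ENNReal.ofReal (Real.exp (-t * ‖y‖ ^ 2))) x]
  have h := GaussianFourier.integral_rexp_neg_mul_sq_norm (V := Space d) ht
  rw [← ofReal_integral_eq_lintegral_ofReal _ (Eventually.of_forall fun _ => Real.exp_nonneg _), h,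
    finrank_euclideanSpace_fin, Real.div_rpow Real.pi_pos.le ht.le, neg_div, Real.rpow_neg ht.le,
    ← div_eq_mul_inv]
  exact Integrable.of_integral_ne_zero (by rw [h]; positivity)

lemma HasDensityLE.le {μ : Measure (Space d)} {K : ℝ} (hμ : HasDensityLE μ K) :
    μ ≤ ENNReal.ofReal K • volume := by
  obtain ⟨ρ, -, -, hK, rfl⟩ := hμ
  rw [← withDensity_const]
  exact withDensity_mono (hK.mono fun x hx => ENNReal.ofReal_le_ofReal hx)

/-- The regularized potentials of bounded densities are uniformly bounded. -/
lemma lintegral_gaussMix_le (hk : 0 < k) (hkd : k < d) {K : ℝ} (hK : 0 < K) :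
    ∃ C : ℝ, 0 < C ∧ ∀ a, 0 < a → ∀ (μ : Measure (Space d)) [IsProbabilityMeasure μ],
      HasDensityLE μ K → ∀ x, ∫⁻ y, ENNReal.ofReal (gaussMix (rieszMixture d k a) (x - y)) ∂μ ≤
        ENNReal.ofReal C := by
  have hΓ := Real.Gamma_pos_of_pos (half_pos hk)
  have hdk : 0 < (d - k) / 2 := by linarith
  refine ⟨(1 / (k / 2) + K * Real.pi ^ ((d : ℝ) / 2) / ((d - k) / 2)) / Real.Gamma (k / 2),
    by positivity, fun a ha μ _ hμ x => ?_⟩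
  have := isFiniteMeasure_rieszMixture hk hkd ha
  simp_rw [ofReal_gaussMix (ae_rieszMixture_pos (d := d) (k := k) (a := a))]
  rw [lintegral_lintegral_swap (by fun_prop)]
  refine lintegral_rieszMixture_le hk hkd (by positivity) (fun t ht => ?_) fun t ht => ?_
  · calc ∫⁻ y, ENNReal.ofReal (Real.exp (-t * ‖x - y‖ ^ 2)) ∂μ ≤ ∫⁻ y, 1 ∂μ := by
          refine lintegral_mono fun y => ENNReal.ofReal_le_one.2 (Real.exp_le_one_iff.2 ?_)
          nlinarith [sq_nonneg ‖x - y‖]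
      _ = 1 := by simp
  · refine (lintegral_mono' hμ.le le_rfl).trans_eq ?_
    rw [lintegral_smul_measure, lintegral_exp_neg_mul_sq ht, mul_assoc, ENNReal.ofReal_mul hK.le,
      smul_eq_mul]

lemma ofReal_rieszPotential (hk : 0 < k) {x : Space d} (hx : x ≠ 0) :
    ENNReal.ofReal (rieszPotential d k x) = ∫⁻ t in Ioi 0,
      ENNReal.ofReal (t ^ (k / 2 - 1) / Real.Gamma (k / 2) * Real.exp (-t * ‖x‖ ^ 2)) := by
  have hΓ := Real.Gamma_pos_of_pos (half_pos hk)
  have hx' : 0 < ‖x‖ := norm_pos_iff.2 hx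
  have h := Real.integral_rpow_mul_exp_neg_mul_Ioi (half_pos hk) (r := ‖x‖ ^ 2) (by positivity)
  have h' : ∫ t in Ioi (0 : ℝ), t ^ (k / 2 - 1) / Real.Gamma (k / 2) * Real.exp (-t * ‖x‖ ^ 2) =
      rieszPotential d k x := by
    have e : ∀ t : ℝ, t ^ (k / 2 - 1) / Real.Gamma (k / 2) * Real.exp (-t * ‖x‖ ^ 2) =
        (Real.Gamma (k / 2))⁻¹ * (t ^ (k / 2 - 1) * Real.exp (-(‖x‖ ^ 2 * t))) := fun t => by
      rw [show -t * ‖x‖ ^ 2 = -(‖x‖ ^ 2 * t) by ring]; ring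
    simp_rw [e]
    rw [integral_const_mul, h, rieszPotential, mul_comm, mul_assoc, mul_inv_cancel₀ hΓ.ne', mul_one,
      one_div, ← Real.rpow_two, ← Real.rpow_neg hx'.le, ← Real.rpow_mul hx'.le]
    congr 1
    ring
  rw [← h', ofReal_integral_eq_lintegral_ofReal]
  · exact Integrable.of_integral_ne_zero (by
      rw [h', rieszPotential]; exact (Real.rpow_pos_of_pos hx' _).ne')
  · refine ae_restrict_of_forall_mem measurableSet_Ioi fun t ht => ?_
    have : (0 : ℝ) < t := ht
    positivity

lemma ofReal_gaussMix_rieszMixture (hk : 0 < k) (hkd : k < d) (ha : 0 < a) (x : Space d) :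
    ENNReal.ofReal (gaussMix (rieszMixture d k a) x) = ∫⁻ t in Ioi 0,
      ENNReal.ofReal (rieszWeight d k a t * Real.exp (-t * ‖x‖ ^ 2)) := by
  have := isFiniteMeasure_rieszMixture hk hkd ha
  rw [ofReal_gaussMix ae_rieszMixture_pos, lintegral_rieszMixture]
  refine setLIntegral_congr_fun measurableSet_Ioi fun t ht => ?_
  rw [ENNReal.ofReal_mul (rieszWeight_nonneg hk ht)]

lemma gaussMix_rieszMixture_le (hk : 0 < k) (hkd : k < d) (ha : 0 < a) {x : Space d} (hx : x ≠ 0) :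
    gaussMix (rieszMixture d k a) x ≤ rieszPotential d k x := by
  have hV : 0 ≤ rieszPotential d k x := Real.rpow_nonneg (norm_nonneg _) _
  rw [← ENNReal.ofReal_le_ofReal_iff hV, ofReal_gaussMix_rieszMixture hk hkd ha,
    ofReal_rieszPotential hk hx]
  refine setLIntegral_mono' measurableSet_Ioi fun t ht => ENNReal.ofReal_le_ofReal ?_
  gcongr
  exact rieszWeight_le hk ht

/-- The error of the regularization is of order `a^{d-k}` in `L¹`. -/
lemma lintegral_rieszPotential_sub_le (hk : 0 < k) (hkd : k < d) :
    ∃ C : ℝ, 0 < C ∧ ∀ a, 0 < a → ∀ x, ∫⁻ y : Space d, ENNReal.ofReal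
      (rieszPotential d k (x - y) - gaussMix (rieszMixture d k a) (x - y)) ≤
        ENNReal.ofReal (C * a ^ (d - k)) := by
  have hΓ := Real.Gamma_pos_of_pos (half_pos hk)
  have hdk : 0 < (d - k) / 2 := by linarith
  refine ⟨Real.pi ^ ((d : ℝ) / 2) / Real.Gamma (k / 2) * (1 / ((d - k) / 2)), by positivity,
    fun a ha x => ?_⟩
  have hd : Nonempty (Fin d) := by
    rcases d with _ | d
    · norm_num at hkd; linarith
    · exact ⟨0⟩
  have hx : ∀ᵐ y : Space d, x - y ≠ 0 := by
    have : ∀ᵐ y : Space d, y ≠ x := by simp [ae_iff]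
    filter_upwards [this] with y hy using sub_ne_zero.2 hy.symm
  have key : ∀ᵐ y : Space d, ENNReal.ofReal
      (rieszPotential d k (x - y) - gaussMix (rieszMixture d k a) (x - y)) ≤
      ∫⁻ t in Ioi 0, ENNReal.ofReal ((t ^ (k / 2 - 1) / Real.Gamma (k / 2) - rieszWeight d k a t) *
        Real.exp (-t * ‖x - y‖ ^ 2)) := by
    filter_upwards [hx] with y hy
    rw [ENNReal.ofReal_sub _ (gaussMix_nonneg _ _), ofReal_rieszPotential hk hy,
      ofReal_gaussMix_rieszMixture hk hkd ha, tsub_le_iff_right, ← lintegral_add_left (by fun_prop)]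
    refine setLIntegral_mono' measurableSet_Ioi fun t ht => ?_
    rw [← ENNReal.ofReal_add (mul_nonneg (sub_nonneg.2 (rieszWeight_le hk ht)) (Real.exp_nonneg _))
      (mul_nonneg (rieszWeight_nonneg hk ht) (Real.exp_nonneg _))]
    exact ENNReal.ofReal_le_ofReal (le_of_eq (by ring))
  refine (lintegral_mono_ae key).trans ?_
  rw [lintegral_lintegral_swap (by fun_prop)]
  -- The weights coincide for t ≤ a⁻², hence A = 0 with a dummy exponent r. For larger t the
  -- Gaussian has integral of order t^{-d/2}, and the tail integral gives a^{d-k}.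
  refine (setLIntegral_Ioi_zero_le (r := 0) (s := k / 2 - 1 + -(d : ℝ) / 2) (T := (a ^ 2)⁻¹)
    (A := 0) (B := Real.pi ^ ((d : ℝ) / 2) / Real.Gamma (k / 2)) le_rfl
    (by positivity) (by linarith) (by linarith) (by positivity) ?_ ?_).trans
    (ENNReal.ofReal_le_ofReal (le_of_eq ?_))
  · intro t ht hta
    rw [rieszWeight_eq ha ht hta]
    simp
  · intro t ht
    have ht0 : 0 < t := lt_trans (by positivity) ht
    calc ∫⁻ y : Space d, ENNReal.ofReal ((t ^ (k / 2 - 1) / Real.Gamma (k / 2) -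
          rieszWeight d k a t) * Real.exp (-t * ‖x - y‖ ^ 2))
        ≤ ∫⁻ y : Space d, ENNReal.ofReal (t ^ (k / 2 - 1) / Real.Gamma (k / 2)) *
          ENNReal.ofReal (Real.exp (-t * ‖x - y‖ ^ 2)) := by
          refine lintegral_mono fun y => ?_
          rw [← ENNReal.ofReal_mul (by positivity)]
          refine ENNReal.ofReal_le_ofReal ?_
          gcongr
          linarith [rieszWeight_nonneg (d := d) (a := a) hk ht0]
      _ = _ := by
          rw [lintegral_const_mul' _ _ ENNReal.ofReal_ne_top, lintegral_exp_neg_mul_sq ht0,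
            ← ENNReal.ofReal_mul (by positivity), Real.rpow_add ht0]
          congr 1
          ring
  · have e1 : ((a ^ 2)⁻¹ : ℝ) = a ^ (-2 : ℝ) := by
      rw [Real.rpow_neg ha.le, Real.rpow_two]
    rw [e1, zero_mul, zero_add, ← Real.rpow_mul ha.le,
      show -2 * (k / 2 - 1 + -(d : ℝ) / 2 + 1) = d - k by ring,
      show -(k / 2 - 1 + -(d : ℝ) / 2 + 1) = (d - k) / 2 by ring]
    ring

lemma lintegral_Ioi_eq_mul_comp_mul {c : ℝ} (hc : 0 < c) {f : ℝ → ℝ≥0∞} (hf : Measurable f) :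
    ∫⁻ t in Ioi 0, f t = ENNReal.ofReal c * ∫⁻ t in Ioi 0, f (c * t) := by
  have h : Measure.map (c * ·) (volume.restrict (Ioi (0 : ℝ))) =
      ENNReal.ofReal c⁻¹ • volume.restrict (Ioi 0) := by
    have hp : (c * ·) ⁻¹' Ioi (0 : ℝ) = Ioi 0 := by
      ext t; simp [hc]
    nth_rewrite 1 [← hp]
    rw [← Measure.restrict_map (by fun_prop) measurableSet_Ioi, Real.map_volume_mul_left hc.ne',
      abs_of_pos (inv_pos.2 hc), Measure.restrict_smul]
  rw [← lintegral_map hf (by fun_prop : Measurable (c * ·)), h, lintegral_smul_measure, smul_eq_mul,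
    ← mul_assoc, ← ENNReal.ofReal_mul hc.le, mul_inv_cancel₀ hc.ne', ENNReal.ofReal_one, one_mul]

/-- The spectral density is a moderate weight, uniformly in `a`. -/
lemma spectralDensity_le_mul (hk : 0 < k) {L : ℝ} (hL : 1 ≤ L)
    {ζ ξ : Space d} (h : ‖ξ‖ ≤ L * ‖ζ‖) :
    spectralDensity (rieszMixture d k a) ζ ≤
      ENNReal.ofReal (L ^ (3 * d)) * spectralDensity (rieszMixture d k a) ξ := by
  have hΓ := Real.Gamma_pos_of_pos (half_pos hk)
  have hL0 : 0 < L := by linarith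
  have hL2 : 0 < L ^ 2 := by positivity
  unfold spectralDensity
  -- Substituting t ↦ L²t matches the Gaussian at ξ with the one at ζ. The Jacobian accounts for the
  -- factor L² of `hw`; the damping leaves L^{2d} and the Gaussian normalization L^d, hence the
  -- exponent 3d.
  rw [lintegral_rieszMixture, lintegral_rieszMixture (f := fun t => ENNReal.ofReal (gaussDensity t ξ)),
    lintegral_Ioi_eq_mul_comp_mul hL2 (f := fun t => ENNReal.ofReal (rieszWeight d k a t) *
      ENNReal.ofReal (gaussDensity t ξ)) (by fun_prop), ← mul_assoc,
    ← ENNReal.ofReal_mul (by positivity), ← lintegral_const_mul' _ _ ENNReal.ofReal_ne_top]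
  refine setLIntegral_mono' measurableSet_Ioi fun t ht => ?_
  have ht : 0 < t := ht
  have hLt : 0 < L ^ 2 * t := by positivity
  rw [← ENNReal.ofReal_mul (rieszWeight_nonneg hk ht),
    ← ENNReal.ofReal_mul (rieszWeight_nonneg hk hLt), ← ENNReal.ofReal_mul (by positivity)]
  refine ENNReal.ofReal_le_ofReal ?_
  -- This is why the damping is polynomial: an exponential one would lose an unbounded factor under
  -- t ↦ L²t.
  have hw : rieszWeight d k a t ≤ L ^ 2 * L ^ (2 * d) * rieszWeight d k a (L ^ 2 * t) := by
    unfold rieszWeight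
    have h1 : min 1 (((a ^ 2 * t) ^ d)⁻¹) ≤
        L ^ (2 * d) * min 1 (((a ^ 2 * (L ^ 2 * t)) ^ d)⁻¹) := by
      rw [mul_min_of_nonneg _ _ (by positivity), mul_one]
      refine min_le_min (one_le_pow₀ hL) (le_of_eq ?_)
      rw [show a ^ 2 * (L ^ 2 * t) = L ^ 2 * (a ^ 2 * t) by ring, mul_pow (L ^ 2), ← pow_mul,
        mul_inv, ← mul_assoc, mul_inv_cancel₀ (by positivity), one_mul]
    have h2 : t ^ (k / 2 - 1) ≤ L ^ 2 * (L ^ 2 * t) ^ (k / 2 - 1) := by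
      rw [Real.mul_rpow hL2.le ht.le, ← mul_assoc, ← Real.rpow_one_add' hL2.le (by linarith)]
      refine le_mul_of_one_le_left (by positivity) (Real.one_le_rpow (one_le_pow₀ hL) (by linarith))
    calc _ ≤ (L ^ 2 * (L ^ 2 * t) ^ (k / 2 - 1)) / Real.Gamma (k / 2) *
          (L ^ (2 * d) * min 1 (((a ^ 2 * (L ^ 2 * t)) ^ d)⁻¹)) := by gcongr
      _ = _ := by ring
  have hg : gaussDensity t ζ ≤ L ^ d * gaussDensity (L ^ 2 * t) ξ := by
    unfold gaussDensity
    have h1 : (Real.pi / t) ^ ((d : ℝ) / 2) = L ^ d * (Real.pi / (L ^ 2 * t)) ^ ((d : ℝ) / 2) := by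
      rw [show Real.pi / t = L ^ 2 * (Real.pi / (L ^ 2 * t)) by field_simp,
        Real.mul_rpow hL2.le (by positivity), ← Real.rpow_two, ← Real.rpow_mul hL0.le,
        mul_div_cancel₀ _ two_ne_zero, Real.rpow_natCast]
    rw [h1, mul_assoc]
    gcongr _ * (_ * Real.exp ?_)
    have h2 : ‖ξ‖ ^ 2 ≤ L ^ 2 * ‖ζ‖ ^ 2 := by
      rw [← mul_pow]; gcongr
    rw [div_le_div_iff₀ ht hLt]
    nlinarith [mul_le_mul_of_nonneg_left h2 (show 0 ≤ Real.pi ^ 2 * t by positivity)]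
  calc _ ≤ (L ^ 2 * L ^ (2 * d) * rieszWeight d k a (L ^ 2 * t)) *
        (L ^ d * gaussDensity (L ^ 2 * t) ξ) :=
      mul_le_mul hw hg (gaussDensity_nonneg ht _)
        (mul_nonneg (by positivity) (rieszWeight_nonneg hk hLt))
    _ = _ := by ring

/-- A larger scale damps more. This reduces lower bounds for all a ≤ 1 to the case a = 1. -/
lemma spectralDensity_anti (hk : 0 < k) (ha : 0 < a) {b : ℝ} (hab : a ≤ b) (ξ : Space d) :
    spectralDensity (rieszMixture d k b) ξ ≤ spectralDensity (rieszMixture d k a) ξ := by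
  have hΓ := Real.Gamma_pos_of_pos (half_pos hk)
  unfold spectralDensity
  rw [lintegral_rieszMixture, lintegral_rieszMixture]
  refine setLIntegral_mono' measurableSet_Ioi fun t ht => ?_
  have ht : 0 < t := ht
  gcongr
  unfold rieszWeight
  gcongr

/-- The spectral density is bounded below by a power weight, uniformly in `a ≤ 1`. -/
lemma exists_le_spectralDensity (hk : 0 < k) (hkd : k < d) :
    ∃ c : ℝ≥0∞, c ≠ 0 ∧ c ≠ ∞ ∧ ∀ a, 0 < a → a ≤ 1 → ∀ ξ : Space d,
      c ≤ ENNReal.ofReal ((1 + ‖ξ‖) ^ (3 * d)) * spectralDensity (rieszMixture d k a) ξ := by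
  have hΓ := Real.Gamma_pos_of_pos (half_pos hk)
  have hd : 0 < d := by
    have : (0 : ℝ) < d := by linarith
    exact_mod_cast this
  set e : Space d := EuclideanSpace.single ⟨0, hd⟩ 1 with he
  have hne : ‖e‖ = 1 := by simp [he]
  -- Every ξ is compared with the unit vector e, with L = 1 + ‖ξ‖. The minimum with 1 only keeps the
  -- constant finite.
  refine ⟨min 1 (spectralDensity (rieszMixture d k 1) e), ?_, ?_, fun a ha ha1 ξ => ?_⟩
  · refine (lt_min one_pos ?_).ne'
    unfold spectralDensity
    rw [lintegral_rieszMixture, setLIntegral_pos_iff (by fun_prop)]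
    refine lt_of_lt_of_le (b := volume (Ioi (0 : ℝ))) (by simp) (measure_mono fun t ht => ⟨?_, ht⟩)
    have ht : 0 < t := ht
    simp only [Function.mem_support]
    refine mul_ne_zero ?_ ?_
    · rw [ENNReal.ofReal_ne_zero_iff]
      unfold rieszWeight
      have : 0 < min 1 (((1 ^ 2 * t) ^ d)⁻¹) := lt_min one_pos (by positivity)
      positivity
    · rw [ENNReal.ofReal_ne_zero_iff]
      unfold gaussDensity
      positivity
  · exact ((min_le_left _ _).trans_lt ENNReal.one_lt_top).ne
  · refine (min_le_right _ _).trans ((spectralDensity_anti hk ha ha1 e).trans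
      (spectralDensity_le_mul hk (by linarith [norm_nonneg ξ]) ?_))
    rw [hne]
    linarith
end

/-! ### Convolution in moderate weighted L² spaces, and multiplication by S∗Q -/

lemma sq_lintegral_mul_le {X : Type*} [MeasurableSpace X] {μ : Measure X} {f g : X → ℝ≥0∞}
    (hf : Measurable f) (hg : Measurable g) :
    (∫⁻ x, f x * g x ∂μ) ^ 2 ≤ (∫⁻ x, f x ^ 2 ∂μ) * ∫⁻ x, g x ^ 2 ∂μ := by
  have h := ENNReal.lintegral_mul_le_Lp_mul_Lq μ (Real.HolderConjugate.two_two)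
    hf.aemeasurable hg.aemeasurable
  simp only [Pi.mul_apply, ENNReal.rpow_two] at h
  calc _ ≤ ((∫⁻ x, f x ^ 2 ∂μ) ^ (1 / 2 : ℝ) * (∫⁻ x, g x ^ 2 ∂μ) ^ (1 / 2 : ℝ)) ^ 2 := by gcongr
    _ = _ := by
      rw [mul_pow, ← ENNReal.rpow_two, ← ENNReal.rpow_two, ← ENNReal.rpow_mul, ← ENNReal.rpow_mul]
      norm_num

lemma sq_lintegral_mul_le' {X : Type*} [MeasurableSpace X] {μ : Measure X} {f g : X → ℝ≥0∞}
    (hf : Measurable f) (hg : Measurable g) :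
    (∫⁻ x, f x * g x ∂μ) ^ 2 ≤ (∫⁻ x, f x ∂μ) * ∫⁻ x, f x * g x ^ 2 ∂μ := by
  have e : ∀ x, f x ^ (1 / 2 : ℝ) * f x ^ (1 / 2 : ℝ) = f x := fun x => by
    rw [← ENNReal.rpow_add_of_nonneg _ _ (by norm_num) (by norm_num)]
    norm_num
  have h := sq_lintegral_mul_le (μ := μ) (f := fun x => f x ^ (1 / 2 : ℝ))
    (g := fun x => f x ^ (1 / 2 : ℝ) * g x) (by fun_prop) (by fun_prop)
  have e2 : ∀ x, (f x ^ (1 / 2 : ℝ)) ^ 2 = f x := fun x => by rw [sq, e]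
  simpa only [← mul_assoc, mul_pow, e, e2] using h

section
variable {d : ℕ}

/-- The polynomial weight `(1 + ‖ξ‖)^n`. -/
def polyWeight (n : ℕ) (ξ : Space d) : ℝ≥0∞ := ENNReal.ofReal ((1 + ‖ξ‖) ^ n)

@[fun_prop]
lemma measurable_polyWeight (n : ℕ) : Measurable (polyWeight n : Space d → ℝ≥0∞) := by
  unfold polyWeight
  fun_prop

lemma one_le_polyWeight (n : ℕ) (ξ : Space d) : 1 ≤ polyWeight n ξ :=
  ENNReal.one_le_ofReal.2 (one_le_pow₀ (by linarith [norm_nonneg ξ]))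

lemma polyWeight_ne_top (n : ℕ) (ξ : Space d) : polyWeight n ξ ≠ ∞ := ENNReal.ofReal_ne_top

lemma polyWeight_add_le (n : ℕ) (ζ η : Space d) :
    polyWeight n (ζ + η) ≤ polyWeight n ζ * polyWeight n η := by
  unfold polyWeight
  rw [← ENNReal.ofReal_mul (by positivity), ← mul_pow]
  refine ENNReal.ofReal_le_ofReal (pow_le_pow_left₀ (by positivity) ?_ n)
  nlinarith [norm_add_le ζ η, mul_nonneg (norm_nonneg ζ) (norm_nonneg η)]

/-- A weight on frequency space that is moderate away from the origin, bounded below by a power and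
integrable near the origin. -/
structure IsModerate (n : ℕ) (c C : ℝ≥0∞) (w : Space d → ℝ≥0∞) : Prop where
  measurable : Measurable w
  le_mul : ∀ L : ℝ, 1 ≤ L → ∀ ζ ξ : Space d, ‖ξ‖ ≤ L * ‖ζ‖ → w ζ ≤ ENNReal.ofReal (L ^ n) * w ξ
  lower : ∀ ξ, c ≤ polyWeight n ξ * w ξ
  lintegral_ball_le : ∫⁻ ξ in Metric.ball (0 : Space d) 1, w ξ ≤ C

variable {n : ℕ} {c C : ℝ≥0∞} {w : Space d → ℝ≥0∞}

/-- Cauchy–Schwarz after inserting the polynomial weight at ζ + η and its inverse: G absorbs the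
growth, and the inverse is at most c⁻¹ w. The variation of w plays no role, so the bound serves near
the origin, where w may be singular, and gives pointwise bounds at ζ = 0. -/
lemma IsModerate.sq_lintegral_le (hw : IsModerate n c C w) (hc : c ≠ 0) (hc' : c ≠ ∞)
    {G U : Space d → ℝ≥0∞} (hG : Measurable G) (hU : Measurable U) (ζ : Space d) :
    (∫⁻ η, G η * U (ζ + η)) ^ 2 ≤ polyWeight n ζ ^ 2 * (∫⁻ η, (G η * polyWeight n η) ^ 2) *
      (c⁻¹ * ∫⁻ ξ, U ξ ^ 2 * w ξ) := by
  have hwm := hw.measurable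
  have h0 : ∀ η : Space d, polyWeight n η ≠ 0 := fun η =>
    (lt_of_lt_of_le one_pos (one_le_polyWeight n η)).ne'
  have h := sq_lintegral_mul_le (μ := volume) (f := fun η => G η * polyWeight n (ζ + η))
    (g := fun η => (polyWeight n (ζ + η))⁻¹ * U (ζ + η)) (by fun_prop) (by fun_prop)
  have e : ∀ η, G η * polyWeight n (ζ + η) * ((polyWeight n (ζ + η))⁻¹ * U (ζ + η)) =
      G η * U (ζ + η) := fun η => by
    rw [mul_assoc, ← mul_assoc (polyWeight n (ζ + η)), ENNReal.mul_inv_cancel (h0 _)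
      (polyWeight_ne_top _ _), one_mul]
  simp_rw [e] at h
  refine h.trans (mul_le_mul' ?_ ?_)
  · rw [← lintegral_const_mul _ (by fun_prop)]
    refine lintegral_mono fun η => ?_
    rw [← mul_pow]
    refine pow_le_pow_left₀ zero_le ?_ 2
    rw [mul_left_comm]
    gcongr
    exact polyWeight_add_le n ζ η
  · rw [← lintegral_const_mul _ (by fun_prop), ← lintegral_add_left_eq_self
      (fun ξ => c⁻¹ * (U ξ ^ 2 * w ξ)) ζ]
    refine lintegral_mono fun η => ?_
    set ξ := ζ + η
    have h1 : (polyWeight n ξ)⁻¹ ≤ c⁻¹ * w ξ := by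
      rw [ENNReal.inv_le_iff_le_mul (fun _ => h0 ξ) (fun h => absurd h (polyWeight_ne_top n ξ)),
        mul_left_comm]
      calc 1 = c⁻¹ * c := (ENNReal.inv_mul_cancel hc hc').symm
        _ ≤ _ := by gcongr; exact hw.lower ξ
    have h2 : (polyWeight n ξ)⁻¹ ≤ 1 := ENNReal.inv_le_one.2 (one_le_polyWeight n ξ)
    calc ((polyWeight n ξ)⁻¹ * U ξ) ^ 2 = (polyWeight n ξ)⁻¹ * (polyWeight n ξ)⁻¹ * U ξ ^ 2 := by
          ring
      _ ≤ 1 * (c⁻¹ * w ξ) * U ξ ^ 2 := by gcongr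
      _ = _ := by ring

/-- Convolution with a rapidly decreasing function is bounded on a moderate weighted `L²` space. -/
lemma IsModerate.lintegral_sq_lintegral_le (hw : IsModerate n c C w) (hc : c ≠ 0) (hc' : c ≠ ∞)
    {G U : Space d → ℝ≥0∞} (hG : Measurable G) (hU : Measurable U) :
    ∫⁻ ζ, (∫⁻ η, G η * U (ζ + η)) ^ 2 * w ζ ≤
      (4 ^ n * (∫⁻ η, (G η * polyWeight n η) ^ 2) * c⁻¹ * C +
        (∫⁻ η, G η) * ∫⁻ η, G η * polyWeight n η) * ∫⁻ ξ, U ξ ^ 2 * w ξ := by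
  have hwm := hw.measurable
  rw [← lintegral_add_compl _ (Metric.isOpen_ball (x := (0 : Space d)) (ε := 1)).measurableSet,
    add_mul]
  gcongr ?_ + ?_
  -- Near the origin w is not compared with its translates: the pointwise bound is multiplied by the
  -- integral of w. The factor 4^n bounds the squared polynomial weight on the unit ball.
  · calc ∫⁻ ζ in Metric.ball 0 1, (∫⁻ η, G η * U (ζ + η)) ^ 2 * w ζ
        ≤ ∫⁻ ζ in Metric.ball 0 1, (4 ^ n * (∫⁻ η, (G η * polyWeight n η) ^ 2) *
          (c⁻¹ * ∫⁻ ξ, U ξ ^ 2 * w ξ)) * w ζ := by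
          refine setLIntegral_mono' Metric.isOpen_ball.measurableSet fun ζ hζ => ?_
          gcongr
          refine (hw.sq_lintegral_le hc hc' hG hU ζ).trans ?_
          refine mul_le_mul' (mul_le_mul' ?_ le_rfl) le_rfl
          rw [polyWeight, ← ENNReal.ofReal_pow (by positivity), ← pow_mul, mul_comm n 2, pow_mul,
            show (4 : ℝ≥0∞) ^ n = ENNReal.ofReal (4 ^ n) by
              rw [ENNReal.ofReal_pow (by norm_num)]; norm_num]
          refine ENNReal.ofReal_le_ofReal (pow_le_pow_left₀ (by positivity) ?_ n)
          rw [mem_ball_zero_iff] at hζ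
          nlinarith [norm_nonneg ζ]
      _ ≤ (4 ^ n * (∫⁻ η, (G η * polyWeight n η) ^ 2) * (c⁻¹ * ∫⁻ ξ, U ξ ^ 2 * w ξ)) * C := by
          rw [lintegral_const_mul _ hwm]
          gcongr
          exact hw.lintegral_ball_le
      _ = _ := by ring
  -- For ‖ζ‖ ≥ 1 one has ‖ζ + η‖ ≤ (1 + ‖η‖)‖ζ‖, so moderateness moves w from ζ to ζ + η at a
  -- polynomial price in η. Cauchy–Schwarz for the measure G dη, Tonelli and translation invariance
  -- conclude.
  · calc ∫⁻ ζ in (Metric.ball 0 1)ᶜ, (∫⁻ η, G η * U (ζ + η)) ^ 2 * w ζ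
        ≤ ∫⁻ ζ in (Metric.ball 0 1)ᶜ, (∫⁻ η, G η) *
          ∫⁻ η, G η * polyWeight n η * (U (ζ + η) ^ 2 * w (ζ + η)) := by
          refine setLIntegral_mono' Metric.isOpen_ball.measurableSet.compl fun ζ hζ => ?_
          have hζ' : 1 ≤ ‖ζ‖ := by simpa using hζ
          calc (∫⁻ η, G η * U (ζ + η)) ^ 2 * w ζ
              ≤ (∫⁻ η, G η) * (∫⁻ η, G η * U (ζ + η) ^ 2) * w ζ := by
                refine mul_le_mul_left ?_ _
                exact sq_lintegral_mul_le' hG (by fun_prop)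
            _ ≤ _ := by
                rw [mul_assoc, ← lintegral_mul_const (w ζ) (f := fun η => G η * U (ζ + η) ^ 2)
                  (by fun_prop)]
                refine mul_le_mul' le_rfl (lintegral_mono fun η => ?_)
                have := hw.le_mul (1 + ‖η‖) (by linarith [norm_nonneg η]) ζ (ζ + η) (by
                  nlinarith [norm_add_le ζ η, norm_nonneg η])
                calc G η * U (ζ + η) ^ 2 * w ζ
                    ≤ G η * U (ζ + η) ^ 2 * (polyWeight n η * w (ζ + η)) := by gcongr; exact this
                  _ = _ := by ring
      _ ≤ ∫⁻ ζ, (∫⁻ η, G η) *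
          ∫⁻ η, G η * polyWeight n η * (U (ζ + η) ^ 2 * w (ζ + η)) := setLIntegral_le_lintegral _ _
      _ = _ := by
          rw [lintegral_const_mul _ (Measurable.lintegral_prod_right' (f := fun z : Space d × Space d =>
            G z.2 * polyWeight n z.2 * (U (z.1 + z.2) ^ 2 * w (z.1 + z.2))) (by fun_prop)),
            lintegral_lintegral_swap (by fun_prop), mul_assoc]
          congr 1
          rw [← lintegral_mul_const _ (by fun_prop)]
          refine lintegral_congr fun η => ?_
          dsimp only
          rw [lintegral_const_mul _ (by fun_prop),
            lintegral_add_right_eq_self (fun ζ => U ζ ^ 2 * w ζ) η]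

lemma exists_isModerate_spectralDensity {k : ℝ} (hk : 0 < k) (hkd : k < d) :
    ∃ c C : ℝ≥0∞, c ≠ 0 ∧ c ≠ ∞ ∧ C ≠ ∞ ∧ ∀ a, 0 < a → a ≤ 1 →
      IsModerate (3 * d) c C (spectralDensity (rieszMixture d k a) : Space d → ℝ≥0∞) := by
  obtain ⟨c, hc, hc', h⟩ := exists_le_spectralDensity (d := d) hk hkd
  obtain ⟨C, hC⟩ := setLIntegral_ball_spectralDensity_le (d := d) hk hkd
  exact ⟨c, _, hc, hc', ENNReal.ofReal_ne_top, fun a ha ha1 =>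
    ⟨by fun_prop, fun L hL ζ ξ h => spectralDensity_le_mul hk hL h, h a ha ha1, hC a⟩⟩

lemma SchwartzMap.exists_norm_le_rpow (s : 𝓢(Space d, ℂ)) (m : ℕ) :
    ∃ B : ℝ, 0 ≤ B ∧ ∀ η, ‖s η‖ * (1 + ‖η‖) ^ m ≤ B * (1 + ‖η‖) ^ (-((d : ℝ) + 1)) := by
  refine ⟨2 ^ (m + (d + 1)) * ((Finset.Iic (m + (d + 1), 0)).sup
    fun i => SchwartzMap.seminorm ℝ i.1 i.2) s, by positivity, fun η => ?_⟩
  have h := SchwartzMap.one_add_le_sup_seminorm_apply (𝕜 := ℝ) (m := (m + (d + 1), 0))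
    (k := m + (d + 1)) (n := 0) le_rfl le_rfl s η
  rw [norm_iteratedFDeriv_zero] at h
  have hp : 0 < 1 + ‖η‖ := by positivity
  rw [Real.rpow_neg hp.le, ← div_eq_mul_inv, le_div_iff₀ (by positivity),
    show ((d : ℝ) + 1) = ((d + 1 : ℕ) : ℝ) by push_cast; ring, Real.rpow_natCast]
  calc _ = (1 + ‖η‖) ^ (m + (d + 1)) * ‖s η‖ := by rw [pow_add]; ring
    _ ≤ _ := h

lemma SchwartzMap.lintegral_mul_polyWeight_ne_top (s : 𝓢(Space d, ℂ)) (m : ℕ) :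
    ∫⁻ η, ‖s η‖ₑ * polyWeight m η ≠ ∞ ∧ ∫⁻ η, (‖s η‖ₑ * polyWeight m η) ^ 2 ≠ ∞ := by
  obtain ⟨B, hB, h⟩ := s.exists_norm_le_rpow m
  have hint : Integrable (fun η : Space d => B * (1 + ‖η‖) ^ (-((d : ℝ) + 1))) :=
    (integrable_one_add_norm (by simp)).const_mul B
  have e : ∀ η, ‖s η‖ₑ * polyWeight m η = ENNReal.ofReal (‖s η‖ * (1 + ‖η‖) ^ m) := fun η => by
    rw [ENNReal.ofReal_mul (norm_nonneg _), ofReal_norm, polyWeight]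
  have fin : ∫⁻ η : Space d, ENNReal.ofReal (B * (1 + ‖η‖) ^ (-((d : ℝ) + 1))) < ∞ :=
    hint.lintegral_lt_top
  have fin2 : ∫⁻ η : Space d, ENNReal.ofReal B *
      ENNReal.ofReal (B * (1 + ‖η‖) ^ (-((d : ℝ) + 1))) < ∞ := by
    rw [lintegral_const_mul' _ _ ENNReal.ofReal_ne_top]
    exact ENNReal.mul_lt_top ENNReal.ofReal_lt_top fin
  refine ⟨(lt_of_le_of_lt (lintegral_mono fun η => ?_) fin).ne,
    (lt_of_le_of_lt (lintegral_mono fun η => ?_) fin2).ne⟩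
  · rw [e]
    exact ENNReal.ofReal_le_ofReal (h η)
  · rw [e, sq]
    refine mul_le_mul' (ENNReal.ofReal_le_ofReal ((h η).trans ?_)) (ENNReal.ofReal_le_ofReal (h η))
    refine mul_le_of_le_one_right hB (Real.rpow_le_one_of_one_le_of_nonpos ?_ ?_)
    · linarith [norm_nonneg η]
    · have : (0 : ℝ) ≤ d := by positivity
      linarith

lemma SchwartzMap.exists_fourier_representation (S : 𝓢(Space d, ℝ)) :
    ∃ s : 𝓢(Space d, ℂ), ∀ x, ∫ η, s η * character x η = (S x : ℂ) := by
  set Sc : 𝓢(Space d, ℂ) := S.postcompCLM Complex.ofRealCLM with hSc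
  refine ⟨𝓕 Sc, fun x => ?_⟩
  have h : 𝓕⁻ (𝓕 Sc) x = Sc x := by rw [FourierTransform.fourierInv_fourier_eq]
  rw [SchwartzMap.fourierInv_coe, Real.fourierInv_eq'] at h
  rw [show (S x : ℂ) = Sc x by simp [hSc], ← h]
  refine integral_congr_ae (Eventually.of_forall fun η => ?_)
  simp only [character, smul_eq_mul, mul_comm]
  rw [real_inner_comm]
  congr 2
  push_cast
  ring

/-- A convolution with `S`, in Fourier variables. -/
lemma convolution_eq_integral_transform {S : 𝓢(Space d, ℝ)} {s : 𝓢(Space d, ℂ)}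
    (hs : ∀ x, ∫ η, s η * character x η = (S x : ℂ)) {P : Measure (Space d)} [IsFiniteMeasure P]
    {u : Space d → ℝ} (hu : Integrable u P) (x : Space d) :
    ((∫ y, S (x - y) * u y ∂P : ℝ) : ℂ) =
      ∫ η, s η * character x η * (starRingEnd ℂ) (transform P u η) := by
  have e : ∀ η, s η * character x η * (starRingEnd ℂ) (transform P u η) =
      ∫ y, s η * character (x - y) η * u y ∂P := fun η => by
    rw [transform, ← integral_conj, ← integral_const_mul]
    refine integral_congr_ae (Eventually.of_forall fun y => ?_)
    simp only [character_sub_left, map_mul, Complex.conj_ofReal]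
    ring
  simp_rw [e]
  rw [integral_integral_swap, ← integral_complex_ofReal]
  · refine integral_congr_ae (Eventually.of_forall fun y => ?_)
    simp only
    rw [integral_mul_const, hs]
    push_cast
    ring
  · have hi : Integrable (fun z : Space d × Space d => s z.1 * u z.2) (volume.prod P) :=
      s.integrable.mul_prod hu.ofReal
    have e2 : (Function.uncurry fun (η y : Space d) => s η * character (x - y) η * (u y : ℂ)) =
        fun z => character (x - z.2) z.1 * (s z.1 * u z.2) := by
      ext z; simp only [Function.uncurry]; ring
    rw [e2]
    refine hi.mono (AEStronglyMeasurable.mul (Measurable.aestronglyMeasurable (by fun_prop))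
      hi.aestronglyMeasurable) (Eventually.of_forall fun z => ?_)
    simp [norm_character]

lemma lintegral_spectralMeasure (Λ : Measure ℝ) [SFinite Λ] (f : Space d → ℝ≥0∞)
    (hf : Measurable f) :
    ∫⁻ ξ, f ξ ∂(spectralMeasure d Λ) = ∫⁻ ξ, f ξ * spectralDensity Λ ξ := by
  rw [spectralMeasure, lintegral_withDensity_eq_lintegral_mul _ (by fun_prop) hf]
  exact lintegral_congr fun ξ => mul_comm _ _

/-- Multiplication by φ becomes a superposition of frequency shifts. In the application q is the
conjugate transform of a probability measure; only |q| ≤ 1 matters, whence the uniformity in that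
measure. -/
lemma enorm_transform_mul_le {s : Space d → ℂ} (hs : Integrable s) {q : Space d → ℂ}
    (hqm : Measurable q) (hq : ∀ η, ‖q η‖ ≤ 1) {φ : Space d → ℝ}
    (hφ : ∀ x, (φ x : ℂ) = ∫ η, s η * character x η * q η) {P : Measure (Space d)}
    [IsFiniteMeasure P] {u : Space d → ℝ} (hu : Integrable u P) (ζ : Space d) :
    ‖transform P (fun x => φ x * u x) ζ‖ₑ ≤ ∫⁻ η, ‖s η‖ₑ * ‖transform P u (ζ + η)‖ₑ := by
  have e : ∀ x, character x ζ * ((φ x * u x : ℝ) : ℂ) =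
      ∫ η, s η * q η * (character x (ζ + η) * u x) := fun x => by
    rw [Complex.ofReal_mul, hφ, mul_left_comm, mul_comm (∫ _, _), ← integral_const_mul]
    refine integral_congr_ae (Eventually.of_forall fun η => ?_)
    simp only [character_add_right]
    ring
  rw [transform]
  simp_rw [e]
  rw [integral_integral_swap]
  · simp_rw [integral_const_mul]
    refine (enorm_integral_le_lintegral_enorm _).trans (lintegral_mono fun η => ?_)
    rw [enorm_mul, enorm_mul, ← transform]
    gcongr
    refine mul_le_of_le_one_right zero_le ?_
    rw [← ofReal_norm]
    exact ENNReal.ofReal_le_one.2 (hq η)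
  · have hi : Integrable (fun z : Space d × Space d => (u z.1 : ℂ) * s z.2) (P.prod volume) :=
      hu.ofReal.mul_prod hs
    have e2 : (Function.uncurry fun (x η : Space d) =>
        s η * q η * (character x (ζ + η) * (u x : ℂ))) =
        fun z => q z.2 * character z.1 (ζ + z.2) * ((u z.1 : ℂ) * s z.2) := by
      ext z; simp only [Function.uncurry]; ring
    rw [e2]
    refine hi.mono (AEStronglyMeasurable.mul (Measurable.aestronglyMeasurable (by fun_prop))
      hi.aestronglyMeasurable) (Eventually.of_forall fun z => ?_)
    rw [norm_mul, norm_mul, norm_character, mul_one]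
    exact mul_le_of_le_one_left (norm_nonneg _) (hq _)

lemma measurable_convolution (S : 𝓢(Space d, ℝ)) (P : Measure (Space d)) [SFinite P]
    {u : Space d → ℝ} (hu : Measurable u) : Measurable fun x => ∫ y, S (x - y) * u y ∂P :=
  (StronglyMeasurable.integral_prod_right (f := fun x y => S (x - y) * u y)
    (((S.continuous.comp (continuous_fst.sub continuous_snd)).measurable.mul
      (hu.comp measurable_snd)).stronglyMeasurable)).measurable

/-- Multiplication by `S * Q` is bounded for the energy norm, uniformly in the regularization and in
the probability measure `Q`. -/
lemma exists_spectralEnergy_mul_le {k : ℝ} (hk : 0 < k) (hkd : k < d) (S : 𝓢(Space d, ℝ)) :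
    ∃ C : ℝ≥0∞, C ≠ ∞ ∧ ∀ a, 0 < a → a ≤ 1 → ∀ (P Q : Measure (Space d)) [IsFiniteMeasure P]
      [IsProbabilityMeasure Q] (u : Space d → ℝ), Measurable u → Integrable u P →
      spectralEnergy (spectralMeasure d (rieszMixture d k a)) P
        (fun x => (∫ y, S (x - y) ∂Q) * u x) ≤
      C * spectralEnergy (spectralMeasure d (rieszMixture d k a)) P u := by
  obtain ⟨s, hs⟩ := S.exists_fourier_representation
  obtain ⟨c, C, hc, hc', hC, hw⟩ := exists_isModerate_spectralDensity (d := d) hk hkd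
  obtain ⟨h1, h2⟩ := s.lintegral_mul_polyWeight_ne_top (3 * d)
  have h3 : ∫⁻ η, ‖s η‖ₑ ≠ ∞ := (s.integrable (μ := volume)).2.ne
  have hsm : Measurable fun η => ‖s η‖ₑ := s.continuous.enorm.measurable
  refine ⟨4 ^ (3 * d) * (∫⁻ η, (‖s η‖ₑ * polyWeight (3 * d) η) ^ 2) * c⁻¹ * C +
    (∫⁻ η, ‖s η‖ₑ) * ∫⁻ η, ‖s η‖ₑ * polyWeight (3 * d) η, by finiteness,
    fun a ha ha1 P Q _ _ u hum hu => ?_⟩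
  have hUm' : Measurable fun ξ => ‖transform P u ξ‖ₑ := (measurable_transform P hum).enorm
  have hSQ : Measurable fun x => ∫ y, S (x - y) ∂Q := by
    simpa using measurable_convolution S Q (measurable_const (a := (1 : ℝ)))
  refine le_trans ?_ ((hw a ha ha1).lintegral_sq_lintegral_le hc hc' hsm hUm' |>.trans_eq ?_)
  · unfold spectralEnergy
    rw [lintegral_spectralMeasure _ _ (((measurable_transform P
      (f := fun x => (∫ y, S (x - y) ∂Q) * u x) (hSQ.mul hum)).enorm).pow_const 2)]
    refine lintegral_mono fun ζ => ?_
    gcongr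
    refine enorm_transform_mul_le s.integrable
      (q := fun η => (starRingEnd ℂ) (transform Q (fun _ => 1) η))
      (Complex.continuous_conj.measurable.comp (measurable_transform Q measurable_const))
      (fun η => ?_) (fun x => ?_) hu ζ
    · rw [RCLike.norm_conj]
      exact (norm_transform_le Q _ η).trans_eq (by simp)
    · simpa using convolution_eq_integral_transform hs (P := Q) (integrable_const (1 : ℝ)) x
  · rw [spectralEnergy, lintegral_spectralMeasure _ _ (hUm'.pow_const 2)]

/-- Up to unimodular factors the convolution is the integral of the transforms of S and of u P, so
it is bounded by `IsModerate.sq_lintegral_le` at zero shift. -/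
lemma exists_enorm_convolution_sq_le {k : ℝ} (hk : 0 < k) (hkd : k < d) (S : 𝓢(Space d, ℝ)) :
    ∃ C : ℝ≥0∞, C ≠ ∞ ∧ ∀ a, 0 < a → a ≤ 1 → ∀ (P : Measure (Space d)) [IsFiniteMeasure P]
      (u : Space d → ℝ), Measurable u → Integrable u P → ∀ x,
      ‖∫ y, S (x - y) * u y ∂P‖ₑ ^ 2 ≤
      C * spectralEnergy (spectralMeasure d (rieszMixture d k a)) P u := by
  obtain ⟨s, hs⟩ := S.exists_fourier_representation
  obtain ⟨c, C, hc, hc', -, hw⟩ := exists_isModerate_spectralDensity (d := d) hk hkd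
  obtain ⟨h1, h2⟩ := s.lintegral_mul_polyWeight_ne_top (3 * d)
  have hsm : Measurable fun η => ‖s η‖ₑ := s.continuous.enorm.measurable
  refine ⟨polyWeight (3 * d) (0 : Space d) ^ 2 *
    (∫⁻ η, (‖s η‖ₑ * polyWeight (3 * d) η) ^ 2) * c⁻¹, ?_, fun a ha ha1 P _ u hum hu x => ?_⟩
  · have := polyWeight_ne_top (3 * d) (0 : Space d)
    finiteness
  · have hUm' : Measurable fun ξ => ‖transform P u ξ‖ₑ := (measurable_transform P hum).enorm
    rw [spectralEnergy, lintegral_spectralMeasure _ _ (hUm'.pow_const 2), mul_assoc]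
    refine le_trans ?_ ((hw a ha ha1).sq_lintegral_le hc hc' hsm hUm' 0)
    gcongr
    have h := convolution_eq_integral_transform hs hu x
    calc ‖∫ y, S (x - y) * u y ∂P‖ₑ = ‖((∫ y, S (x - y) * u y ∂P : ℝ) : ℂ)‖ₑ := by
          rw [← ofReal_norm, ← ofReal_norm, Complex.norm_real]
      _ ≤ _ := by
          rw [h]
          refine (enorm_integral_le_lintegral_enorm _).trans_eq (lintegral_congr fun η => ?_)
          rw [enorm_mul, enorm_mul, zero_add, ← ofReal_norm (character x η), norm_character,
            ← ofReal_norm (starRingEnd ℂ _), RCLike.norm_conj, ofReal_norm]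
          simp
end

/-! ### From a positive definite minorant to the potential off the diagonal -/

section
variable {d : ℕ}

-- Since Q lives on A, a second variable off A is distributed by μ, whose potential is at most κ.
-- The 2 is the mass of Q + μ in the first variable.
open scoped Classical in
lemma lintegral_prod_snd_le {Q μ : Measure (Space d)} [IsProbabilityMeasure Q]
    [IsProbabilityMeasure μ] {A : Set (Space d)} (hA : MeasurableSet A) (hQ : ∀ᵐ x ∂Q, x ∈ A)
    {F : Space d → ℝ≥0∞} (hF : Measurable F) {κ : ℝ≥0∞} (hκ : ∀ x, ∫⁻ y, F (x - y) ∂μ ≤ κ) :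
    ∫⁻ z, (if z.2 ∈ A then 0 else F (z.1 - z.2)) ∂((Q + μ).prod (Q + μ)) ≤ 2 * κ := by
  rw [lintegral_prod _ (Measurable.aemeasurable
    (Measurable.ite (measurable_snd hA) measurable_const (by fun_prop)))]
  calc ∫⁻ x, ∫⁻ y, (if y ∈ A then 0 else F (x - y)) ∂(Q + μ) ∂(Q + μ)
      ≤ ∫⁻ _, κ ∂(Q + μ) := by
        refine lintegral_mono fun x => ?_
        rw [lintegral_add_measure, lintegral_congr_ae (μ := Q) (g := fun _ => 0) (by
          filter_upwards [hQ] with y hy using if_pos hy), lintegral_zero, zero_add]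
        refine (lintegral_mono fun y => ?_).trans (hκ x)
        split_ifs
        exacts [zero_le, le_rfl]
    _ = 2 * κ := by
        rw [lintegral_const, Measure.add_apply, measure_univ, measure_univ, one_add_one_eq_two,
          mul_comm]

open scoped Classical in
lemma lintegral_prod_fst_le {Q μ : Measure (Space d)} [IsProbabilityMeasure Q]
    [IsProbabilityMeasure μ] {A : Set (Space d)} (hA : MeasurableSet A) (hQ : ∀ᵐ x ∂Q, x ∈ A)
    {F : Space d → ℝ≥0∞} (hF : Measurable F) (hev : ∀ x, F (-x) = F x) {κ : ℝ≥0∞}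
    (hκ : ∀ x, ∫⁻ y, F (x - y) ∂μ ≤ κ) :
    ∫⁻ z, (if z.1 ∈ A then 0 else F (z.1 - z.2)) ∂((Q + μ).prod (Q + μ)) ≤ 2 * κ := by
  rw [← lintegral_prod_swap]
  refine le_of_eq_of_le (lintegral_congr fun z => ?_) (lintegral_prod_snd_le hA hQ hF hκ)
  simp only [Prod.fst_swap, Prod.snd_swap]
  rw [← hev (z.2 - z.1), neg_sub]

/-- The sign of a point: `1` on `A`, `-1` outside. -/
def signOn (A : Set (Space d)) [DecidablePred (· ∈ A)] (x : Space d) : ℝ := if x ∈ A then 1 else -1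

lemma measurable_signOn {A : Set (Space d)} [DecidablePred (· ∈ A)] (hA : MeasurableSet A) :
    Measurable (signOn A) := Measurable.ite hA measurable_const measurable_const

lemma abs_signOn (A : Set (Space d)) [DecidablePred (· ∈ A)] (x : Space d) : |signOn A x| = 1 := by
  unfold signOn
  split_ifs <;> simp

open scoped Classical in
/-- Comparison of the off-diagonal energies for a potential `V` with the energies of a bounded
positive definite potential `W ≤ V`. -/
lemma offDiagonal_energy_le {Q μ : Measure (Space d)} [IsProbabilityMeasure Q]
    [IsProbabilityMeasure μ] {A : Set (Space d)} (hA : MeasurableSet A) (hQ : ∀ᵐ x ∂Q, x ∈ A)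
    {V W : Space d → ℝ} (hVm : Measurable V) (hWm : Measurable W) (hVe : ∀ x, V (-x) = V x)
    (hWe : ∀ x, W (-x) = W x) {w₀ κ s C m₀ : ℝ} (hW0 : ∀ x, 0 ≤ W x) (hWw : ∀ x, W x ≤ w₀)
    (hVW : ∀ x, x ≠ 0 → W x ≤ V x) (hκ0 : 0 ≤ κ)
    (hκ : ∀ x, ∫⁻ y, ENNReal.ofReal (V (x - y) - W (x - y)) ∂μ ≤ ENNReal.ofReal κ)
    (hV : IntegrableOn (fun z : Space d × Space d => V (z.1 - z.2)) (offDiagonal d)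
      ((Q + μ).prod (Q + μ)))
    (hdiag : ((Q + μ).prod (Q + μ)).real (offDiagonal d)ᶜ ≤ m₀) {v : Space d → ℝ} (hvm : Measurable v)
    (hC : 0 ≤ C) (hvs : ∀ x, |v x| ≤ s)
    (h0 : 0 ≤ ∫ z, W (z.1 - z.2) * (signOn A z.1 * signOn A z.2) ∂((Q + μ).prod (Q + μ)))
    (h1 : ∫ z, W (z.1 - z.2) * (signOn A z.1 * v z.2) ∂((Q + μ).prod (Q + μ)) ≤
      C * ∫ z, W (z.1 - z.2) * (signOn A z.1 * signOn A z.2) ∂((Q + μ).prod (Q + μ))) :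
    ∫ z in offDiagonal d, V (z.1 - z.2) * (signOn A z.1 * v z.2) ∂((Q + μ).prod (Q + μ)) ≤
      (s + C) * (∫ z in offDiagonal d, V (z.1 - z.2) * (signOn A z.1 * signOn A z.2)
        ∂((Q + μ).prod (Q + μ)) + (8 * κ + 2 * (w₀ * m₀))) := by
  set ρ := (Q + μ).prod (Q + μ) with hρ
  have hoff := measurableSet_offDiagonal d
  have hum := measurable_signOn hA
  have hs : 0 ≤ s := (abs_nonneg _).trans (hvs 0)
  have hw₀ : 0 ≤ w₀ := (hW0 0).trans (hWw 0)
  have hWint : Integrable (fun z : Space d × Space d => W (z.1 - z.2)) ρ :=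
    (integrable_const w₀).mono' (Measurable.aestronglyMeasurable (by fun_prop)) (Eventually.of_forall fun z => by
      rw [Real.norm_of_nonneg (hW0 _)]; exact hWw _)
  have hFint : IntegrableOn (fun z : Space d × Space d => V (z.1 - z.2) - W (z.1 - z.2))
      (offDiagonal d) ρ := hV.sub hWint.integrableOn
  have hF0 : ∀ z ∈ offDiagonal d, 0 ≤ V (z.1 - z.2) - W (z.1 - z.2) := fun z hz =>
    sub_nonneg.2 (hVW _ (sub_ne_zero.2 hz))
  -- Off the diagonal V = (V − W) + W. The term in W is completed to the whole space, where positive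
  -- definiteness applies, at the cost of a diagonal term.
  have hsplit : ∀ (g : Space d × Space d → ℝ) (b : ℝ), Measurable g → (∀ z, |g z| ≤ b) →
      IntegrableOn (fun z => (V (z.1 - z.2) - W (z.1 - z.2)) * g z) (offDiagonal d) ρ ∧
      ∫ z in offDiagonal d, V (z.1 - z.2) * g z ∂ρ =
        ∫ z in offDiagonal d, (V (z.1 - z.2) - W (z.1 - z.2)) * g z ∂ρ +
          ∫ z, W (z.1 - z.2) * g z ∂ρ - ∫ z in (offDiagonal d)ᶜ, W (z.1 - z.2) * g z ∂ρ ∧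
      |∫ z in (offDiagonal d)ᶜ, W (z.1 - z.2) * g z ∂ρ| ≤ w₀ * m₀ * b := by
    intro g b hg hgb
    have hb : 0 ≤ b := (abs_nonneg _).trans (hgb 0)
    have i1 : IntegrableOn (fun z => (V (z.1 - z.2) - W (z.1 - z.2)) * g z) (offDiagonal d) ρ :=
      hFint.mul_bdd hg.aestronglyMeasurable (Eventually.of_forall hgb)
    have i2 : Integrable (fun z => W (z.1 - z.2) * g z) ρ :=
      hWint.mul_bdd hg.aestronglyMeasurable (Eventually.of_forall hgb)
    refine ⟨i1, ?_, ?_⟩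
    · rw [← integral_add_compl hoff i2, ← add_assoc, add_sub_cancel_right,
        ← integral_add i1 i2.integrableOn]
      exact integral_congr_ae (Eventually.of_forall fun z => by ring)
    · rw [← Real.norm_eq_abs]
      refine (norm_setIntegral_le_of_norm_le_const (μ := ρ) (C := w₀ * b) (measure_lt_top _ _)
        fun z _ => ?_).trans ?_
      · rw [norm_mul, Real.norm_of_nonneg (hW0 _)]
        exact mul_le_mul (hWw _) (hgb z) (norm_nonneg _) hw₀
      · rw [mul_right_comm w₀]
        gcongr
  obtain ⟨iu, eu, du⟩ := hsplit (fun z => signOn A z.1 * signOn A z.2) 1 (by fun_prop)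
    fun z => by rw [abs_mul, abs_signOn, abs_signOn, one_mul]
  obtain ⟨iv, ev, dv⟩ := hsplit (fun z => signOn A z.1 * v z.2) s (by fun_prop)
    fun z => by rw [abs_mul, abs_signOn, one_mul]; exact hvs _
  -- the part of the mass of `V - W` that meets `μ`
  have hpart : ∀ B : Set (Space d × Space d), MeasurableSet B →
      (∫⁻ z, (if z ∈ B then 0 else ENNReal.ofReal (V (z.1 - z.2) - W (z.1 - z.2))) ∂ρ ≤
        2 * ENNReal.ofReal κ) →
      IntegrableOn (fun z => (V (z.1 - z.2) - W (z.1 - z.2)) * (if z ∈ B then 0 else 1))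
        (offDiagonal d) ρ ∧
      ∫ z in offDiagonal d, (V (z.1 - z.2) - W (z.1 - z.2)) * (if z ∈ B then 0 else 1) ∂ρ ≤
        2 * κ := by
    intro B hB hle
    have hm : Measurable fun z => if z ∈ B then (0 : ℝ) else 1 :=
      Measurable.ite hB measurable_const measurable_const
    have i1 : IntegrableOn (fun z => (V (z.1 - z.2) - W (z.1 - z.2)) *
        (if z ∈ B then (0 : ℝ) else 1)) (offDiagonal d) ρ :=
      hFint.mul_bdd (c := 1) hm.aestronglyMeasurable (Eventually.of_forall fun z => by
        split_ifs <;> simp)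
    refine ⟨i1, ?_⟩
    rw [← ENNReal.ofReal_le_ofReal_iff (by positivity), ofReal_integral_eq_lintegral_ofReal i1
      (ae_restrict_of_forall_mem hoff fun z hz => mul_nonneg (hF0 z hz) (by split_ifs <;> simp)),
      ENNReal.ofReal_mul zero_le_two, ENNReal.ofReal_ofNat]
    refine ((setLIntegral_le_lintegral _ _).trans (lintegral_mono fun z => ?_)).trans hle
    split_ifs <;> simp
  have hFm : Measurable fun x => ENNReal.ofReal (V x - W x) := by fun_prop
  obtain ⟨j1, k1⟩ := hpart (Prod.fst ⁻¹' A) (measurable_fst hA)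
    (lintegral_prod_fst_le hA hQ hFm (fun x => by rw [hVe, hWe]) hκ)
  obtain ⟨j2, k2⟩ := hpart (Prod.snd ⁻¹' A) (measurable_snd hA)
    (lintegral_prod_snd_le hA hQ hFm hκ)
  have j12 : IntegrableOn (fun z => ((V (z.1 - z.2) - W (z.1 - z.2)) *
      (if z ∈ Prod.fst ⁻¹' A then 0 else 1)) + ((V (z.1 - z.2) - W (z.1 - z.2)) *
      (if z ∈ Prod.snd ⁻¹' A then 0 else 1))) (offDiagonal d) ρ := j1.add j2
  -- The product of signs is −1 only on mixed pairs, so 1 is at most this product plus twice the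
  -- indicators of z₁ ∉ A and z₂ ∉ A. Each indicator carries a mass of at most 2κ, hence 8κ.
  have hmass : ∫ z in offDiagonal d, (V (z.1 - z.2) - W (z.1 - z.2)) ∂ρ ≤
      ∫ z in offDiagonal d, (V (z.1 - z.2) - W (z.1 - z.2)) * (signOn A z.1 * signOn A z.2) ∂ρ +
        8 * κ := by
    calc _ ≤ ∫ z in offDiagonal d, ((V (z.1 - z.2) - W (z.1 - z.2)) *
            (signOn A z.1 * signOn A z.2) + 2 * (((V (z.1 - z.2) - W (z.1 - z.2)) *
              (if z ∈ Prod.fst ⁻¹' A then 0 else 1)) + ((V (z.1 - z.2) - W (z.1 - z.2)) *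
              (if z ∈ Prod.snd ⁻¹' A then 0 else 1)))) ∂ρ := by
          refine setIntegral_mono_on hFint (iu.add (j12.const_mul 2)) hoff fun z hz => ?_
          have := hF0 z hz
          by_cases h1 : z.1 ∈ A <;> by_cases h2 : z.2 ∈ A <;> simp [signOn, h1, h2] <;> linarith
      _ ≤ _ := by
          rw [integral_add iu (j12.const_mul 2), integral_const_mul, integral_add j1 j2]
          linarith
  have hvF : ∫ z in offDiagonal d, (V (z.1 - z.2) - W (z.1 - z.2)) * (signOn A z.1 * v z.2) ∂ρ ≤
      s * ∫ z in offDiagonal d, (V (z.1 - z.2) - W (z.1 - z.2)) ∂ρ := by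
    rw [← integral_const_mul]
    refine setIntegral_mono_on iv (hFint.const_mul s) hoff fun z hz => ?_
    rw [mul_comm s]
    refine mul_le_mul_of_nonneg_left ((le_abs_self _).trans ?_) (hF0 z hz)
    rw [abs_mul, abs_signOn, one_mul]
    exact hvs _
  have hFnn : 0 ≤ ∫ z in offDiagonal d, (V (z.1 - z.2) - W (z.1 - z.2)) ∂ρ :=
    setIntegral_nonneg hoff hF0
  have du' := (le_abs_self _).trans du
  have dv' := (neg_le_abs _).trans dv
  rw [eu, ev]
  -- The part in V − W costs s times its mass and the part in W costs C times its energy. Both can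
  -- be given the factor s + C, because that mass and that energy are nonnegative. One w₀ m₀ pays
  -- for the diagonal term of each side.
  have m1 := mul_le_mul_of_nonneg_left hmass hs
  have m2 := mul_le_mul_of_nonneg_left (hFnn.trans hmass) hC
  have m3 := mul_nonneg hs h0
  have m4 := mul_le_mul_of_nonneg_left du' hs
  have m5 := mul_le_mul_of_nonneg_left du' hC
  have hm0 : 0 ≤ w₀ * m₀ := mul_nonneg hw₀ (measureReal_nonneg.trans hdiag)
  have m6 := mul_nonneg hC hm0
  nlinarith
end

/-! ### The functional inequality for the regularized potentials -/

section
variable {d : ℕ}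

lemma gaussMix_neg (Λ : Measure ℝ) (x : Space d) : gaussMix Λ (-x) = gaussMix Λ x := by
  simp [gaussMix]

lemma rieszPotential_neg (k : ℝ) (x : Space d) :
    rieszPotential d k (-x) = rieszPotential d k x := by
  simp [rieszPotential]

@[fun_prop]
lemma measurable_rieszPotential (k : ℝ) : Measurable (rieszPotential d k) := by
  unfold rieszPotential
  fun_prop

lemma SchwartzMap.exists_forall_abs_le (S : 𝓢(Space d, ℝ)) : ∃ B, 0 ≤ B ∧ ∀ x, |S x| ≤ B :=
  ⟨SchwartzMap.seminorm ℝ 0 0 S, apply_nonneg _ _, fun x => S.norm_le_seminorm ℝ x⟩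

lemma abs_integral_le_of_forall_abs_le {X : Type*} [MeasurableSpace X] (Q : Measure X)
    [IsProbabilityMeasure Q] {f : X → ℝ} {B : ℝ} (hf : ∀ x, |f x| ≤ B) : |∫ x, f x ∂Q| ≤ B := by
  simpa using norm_integral_le_of_norm_le_const (μ := Q) (f := f) (Eventually.of_forall hf)

lemma ENNReal.ofReal_le_ofReal_toReal_mul {x y : ℝ} {C : ℝ≥0∞} (hC : C ≠ ∞) (hy : 0 ≤ y)
    (h : ENNReal.ofReal x ≤ C * ENNReal.ofReal y) : x ≤ C.toReal * y := by
  rw [← ENNReal.ofReal_le_ofReal_iff (by positivity), ENNReal.ofReal_mul (by positivity),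
    ENNReal.ofReal_toReal hC]
  exact h

/-- The density of `h[Q] - h[μ]` with respect to `Q + μ`, for `Q` concentrated on `A` and `μ`
on its complement. -/
def sourceDensity (S : Space d → ℝ) (Q μ : Measure (Space d)) (A : Set (Space d))
    [DecidablePred (· ∈ A)] (x : Space d) : ℝ :=
  if x ∈ A then ∫ y, S (x - y) ∂Q else -∫ y, S (x - y) ∂μ

lemma abs_sourceDensity_le {S : Space d → ℝ} {Q μ : Measure (Space d)} [IsProbabilityMeasure Q]
    [IsProbabilityMeasure μ] {A : Set (Space d)} [DecidablePred (· ∈ A)] {B : ℝ}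
    (hB : ∀ x, |S x| ≤ B) (x : Space d) : |sourceDensity S Q μ A x| ≤ B := by
  unfold sourceDensity
  split_ifs
  · exact abs_integral_le_of_forall_abs_le Q fun y => hB _
  · rw [abs_neg]
    exact abs_integral_le_of_forall_abs_le μ fun y => hB _

lemma measurable_integral_sub (S : 𝓢(Space d, ℝ)) (Q : Measure (Space d)) [SFinite Q] :
    Measurable fun x => ∫ y, S (x - y) ∂Q := by
  simpa using measurable_convolution S Q (measurable_const (a := (1 : ℝ)))

lemma measurable_sourceDensity (S : 𝓢(Space d, ℝ)) (Q μ : Measure (Space d)) [SFinite Q] [SFinite μ]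
    {A : Set (Space d)} [DecidablePred (· ∈ A)] (hA : MeasurableSet A) :
    Measurable (sourceDensity S Q μ A) :=
  Measurable.ite hA (measurable_integral_sub S Q) (measurable_integral_sub S μ).neg

open scoped Classical in
/-- The functional inequality for the regularized, positive definite potentials. -/
lemma exists_regularized_energy_le {k : ℝ} (hk : 0 < k) (hkd : k < d) (S : 𝓢(Space d, ℝ)) {K : ℝ}
    (hK : 0 < K) :
    ∃ C : ℝ, 0 ≤ C ∧ ∀ a, 0 < a → a ≤ 1 → ∀ (Q μ : Measure (Space d)) [IsProbabilityMeasure Q]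
      [IsProbabilityMeasure μ], HasDensityLE μ K → ∀ A : Set (Space d), MeasurableSet A →
      (∀ᵐ x ∂Q, x ∈ A) → (∀ᵐ x ∂μ, x ∉ A) →
      ∫ z, gaussMix (rieszMixture d k a) (z.1 - z.2) * (signOn A z.1 * sourceDensity S Q μ A z.2)
          ∂((Q + μ).prod (Q + μ)) ≤
        C * ∫ z, gaussMix (rieszMixture d k a) (z.1 - z.2) * (signOn A z.1 * signOn A z.2)
          ∂((Q + μ).prod (Q + μ)) := by
  obtain ⟨C₁, hC₁, hmul⟩ := exists_spectralEnergy_mul_le hk hkd S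
  obtain ⟨C₂, hC₂, hconv⟩ := exists_enorm_convolution_sq_le hk hkd S
  obtain ⟨C₃, hC₃, hpot⟩ := lintegral_gaussMix_le (d := d) hk hkd hK
  obtain ⟨B, hB0, hB⟩ := S.exists_forall_abs_le
  -- The polarized bound is applied to two parts of the source, of energies at most C₁E and 2C₂C₃E;
  -- each application also costs one E.
  refine ⟨(2 + C₁.toReal + C₂.toReal * (2 * C₃)) / 2, by positivity,
    fun a ha ha1 Q μ _ _ hμ A hA hQA hμA => ?_⟩
  have hΛ := isFiniteMeasure_rieszMixture (d := d) hk hkd ha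
  have hpos := ae_rieszMixture_pos (d := d) (k := k) (a := a)
  set Λ := rieszMixture d k a
  set ρ := (Q + μ).prod (Q + μ) with hρ
  have hΓ : IsFiniteMeasure (spectralMeasure d Λ) := ⟨by
    rw [spectralMeasure_univ hpos]; exact measure_lt_top _ _⟩
  have hW := integral_character_spectralMeasure (d := d) hpos
  have hum := measurable_signOn hA
  have hbdd : ∀ {f : Space d → ℝ} {b : ℝ}, Measurable f → (∀ x, |f x| ≤ b) →
      Integrable f (Q + μ) := fun hf hb =>
    (integrable_const _).mono' hf.aestronglyMeasurable (Eventually.of_forall hb)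
  have hui := hbdd hum fun x => (abs_signOn A x).le
  set E := ∫ z, gaussMix Λ (z.1 - z.2) * (signOn A z.1 * signOn A z.2) ∂ρ with hE
  have hE0 : 0 ≤ E := energy_nonneg hW hui
  have hEs : ENNReal.ofReal E = spectralEnergy (spectralMeasure d Λ) (Q + μ) (signOn A) :=
    ofReal_energy_eq hW hum hui
  -- the two parts of the source
  set f : Space d → ℝ := fun x => (∫ y, S (x - y) ∂Q) * signOn A x with hf
  set ψ : Space d → ℝ := fun x => ∫ y, S (x - y) * signOn A y ∂(Q + μ) with hψ
  set g : Space d → ℝ := fun x => ψ x * (if x ∈ A then 0 else 1) with hg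
  have hfm : Measurable f := (measurable_integral_sub S Q).mul hum
  have hψm : Measurable ψ := measurable_convolution S _ hum
  have hgm : Measurable g := hψm.mul (Measurable.ite hA measurable_const measurable_const)
  have hfB : ∀ x, |f x| ≤ B := fun x => by
    rw [hf, abs_mul, abs_signOn, mul_one]
    exact abs_integral_le_of_forall_abs_le Q fun y => hB _
  have hSi : ∀ (P : Measure (Space d)) [IsFiniteMeasure P] (x : Space d),
      Integrable (fun y => S (x - y)) P := fun P _ x =>
    (integrable_const B).mono' (S.continuous.comp (by fun_prop)).aestronglyMeasurable
      (Eventually.of_forall fun y => hB _)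
  have hψe : ∀ x, ψ x = (∫ y, S (x - y) ∂Q) - ∫ y, S (x - y) ∂μ := fun x => by
    have e1 : (fun y => S (x - y) * signOn A y) =ᵐ[Q] fun y => S (x - y) := by
      filter_upwards [hQA] with y hy
      simp [signOn, hy]
    have e2 : (fun y => S (x - y) * signOn A y) =ᵐ[μ] fun y => -S (x - y) := by
      filter_upwards [hμA] with y hy
      simp [signOn, hy]
    rw [hψ]
    dsimp only
    rw [integral_add_measure ((hSi Q x).congr e1.symm) ((hSi μ x).neg.congr e2.symm),
      integral_congr_ae e1, integral_congr_ae e2, integral_neg, sub_eq_add_neg]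
  have hψE : ∀ x, |ψ x| ^ 2 ≤ C₂.toReal * E := fun x => by
    refine ENNReal.ofReal_le_ofReal_toReal_mul hC₂ hE0 ?_
    rw [hEs, ENNReal.ofReal_pow (abs_nonneg _), ← Real.enorm_eq_ofReal_abs]
    exact hconv a ha ha1 (Q + μ) _ hum hui x
  have hψB : ∀ x, |ψ x| ≤ √(C₂.toReal * E) := fun x => Real.le_sqrt_of_sq_le (hψE x)
  have hgB : ∀ x, |g x| ≤ √(C₂.toReal * E) * (if x ∈ A then 0 else 1) := fun x => by
    rw [hg, abs_mul]
    gcongr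
    · exact hψB x
    · split_ifs <;> simp
  have hgB' : ∀ x, |g x| ≤ √(C₂.toReal * E) := fun x => (hgB x).trans
    (mul_le_of_le_one_right (Real.sqrt_nonneg _) (by split_ifs <;> simp))
  -- This is h[Q] − h[μ] = (S∗Q)(Q − μ) + (S∗(Q − μ)) μ, read as densities with respect to Q + μ;
  -- the restriction of Q + μ to the complement of A is μ.
  have hv : sourceDensity S Q μ A = fun x => f x + g x := by
    ext x
    by_cases hx : x ∈ A
    · simp [sourceDensity, hf, hg, signOn, hx]
    · rw [show g x = ψ x * (if x ∈ A then 0 else 1) from rfl, hψe]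
      simp only [sourceDensity, hf, signOn, if_neg hx]
      ring
  have hWint : Integrable (fun z : Space d × Space d => gaussMix Λ (z.1 - z.2)) ρ :=
    (integrable_const (Λ.real univ)).mono' (Measurable.aestronglyMeasurable (by fun_prop))
      (Eventually.of_forall fun z => by
        rw [Real.norm_of_nonneg (gaussMix_nonneg _ _)]; exact gaussMix_le hpos _)
  have hWi : ∀ {h : Space d → ℝ} {b : ℝ}, Measurable h → (∀ x, |h x| ≤ b) →
      Integrable (fun z : Space d × Space d => gaussMix Λ (z.1 - z.2) * (signOn A z.1 * h z.2)) ρ :=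
    fun {h b} hh hb => hWint.mul_bdd (c := b) (Measurable.aestronglyMeasurable (by fun_prop))
      (Eventually.of_forall fun z => by
        rw [Real.norm_eq_abs, abs_mul, abs_signOn, one_mul]; exact hb _)
  have hsplit : ∫ z, gaussMix Λ (z.1 - z.2) * (signOn A z.1 * sourceDensity S Q μ A z.2) ∂ρ =
      ∫ z, gaussMix Λ (z.1 - z.2) * (signOn A z.1 * f z.2) ∂ρ +
        ∫ z, gaussMix Λ (z.1 - z.2) * (signOn A z.1 * g z.2) ∂ρ := by
    rw [hv, ← integral_add (hWi hfm hfB) (hWi hgm hgB')]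
    exact integral_congr_ae (Eventually.of_forall fun z => by ring)
  have b1 := two_mul_energy_le hW hum hui hfm (hbdd hfm hfB)
  have b2 := two_mul_energy_le hW hum hui hgm (hbdd hgm hgB')
  have b3 : ∫ z, gaussMix Λ (z.1 - z.2) * (f z.1 * f z.2) ∂ρ ≤ C₁.toReal * E := by
    refine ENNReal.ofReal_le_ofReal_toReal_mul hC₁ hE0 ?_
    rw [ofReal_energy_eq hW hfm (hbdd hfm hfB), hEs]
    exact hmul a ha ha1 (Q + μ) Q _ hum hui
  -- Here g is bounded by √(C₂E) and vanishes on A, so its energy is at most C₂E times the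
  -- interaction of Q + μ with μ, which is bounded because μ has a bounded density.
  have b4 : ∫ z, gaussMix Λ (z.1 - z.2) * (g z.1 * g z.2) ∂ρ ≤ C₂.toReal * E * (2 * C₃) := by
    have hχm : Measurable fun z : Space d × Space d => if z.2 ∈ A then (0 : ℝ) else 1 :=
      Measurable.ite (measurable_snd hA) measurable_const measurable_const
    have hχi : Integrable (fun z : Space d × Space d =>
        gaussMix Λ (z.1 - z.2) * (if z.2 ∈ A then (0 : ℝ) else 1)) ρ :=
      hWint.mul_bdd (c := 1) hχm.aestronglyMeasurable (Eventually.of_forall fun z => by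
        split_ifs <;> simp)
    have hχ : ∫ z, gaussMix Λ (z.1 - z.2) * (if z.2 ∈ A then (0 : ℝ) else 1) ∂ρ ≤ 2 * C₃ := by
      rw [← ENNReal.ofReal_le_ofReal_iff (by positivity), ofReal_integral_eq_lintegral_ofReal hχi
        (Eventually.of_forall fun z => mul_nonneg (gaussMix_nonneg _ _) (by split_ifs <;> simp)),
        ENNReal.ofReal_mul zero_le_two, ENNReal.ofReal_ofNat]
      refine (lintegral_mono fun z => ?_).trans (lintegral_prod_snd_le hA hQA
        (F := fun x => ENNReal.ofReal (gaussMix Λ x)) (by fun_prop) (hpot a ha μ hμ))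
      split_ifs <;> simp
    refine le_trans ?_ (mul_le_mul_of_nonneg_left hχ (by positivity))
    rw [← integral_const_mul]
    refine integral_mono (hWint.mul_bdd (c := √(C₂.toReal * E) * √(C₂.toReal * E))
      (Measurable.aestronglyMeasurable (by fun_prop)) (Eventually.of_forall fun z => ?_))
      (hχi.const_mul _) fun z => ?_
    · rw [norm_mul]
      exact mul_le_mul (hgB' _) (hgB' _) (norm_nonneg _) (Real.sqrt_nonneg _)
    · dsimp only
      rw [mul_left_comm (C₂.toReal * E)]
      refine mul_le_mul_of_nonneg_left ((le_abs_self _).trans ?_) (gaussMix_nonneg _ _)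
      rw [abs_mul]
      calc |g z.1| * |g z.2| ≤ √(C₂.toReal * E) * (√(C₂.toReal * E) *
            (if z.2 ∈ A then 0 else 1)) :=
            mul_le_mul (hgB' _) (hgB _) (abs_nonneg _) (Real.sqrt_nonneg _)
        _ = _ := by rw [← mul_assoc, Real.mul_self_sqrt (by positivity)]
  rw [hsplit]
  change 2 * _ ≤ E + _ at b1
  change 2 * _ ≤ E + _ at b2
  linarith
end

/-! ### Empirical measures: the inequality at a free scale -/

section
variable {d : ℕ}

lemma rieszPotential_nonneg (k : ℝ) (x : Space d) : 0 ≤ rieszPotential d k x :=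
  Real.rpow_nonneg (norm_nonneg _) _

lemma empiricalMeasure_apply {N : ℕ} (x : Fin N → Space d) (m : Fin N → ℝ) {B : Set (Space d)}
    (hB : MeasurableSet B) :
    empiricalMeasure x m B = ∑ i, ENNReal.ofReal (m i / N) * B.indicator 1 (x i) := by
  simp [empiricalMeasure, Measure.finsetSum_apply, Measure.dirac_apply' _ hB]

lemma isProbabilityMeasure_empiricalMeasure {N : ℕ} (hN : 0 < N) (x : Fin N → Space d)
    {m : Fin N → ℝ} (hm : ∀ i, 0 ≤ m i) (hsum : ∑ i, m i = N) :
    IsProbabilityMeasure (empiricalMeasure x m) := ⟨by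
  have hN' : (0 : ℝ) < N := by exact_mod_cast hN
  rw [empiricalMeasure_apply x m .univ]
  simp only [indicator_univ, Pi.one_apply, mul_one]
  rw [← ENNReal.ofReal_sum_of_nonneg fun i _ => by have := hm i; positivity, ← Finset.sum_div, hsum,
    div_self hN'.ne', ENNReal.ofReal_one]⟩

lemma ae_empiricalMeasure_mem_range {N : ℕ} (x : Fin N → Space d) (m : Fin N → ℝ) :
    ∀ᵐ y ∂(empiricalMeasure x m), y ∈ range x := by
  rw [ae_iff]
  change empiricalMeasure x m (range x)ᶜ = 0
  rw [empiricalMeasure_apply x m (finite_range x).measurableSet.compl]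
  simp

lemma empiricalMeasure_singleton_le {N : ℕ} {x : Fin N → Space d} (hx : Function.Injective x)
    {m : Fin N → ℝ} {M : ℝ} (hM : ∀ i, m i ≤ M) (y : Space d) :
    empiricalMeasure x m {y} ≤ ENNReal.ofReal (M / N) := by
  rw [empiricalMeasure_apply x m (measurableSet_singleton y)]
  by_cases h : ∃ i, x i = y
  · obtain ⟨i, rfl⟩ := h
    rw [Finset.sum_eq_single i]
    · simp only [mem_singleton_iff, indicator_of_mem, Pi.one_apply, mul_one]
      have := hM i
      exact ENNReal.ofReal_le_ofReal (by gcongr)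
    · intro j _ hj
      simp [hx.ne hj]
    · simp
  · push Not at h
    simp [h]

lemma HasDensityLE.apply_finite {μ : Measure (Space d)} {K : ℝ} (hd : 0 < d)
    (hμ : HasDensityLE μ K) {A : Set (Space d)} (hA : A.Finite) : μ A = 0 := by
  have : Nonempty (Fin d) := ⟨⟨0, hd⟩⟩
  refine le_antisymm ((hμ.le A).trans_eq ?_) zero_le
  rw [Measure.smul_apply, hA.measure_zero, smul_zero]

/-- Only pairs of equal atoms charge the diagonal: its mass is the Q-average of Q{x}, hence at most
the largest atom. -/
lemma measureReal_compl_offDiagonal_le {Q μ : Measure (Space d)} [IsProbabilityMeasure Q]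
    [IsProbabilityMeasure μ] {A : Set (Space d)} (hA : A.Finite) (hQ : ∀ᵐ x ∂Q, x ∈ A)
    (hμ : ∀ B : Set (Space d), B.Finite → μ B = 0) {b : ℝ} (hb : 0 ≤ b)
    (hQb : ∀ x, Q {x} ≤ ENNReal.ofReal b) :
    ((Q + μ).prod (Q + μ)).real (offDiagonal d)ᶜ ≤ b := by
  refine ENNReal.toReal_le_of_le_ofReal hb ?_
  rw [Measure.prod_apply (measurableSet_offDiagonal d).compl]
  have e : ∀ x : Space d, (Q + μ) (Prod.mk x ⁻¹' (offDiagonal d)ᶜ) = Q {x} := fun x => by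
    have : Prod.mk x ⁻¹' (offDiagonal d)ᶜ = {x} := by
      ext y
      simp [offDiagonal, eq_comm]
    rw [this, Measure.add_apply, hμ _ (finite_singleton x), add_zero]
  simp_rw [e]
  rw [lintegral_add_measure, lintegral_congr_ae (μ := μ) (g := fun _ => 0), lintegral_zero, add_zero]
  · exact (lintegral_mono hQb).trans_eq (by simp)
  · have h : ∀ᵐ x ∂μ, x ∉ A := by
      rw [ae_iff]
      simpa using hμ A hA
    filter_upwards [h] with x hx
    exact measure_mono_null (singleton_subset_iff.2 hx) hQ

/-- The potentials of bounded densities are bounded. -/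
lemma exists_lintegral_rieszPotential_le {k : ℝ} (hk : 0 < k) (hkd : k < d) {K : ℝ} (hK : 0 < K) :
    ∃ C : ℝ, 0 < C ∧ ∀ a, 0 < a → ∀ μ : Measure (Space d), HasDensityLE μ K → ∀ x,
      ∫⁻ y, ENNReal.ofReal (rieszPotential d k (x - y) - gaussMix (rieszMixture d k a) (x - y)) ∂μ ≤
        ENNReal.ofReal (C * a ^ (d - k)) := by
  obtain ⟨C, hC, h⟩ := lintegral_rieszPotential_sub_le (d := d) hk hkd
  refine ⟨K * C, by positivity, fun a ha μ hμ x => ?_⟩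
  refine (lintegral_mono' hμ.le le_rfl).trans ?_
  rw [lintegral_smul_measure, smul_eq_mul, mul_assoc, ENNReal.ofReal_mul hK.le]
  gcongr
  exact h a ha x

-- On pairs of points of A the potential takes finitely many values. Pairs with a variable off A are
-- controlled by the potential of μ, bounded through V = (V − W) + W at scale 1.
open scoped Classical in
lemma integrableOn_offDiagonal_rieszPotential {k : ℝ} (hk : 0 < k) (hkd : k < d) {K : ℝ}
    (hK : 0 < K) {Q μ : Measure (Space d)} [IsProbabilityMeasure Q] [IsProbabilityMeasure μ]
    (hμ : HasDensityLE μ K) {A : Set (Space d)} (hA : A.Finite) (hQ : ∀ᵐ x ∂Q, x ∈ A) :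
    IntegrableOn (fun z : Space d × Space d => rieszPotential d k (z.1 - z.2)) (offDiagonal d)
      ((Q + μ).prod (Q + μ)) := by
  obtain ⟨C, -, hC⟩ := exists_lintegral_rieszPotential_le (d := d) hk hkd hK
  obtain ⟨C', -, hC'⟩ := lintegral_gaussMix_le (d := d) hk hkd hK
  have hbound : ∀ x, ∫⁻ y, ENNReal.ofReal (rieszPotential d k (x - y)) ∂μ ≤
      ENNReal.ofReal C' + ENNReal.ofReal (C * 1 ^ (d - k)) := fun x => by
    have := isFiniteMeasure_rieszMixture (d := d) hk hkd one_pos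
    refine le_trans ?_ (add_le_add (hC' 1 one_pos μ hμ x) (hC 1 one_pos μ hμ x))
    rw [← lintegral_add_left (by fun_prop)]
    refine lintegral_mono fun y => ?_
    refine le_trans (ENNReal.ofReal_le_ofReal (le_of_eq ?_)) ENNReal.ofReal_add_le
    ring
  obtain ⟨B, hB⟩ := ((hA.prod hA).image fun z : Space d × Space d =>
    rieszPotential d k (z.1 - z.2)).bddAbove
  have hAm := hA.measurableSet
  refine ⟨(Measurable.aestronglyMeasurable (by fun_prop)), ?_⟩
  rw [hasFiniteIntegral_iff_ofReal (Eventually.of_forall fun z => rieszPotential_nonneg k _)]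
  have hF : Measurable fun x => ENNReal.ofReal (rieszPotential d k x) := by fun_prop
  have hfst : Measurable fun z : Space d × Space d =>
      if z.1 ∈ A then 0 else ENNReal.ofReal (rieszPotential d k (z.1 - z.2)) :=
    Measurable.ite (measurable_fst hAm) measurable_const (by fun_prop)
  calc ∫⁻ z in offDiagonal d, ENNReal.ofReal (rieszPotential d k (z.1 - z.2)) ∂((Q + μ).prod (Q + μ))
      ≤ ∫⁻ z, ENNReal.ofReal B + ((if z.1 ∈ A then 0 else
          ENNReal.ofReal (rieszPotential d k (z.1 - z.2))) + (if z.2 ∈ A then 0 else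
            ENNReal.ofReal (rieszPotential d k (z.1 - z.2)))) ∂((Q + μ).prod (Q + μ)) := by
        refine (setLIntegral_le_lintegral _ _).trans (lintegral_mono fun z => ?_)
        by_cases h1 : z.1 ∈ A
        · by_cases h2 : z.2 ∈ A
          · simp only [h1, h2, if_true, add_zero]
            exact ENNReal.ofReal_le_ofReal (hB ⟨z, ⟨h1, h2⟩, rfl⟩)
          · simp [h1, h2]
        · simp only [h1, if_false]
          exact le_add_left le_self_add
    _ < ∞ := by
        rw [lintegral_add_left measurable_const, lintegral_add_left hfst]
        have b1 := lintegral_prod_fst_le hAm hQ hF (fun x => by rw [rieszPotential_neg]) hbound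
        have b2 := lintegral_prod_snd_le hAm hQ hF hbound
        have b3 : 2 * (ENNReal.ofReal C' + ENNReal.ofReal (C * 1 ^ (d - k))) < ∞ := by finiteness
        refine ENNReal.add_lt_top.2 ⟨by rw [lintegral_const]; finiteness,
          ENNReal.add_lt_top.2 ⟨b1.trans_lt b3, b2.trans_lt b3⟩⟩

/-- The functional inequality, with an error expressed by a free regularization scale `a`. -/
lemma exists_interaction_le {k : ℝ} (hk : 0 < k) (hkd : k < d) (S : 𝓢(Space d, ℝ)) {K : ℝ}
    (hK : 0 < K) :
    ∃ C₀ C₁ : ℝ, 0 < C₀ ∧ 0 < C₁ ∧ ∀ (μ : Measure (Space d)) [IsProbabilityMeasure μ],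
      HasDensityLE μ K → ∀ (N : ℕ) (x : Fin N → Space d) (m : Fin N → ℝ) (M : ℝ), 0 < N →
      Function.Injective x → (∀ i, 0 ≤ m i) → ∑ i, m i = N → 0 < M → (∀ i, m i ≤ M) →
      InteractionConverges (rieszPotential d k)
        ((empiricalMeasure x m).toSignedMeasure - μ.toSignedMeasure)
        ((empiricalMeasure x m).toSignedMeasure - μ.toSignedMeasure) ∧
      InteractionConverges (rieszPotential d k)
        ((empiricalMeasure x m).toSignedMeasure - μ.toSignedMeasure)
        (sourceTerm S (empiricalMeasure x m) - sourceTerm S μ) ∧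
      ∀ a, 0 < a → a ≤ 1 → interaction (rieszPotential d k)
          ((empiricalMeasure x m).toSignedMeasure - μ.toSignedMeasure)
          (sourceTerm S (empiricalMeasure x m) - sourceTerm S μ) ≤
        C₀ * (interaction (rieszPotential d k)
          ((empiricalMeasure x m).toSignedMeasure - μ.toSignedMeasure)
          ((empiricalMeasure x m).toSignedMeasure - μ.toSignedMeasure) +
            C₁ * (a ^ (d - k) + a ^ (-k) * min 1 (M / N))) := by
  classical
  obtain ⟨C, hC0, hC⟩ := exists_regularized_energy_le hk hkd S hK
  obtain ⟨B, hB0, hB⟩ := S.exists_forall_abs_le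
  obtain ⟨Cκ, hCκ, hκ⟩ := exists_lintegral_rieszPotential_le (d := d) hk hkd hK
  have hd : 0 < d := by
    have : (0 : ℝ) < d := hk.trans hkd
    exact_mod_cast this
  set Cw := (1 / (k / 2) + 1 / (d - k / 2)) / Real.Gamma (k / 2) with hCw
  have hCw0 : 0 < Cw := by
    have := Real.Gamma_pos_of_pos (half_pos hk)
    have : 0 < d - k / 2 := by linarith
    positivity
  -- The added 1 makes the constant positive even if B and C vanish. The second constant collects
  -- the L¹ error and the diagonal error of `offDiagonal_energy_le`.
  refine ⟨B + C + 1, 8 * Cκ + 2 * Cw, by positivity, by positivity, ?_⟩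
  intro μ _ hμ N x m M hN hx hm hsum hM hmM
  set Q := empiricalMeasure x m with hQdef
  obtain ⟨A, hAdef⟩ : ∃ A, A = range x := ⟨_, rfl⟩
  have hQp : IsProbabilityMeasure Q := isProbabilityMeasure_empiricalMeasure hN x hm hsum
  have hA : A.Finite := hAdef ▸ finite_range x
  have hAm := hA.measurableSet
  have hQA : ∀ᵐ y ∂Q, y ∈ A := hAdef ▸ ae_empiricalMeasure_mem_range x m
  have hμ0 : ∀ B : Set (Space d), B.Finite → μ B = 0 := fun B hB => hμ.apply_finite hd hB
  have hμA : ∀ᵐ y ∂μ, y ∉ A := by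
    rw [ae_iff]
    simpa using hμ0 A hA
  have hSi : ∀ (P : Measure (Space d)) [IsProbabilityMeasure P],
      Integrable (fun x => ∫ y, S (x - y) ∂P) P := fun P _ =>
    (integrable_const B).mono' (measurable_integral_sub S P).aestronglyMeasurable
      (Eventually.of_forall fun x => abs_integral_le_of_forall_abs_le P fun y => hB _)
  have hνe : Q.toSignedMeasure - μ.toSignedMeasure = (Q + μ).withDensityᵥ (signOn A) := by
    rw [toSignedMeasure_eq_withDensityᵥ_one, toSignedMeasure_eq_withDensityᵥ_one,
      withDensityᵥ_sub_eq hQA hμA (integrable_const _) (integrable_const _)]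
    rfl
  have hge : sourceTerm S Q - sourceTerm S μ = (Q + μ).withDensityᵥ (sourceDensity S Q μ A) :=
    withDensityᵥ_sub_eq hQA hμA (hSi Q) (hSi μ)
  have hum := measurable_signOn hAm
  have hvm := measurable_sourceDensity S Q μ hAm
  have hui : Integrable (signOn A) (Q + μ) := (integrable_const 1).mono' hum.aestronglyMeasurable
    (Eventually.of_forall fun x => (abs_signOn A x).le)
  have hvi : Integrable (sourceDensity S Q μ A) (Q + μ) := (integrable_const B).mono'
    hvm.aestronglyMeasurable (Eventually.of_forall fun x => abs_sourceDensity_le hB x)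
  have hV := integrableOn_offDiagonal_rieszPotential hk hkd hK hμ hA hQA
  have huB : ∀ z : Space d × Space d, |signOn A z.1 * signOn A z.2| ≤ 1 := fun z => by
    rw [abs_mul, abs_signOn, abs_signOn, one_mul]
  have hvB : ∀ z : Space d × Space d, |signOn A z.1 * sourceDensity S Q μ A z.2| ≤ B := fun z => by
    rw [abs_mul, abs_signOn, one_mul]
    exact abs_sourceDensity_le hB _
  rw [hνe, hge]
  refine ⟨interactionConverges_withDensityᵥ hui hui huB hV,
    interactionConverges_withDensityᵥ hui hvi hvB hV, fun a ha ha1 => ?_⟩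
  rw [interaction_withDensityᵥ hui hui huB hV, interaction_withDensityᵥ hui hvi hvB hV]
  have hΛ := isFiniteMeasure_rieszMixture (d := d) hk hkd ha
  have hpos := ae_rieszMixture_pos (d := d) (k := k) (a := a)
  have hΓ : IsFiniteMeasure (spectralMeasure d (rieszMixture d k a)) := ⟨by
    rw [spectralMeasure_univ hpos]; exact measure_lt_top _ _⟩
  have hM0 : 0 ≤ min 1 (M / N) := by positivity
  -- Distinctness of the points bounds each atom by M/N. The trivial bound 1 is kept for the case
  -- where M/N is large, which matters when the scale is capped at 1.
  have hdiag : ((Q + μ).prod (Q + μ)).real (offDiagonal d)ᶜ ≤ min 1 (M / N) := le_min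
    (measureReal_compl_offDiagonal_le hA hQA hμ0 zero_le_one fun x => by simpa using prob_le_one)
    (measureReal_compl_offDiagonal_le hA hQA hμ0 (by positivity) fun y =>
      empiricalMeasure_singleton_le hx hmM y)
  have hmass : (rieszMixture d k a).real univ ≤ Cw * a ^ (-k) :=
    ENNReal.toReal_le_of_le_ofReal (by positivity) (rieszMixture_univ_le hk hkd ha)
  have key := offDiagonal_energy_le hAm hQA (measurable_rieszPotential k)
    (measurable_gaussMix (rieszMixture d k a)) (rieszPotential_neg k) (gaussMix_neg _)
    (gaussMix_nonneg _) (fun x => (gaussMix_le hpos x).trans hmass)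
    (fun x hx => gaussMix_rieszMixture_le hk hkd ha hx) (by positivity) (hκ a ha μ hμ) hV hdiag hvm
    (C := C + 1) (by positivity) (abs_sourceDensity_le hB)
    (energy_nonneg (integral_character_spectralMeasure hpos) hui)
    ((hC a ha ha1 Q μ hμ A hAm hQA hμA).trans (mul_le_mul_of_nonneg_right (by linarith)
      (energy_nonneg (integral_character_spectralMeasure hpos) hui)))
  refine key.trans ?_
  rw [← add_assoc B C 1]
  have h1 : 0 ≤ a ^ (d - k) := by positivity
  have h2 : 0 ≤ a ^ (-k) * min 1 (M / N) := by positivity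
  gcongr
  nlinarith [mul_nonneg hCκ.le h2, mul_nonneg hCw0.le h1]
end

/-! ### Existence of regularizations -/

/-- The mollified potential `(‖x‖² + ε²)^{-k/2}`. -/
def smoothPotential (d : ℕ) (k ε : ℝ) (x : Space d) : ℝ := (‖x‖ ^ 2 + ε ^ 2) ^ (-(k / 2))

section
variable {d : ℕ} {k ε : ℝ}

lemma hasNonnegFourierTransform_gaussMix {Λ : Measure ℝ} [IsFiniteMeasure Λ]
    (hΛ : ∀ᵐ t ∂Λ, 0 < t) : HasNonnegFourierTransform (gaussMix (d := d) Λ) := by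
  intro φ hφ
  have hfin : IsFiniteMeasure (spectralMeasure d Λ) := ⟨by
    rw [spectralMeasure_univ hΛ]; exact measure_lt_top _ _⟩
  set ρ := spectralMeasure d Λ
  obtain ⟨F, hF⟩ : ∃ F : 𝓢(Space d, ℂ), F = 𝓕 φ := ⟨_, rfl⟩
  rw [← hF]
  have hinv : ∀ ξ, ∫ x, character x ξ * F x = φ ξ := fun ξ => by
    have h : 𝓕⁻ (𝓕 φ) ξ = φ ξ := by rw [FourierTransform.fourierInv_fourier_eq]
    rw [SchwartzMap.fourierInv_coe, Real.fourierInv_eq'] at h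
    rw [← h, hF]
    refine integral_congr_ae (Eventually.of_forall fun x => ?_)
    simp only [character, smul_eq_mul]
    congr 2
    push_cast
    ring
  have hI : Integrable (Function.uncurry fun (x ξ : Space d) => character x ξ * F x)
      (volume.prod ρ) := by
    have h1 := (F.integrable (μ := volume)).comp_fst ρ
    have hm := measurable_character (d := d) measurable_fst measurable_snd
    refine h1.norm.mono' (hm.aestronglyMeasurable.mul h1.aestronglyMeasurable)
      (Eventually.of_forall fun z => ?_)
    simp [Function.uncurry, norm_character]
  have e : ∫ x, (gaussMix Λ x : ℂ) * F x = ∫ ξ, φ ξ ∂ρ := by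
    calc ∫ x, (gaussMix Λ x : ℂ) * F x
        = ∫ x, ∫ ξ, character x ξ * F x ∂ρ := by
          refine integral_congr_ae (Eventually.of_forall fun x => ?_)
          simp only [← integral_character_spectralMeasure hΛ, integral_mul_const, ρ]
      _ = ∫ ξ, (∫ x, character x ξ * F x) ∂ρ := integral_integral_swap hI
      _ = _ := by simp only [hinv]
  rw [e]
  exact integral_nonneg hφ

lemma integral_rpow_mul_exp_neg (hk : 0 < k) {s : ℝ} (hs : 0 < s) :
    ∫ t in Ioi (0 : ℝ), t ^ (k / 2 - 1) * Real.exp (-(s * t)) =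
      s ^ (-(k / 2)) * Real.Gamma (k / 2) := by
  rw [Real.integral_rpow_mul_exp_neg_mul_Ioi (half_pos hk) hs, one_div, Real.inv_rpow hs.le,
    Real.rpow_neg hs.le]

lemma integrableOn_rpow_mul_exp_neg (hk : 0 < k) {s : ℝ} (hs : 0 < s) :
    IntegrableOn (fun t : ℝ => t ^ (k / 2 - 1) * Real.exp (-(s * t))) (Ioi 0) := by
  by_contra h
  have h0 := integral_undef h
  rw [integral_rpow_mul_exp_neg hk hs] at h0
  have := Real.Gamma_pos_of_pos (half_pos hk)
  have : 0 < s ^ (-(k / 2)) * Real.Gamma (k / 2) := by positivity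
  linarith

/-- The Gamma integral writes it as a Gaussian mixture; the factor exp(-ε²t) makes the mixing
measure finite. -/
lemma hasNonnegFourierTransform_smoothPotential (hk : 0 < k) (hε : 0 < ε) :
    HasNonnegFourierTransform (smoothPotential d k ε) := by
  have hΓ := Real.Gamma_pos_of_pos (half_pos hk)
  set w : ℝ → ℝ := fun t => t ^ (k / 2 - 1) * Real.exp (-(ε ^ 2 * t)) / Real.Gamma (k / 2) with hw
  have hwm : Measurable w := by fun_prop
  have hw0 : ∀ t ∈ Ioi (0 : ℝ), 0 ≤ w t := fun t ht => by
    have : 0 ≤ t ^ (k / 2 - 1) := Real.rpow_nonneg (le_of_lt ht) _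
    positivity
  have hwi : IntegrableOn w (Ioi 0) :=
    (integrableOn_rpow_mul_exp_neg hk (s := ε ^ 2) (by positivity)).div_const _
  set Λ : Measure ℝ := (volume.restrict (Ioi 0)).withDensity fun t => ENNReal.ofReal (w t)
  have : IsFiniteMeasure Λ := isFiniteMeasure_withDensity_ofReal hwi.2
  have hΛ : ∀ᵐ t ∂Λ, 0 < t :=
    (withDensity_absolutelyContinuous _ _).ae_le (ae_restrict_mem measurableSet_Ioi)
  have e : smoothPotential d k ε = gaussMix Λ := by
    funext x
    rw [gaussMix, integral_withDensity_eq_integral_toReal_smul (by fun_prop) (by simp),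
      smoothPotential, eq_comm]
    calc _ = ∫ t in Ioi (0 : ℝ), (Real.Gamma (k / 2))⁻¹ *
          (t ^ (k / 2 - 1) * Real.exp (-((‖x‖ ^ 2 + ε ^ 2) * t))) := by
          refine setIntegral_congr_fun measurableSet_Ioi fun t ht => ?_
          rw [ENNReal.toReal_ofReal (hw0 t ht), smul_eq_mul, hw]
          rw [show -((‖x‖ ^ 2 + ε ^ 2) * t) = -(ε ^ 2 * t) + -t * ‖x‖ ^ 2 by ring, Real.exp_add]
          ring
      _ = _ := by
          rw [integral_const_mul, integral_rpow_mul_exp_neg hk (by positivity)]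
          field_simp
  rw [e]
  exact hasNonnegFourierTransform_gaussMix hΛ

lemma contDiff_smoothPotential (hε : 0 < ε) {n : WithTop ℕ∞} :
    ContDiff ℝ n (smoothPotential d k ε) :=
  ((contDiff_norm_sq ℝ).add contDiff_const).rpow_const_of_ne fun x => by positivity

lemma smoothPotential_nonneg (x : Space d) : 0 ≤ smoothPotential d k ε x :=
  Real.rpow_nonneg (by positivity) _

lemma rieszPotential_eq_sq_rpow (x : Space d) : rieszPotential d k x = (‖x‖ ^ 2) ^ (-(k / 2)) := by
  rw [rieszPotential, ← Real.rpow_two, ← Real.rpow_mul (norm_nonneg x)]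
  congr 1
  ring

lemma smoothPotential_le_rieszPotential (hk : 0 < k) {x : Space d} (hx : x ≠ 0) :
    smoothPotential d k ε x ≤ rieszPotential d k x := by
  have := norm_pos_iff.2 hx
  rw [rieszPotential_eq_sq_rpow]
  exact Real.rpow_le_rpow_of_nonpos (by positivity) (by nlinarith [sq_nonneg ε]) (by linarith)

lemma smoothPotential_le (hk : 0 < k) (hε : 0 < ε) (x : Space d) :
    smoothPotential d k ε x ≤ ε ^ (-k) := by
  have : ε ^ (-k) = (ε ^ 2) ^ (-(k / 2)) := by
    rw [← Real.rpow_two, ← Real.rpow_mul hε.le]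
    congr 1
    ring
  rw [this]
  exact Real.rpow_le_rpow_of_nonpos (by positivity) (by nlinarith [sq_nonneg ‖x‖]) (by linarith)

/-- The mollified potential is at least (‖x‖ + ε)^{-k}, and (1 + u)^{-k} ≥ 1 − ku with u = ε/‖x‖. -/
lemma rieszPotential_sub_smoothPotential_le (hk : 0 < k) (hε : 0 < ε) {x : Space d} (hx : x ≠ 0) :
    rieszPotential d k x - smoothPotential d k ε x ≤ k * ε * ‖x‖ ^ (-(k + 1)) := by
  have hx' := norm_pos_iff.2 hx
  have h1 : (‖x‖ + ε) ^ (-k) ≤ smoothPotential d k ε x := by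
    have : (‖x‖ + ε) ^ (-k) = ((‖x‖ + ε) ^ 2) ^ (-(k / 2)) := by
      rw [← Real.rpow_two, ← Real.rpow_mul (by positivity)]
      congr 1
      ring
    rw [this]
    exact Real.rpow_le_rpow_of_nonpos (by positivity) (by nlinarith) (by linarith)
  have h2 : 1 - k * (ε / ‖x‖) ≤ (1 + ε / ‖x‖) ^ (-k) := by
    have hu : 0 < ε / ‖x‖ := by positivity
    rw [Real.rpow_def_of_pos (by positivity)]
    have h3 := Real.add_one_le_exp (Real.log (1 + ε / ‖x‖) * -k)
    have h4 := Real.log_le_sub_one_of_pos (x := 1 + ε / ‖x‖) (by positivity)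
    nlinarith
  have h5 : (‖x‖ + ε) ^ (-k) = ‖x‖ ^ (-k) * (1 + ε / ‖x‖) ^ (-k) := by
    rw [← Real.mul_rpow hx'.le (by positivity)]
    congr 1
    field_simp
  have h6 : ‖x‖ ^ (-(k + 1)) = ‖x‖ ^ (-k) / ‖x‖ := by
    rw [show -(k + 1) = -k - 1 by ring, Real.rpow_sub_one hx'.ne']
  have h7 : 0 < ‖x‖ ^ (-k) := by positivity
  have h8 := mul_le_mul_of_nonneg_left h2 h7.le
  rw [rieszPotential, h6]
  calc _ ≤ ‖x‖ ^ (-k) - ‖x‖ ^ (-k) * (1 - k * (ε / ‖x‖)) := by linarith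
    _ = _ := by ring

/-- Radial integrals in polar coordinates. -/
lemma lintegral_radial [NeZero d] {g : ℝ → ℝ} (hg : ∀ y, 0 < y → 0 ≤ g y) (hg0 : 0 ≤ g 0)
    (hi : IntegrableOn (fun y => y ^ (d - 1) * g y) (Ioi 0)) :
    ∫⁻ x : Space d, ENNReal.ofReal (g ‖x‖) =
      ENNReal.ofReal (d * (volume : Measure (Space d)).real (Metric.ball 0 1) *
        ∫ y in Ioi (0 : ℝ), y ^ (d - 1) * g y) := by
  have hd : Module.finrank ℝ (Space d) = d := by simp
  have hnt : Nontrivial (Space d) := Module.nontrivial_of_finrank_pos (R := ℝ)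
    (by rw [hd]; exact Nat.pos_of_ne_zero (NeZero.ne d))
  rw [← ofReal_integral_eq_lintegral_ofReal]
  · rw [integral_fun_norm_addHaar, hd, nsmul_eq_mul, smul_eq_mul, mul_assoc]
    simp only [smul_eq_mul]
  · rw [integrable_fun_norm_addHaar volume (f := g), hd]
    simpa using hi
  · refine Eventually.of_forall fun x => ?_
    rcases (norm_nonneg x).eq_or_lt with h | h
    · simpa [← h] using hg0
    · exact hg _ h

lemma pow_mul_rpow_neg {y : ℝ} (hd : 0 < d) (hy : 0 < y) (s : ℝ) :
    y ^ (d - 1) * y ^ (-s) = y ^ (d - 1 - s : ℝ) := by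
  rw [← Real.rpow_natCast, ← Real.rpow_add hy, Nat.cast_sub hd]
  simp [sub_eq_add_neg]

lemma lintegral_ball_norm_rpow_neg [NeZero d] {s δ : ℝ} (hs : s < d) (hδ : 0 < δ) :
    ∫⁻ x : Space d in Metric.ball 0 δ, ENNReal.ofReal (‖x‖ ^ (-s)) =
      ENNReal.ofReal (d * (volume : Measure (Space d)).real (Metric.ball 0 1) / (d - s) *
        δ ^ (d - s)) := by
  have hd : 0 < d := Nat.pos_of_ne_zero (NeZero.ne d)
  set g : ℝ → ℝ := (Iio δ).indicator fun y => y ^ (-s)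
  have hg : ∀ y, 0 ≤ y → 0 ≤ g y := fun y hy =>
    indicator_apply_nonneg fun _ => Real.rpow_nonneg hy _
  have e1 : ∀ y ∈ Ioi (0 : ℝ), y ^ (d - 1) * g y =
      (Iio δ).indicator (fun y => y ^ (d - 1 - s : ℝ)) y := fun y hy => by
    by_cases h : y ∈ Iio δ
    · simp only [g, indicator_of_mem h, pow_mul_rpow_neg hd hy]
    · simp [g, indicator_of_notMem h]
  have e2 : Iio δ ∩ Ioi 0 = Ioo 0 δ := by ext; simp [and_comm]
  have hi : IntegrableOn (fun y => y ^ (d - 1 - s : ℝ)) (Ioo 0 δ) :=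
    (intervalIntegral.integrableOn_Ioo_rpow_iff hδ).2 (by linarith)
  rw [← lintegral_indicator measurableSet_ball]
  have e3 : ∀ x : Space d, (Metric.ball 0 δ).indicator (fun x => ENNReal.ofReal (‖x‖ ^ (-s))) x =
      ENNReal.ofReal (g ‖x‖) := fun x => by
    by_cases h : ‖x‖ < δ
    · rw [indicator_of_mem (by simpa using h)]; simp [g, h]
    · rw [indicator_of_notMem (by simpa using h)]; simp [g, h]
  simp only [e3]
  rw [lintegral_radial (fun y hy => hg y hy.le) (hg 0 le_rfl)]
  · rw [setIntegral_congr_fun measurableSet_Ioi e1, setIntegral_indicator measurableSet_Iio,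
      inter_comm, e2, ← integral_Ioc_eq_integral_Ioo, ← intervalIntegral.integral_of_le hδ.le,
      integral_rpow (Or.inl (by linarith)), Real.zero_rpow (by linarith)]
    congr 1
    rw [show (d - 1 - s + 1 : ℝ) = d - s by ring]
    ring
  · rw [integrableOn_congr_fun e1 measurableSet_Ioi, IntegrableOn,
      integrable_indicator_iff measurableSet_Iio, IntegrableOn,
      Measure.restrict_restrict measurableSet_Iio, e2]
    exact hi

lemma lintegral_compl_ball_norm_rpow_neg [NeZero d] {s δ : ℝ} (hs : d < s) (hδ : 0 < δ) :
    ∫⁻ x : Space d in (Metric.ball 0 δ)ᶜ, ENNReal.ofReal (‖x‖ ^ (-s)) =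
      ENNReal.ofReal (d * (volume : Measure (Space d)).real (Metric.ball 0 1) / (s - d) *
        δ ^ (d - s)) := by
  have hd : 0 < d := Nat.pos_of_ne_zero (NeZero.ne d)
  set g : ℝ → ℝ := (Ici δ).indicator fun y => y ^ (-s)
  have hg : ∀ y, 0 ≤ y → 0 ≤ g y := fun y hy =>
    indicator_apply_nonneg fun _ => Real.rpow_nonneg hy _
  have e1 : ∀ y ∈ Ioi (0 : ℝ), y ^ (d - 1) * g y =
      (Ici δ).indicator (fun y => y ^ (d - 1 - s : ℝ)) y := fun y hy => by
    by_cases h : y ∈ Ici δ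
    · simp only [g, indicator_of_mem h, pow_mul_rpow_neg hd hy]
    · simp [g, indicator_of_notMem h]
  have e2 : Ici δ ∩ Ioi 0 = Ici δ := inter_eq_left.2 fun y hy => hδ.trans_le hy
  have hi : IntegrableOn (fun y => y ^ (d - 1 - s : ℝ)) (Ici δ) :=
    (integrableOn_Ici_iff_integrableOn_Ioi).2 (integrableOn_Ioi_rpow_of_lt (by linarith) hδ)
  rw [← lintegral_indicator measurableSet_ball.compl]
  have e3 : ∀ x : Space d, (Metric.ball 0 δ)ᶜ.indicator
      (fun x => ENNReal.ofReal (‖x‖ ^ (-s))) x = ENNReal.ofReal (g ‖x‖) := fun x => by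
    by_cases h : δ ≤ ‖x‖
    · rw [indicator_of_mem (by simpa using h)]; simp [g, h]
    · rw [indicator_of_notMem (by simpa using h)]; simp [g, h]
  simp only [e3]
  rw [lintegral_radial (fun y hy => hg y hy.le) (hg 0 le_rfl)]
  · rw [setIntegral_congr_fun measurableSet_Ioi e1, setIntegral_indicator measurableSet_Ici,
      inter_comm, e2, integral_Ici_eq_integral_Ioi, integral_Ioi_rpow_of_lt (by linarith) hδ]
    congr 1
    rw [show (d - 1 - s + 1 : ℝ) = d - s by ring, show (s - d : ℝ) = -(d - s) by ring, div_neg]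
    ring
  · rw [integrableOn_congr_fun e1 measurableSet_Ioi, IntegrableOn,
      integrable_indicator_iff measurableSet_Ici, IntegrableOn,
      Measure.restrict_restrict measurableSet_Ici, e2]
    exact hi

end

section
variable {d : ℕ} {k p q : ℝ}

lemma eLpNorm_indicator_le_of_norm_rpow [NeZero d] {s A B : ℝ} (hp : 0 < p) (hA : 0 ≤ A)
    (hB : 0 ≤ B) {T : Set (Space d)} (hT : MeasurableSet T) {f : Space d → ℝ}
    (hf : ∀ x, x ≠ 0 → |f x| ≤ B * ‖x‖ ^ (-s))
    (hA' : ∫⁻ x in T, ENNReal.ofReal (‖x‖ ^ (-(s * p))) ≤ ENNReal.ofReal A) :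
    eLpNorm (T.indicator f) (ENNReal.ofReal p) volume ≤ ENNReal.ofReal (B * A ^ (1 / p)) := by
  have hnt : Nontrivial (Space d) := Module.nontrivial_of_finrank_pos (R := ℝ)
    (by simpa using Nat.pos_of_ne_zero (NeZero.ne d))
  have h0 : ∀ᵐ x ∂(volume.restrict T : Measure (Space d)), x ≠ 0 :=
    ae_restrict_of_ae (by simp [ae_iff])
  rw [eLpNorm_indicator_eq_eLpNorm_restrict hT]
  calc _ ≤ eLpNorm (B • fun x : Space d => ‖x‖ ^ (-s)) (ENNReal.ofReal p) (volume.restrict T) := by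
        refine eLpNorm_mono_ae_real ?_
        filter_upwards [h0] with x hx using hf x hx
    _ = ENNReal.ofReal B *
        (∫⁻ x in T, ENNReal.ofReal (‖x‖ ^ (-(s * p)))) ^ (1 / p) := by
        rw [eLpNorm_const_smul, Real.enorm_eq_ofReal hB, eLpNorm_eq_lintegral_rpow_enorm_toReal
          (by simpa using hp) ENNReal.ofReal_ne_top, ENNReal.toReal_ofReal hp.le]
        congr 2
        refine lintegral_congr fun x => ?_
        rw [Real.enorm_eq_ofReal (by positivity), ENNReal.ofReal_rpow_of_nonneg (by positivity) hp.le,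
          ← Real.rpow_mul (norm_nonneg x), neg_mul]
    _ ≤ ENNReal.ofReal B * ENNReal.ofReal A ^ (1 / p) := by gcongr
    _ = _ := by
        rw [ENNReal.ofReal_rpow_of_nonneg hA (by positivity), ← ENNReal.ofReal_mul hB]

/-- The `L^p + L^q` norm of a function bounded by both `‖x‖^{-k}` and `k ε ‖x‖^{-k-1}`. -/
lemma exists_sumSpaceNorm_le [NeZero d] (hk : 0 < k) (hp : 0 < p) (hpk : p < d / k)
    (hq : d / k < q) : ∃ c : ℝ, 0 < c ∧ ∀ ε δ : ℝ, 0 < ε → 0 < δ → ∀ f : Space d → ℝ,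
      Measurable f → (∀ x, x ≠ 0 → |f x| ≤ ‖x‖ ^ (-k)) →
      (∀ x, x ≠ 0 → |f x| ≤ k * ε * ‖x‖ ^ (-(k + 1))) →
      sumSpaceNorm p q f ≤
        ENNReal.ofReal (c * (ε / δ ^ (k + 1 - d / q) + δ ^ (d / p - k))) := by
  have hd : 0 < d := Nat.pos_of_ne_zero (NeZero.ne d)
  have hd' : (0 : ℝ) < d := by exact_mod_cast hd
  have hq0 : 0 < q := lt_trans (by positivity) hq
  rw [lt_div_iff₀ hk] at hpk
  rw [div_lt_iff₀ hk] at hq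
  have hv : 0 < (volume : Measure (Space d)).real (Metric.ball 0 1) :=
    ENNReal.toReal_pos (Metric.measure_ball_pos _ _ one_pos).ne' measure_ball_lt_top.ne
  set v := (volume : Measure (Space d)).real (Metric.ball 0 1)
  -- The first majorant is p-integrable inside the ball of radius δ because kp < d; the second is
  -- q-integrable outside because (k + 1)q > d. This is the splitting used for the norm.
  have hs1 : k * p < d := by linarith
  have hs2 : d < (k + 1) * q := by nlinarith
  set A₁ : ℝ := d * v / (d - k * p)
  set A₂ : ℝ := d * v / ((k + 1) * q - d)
  have hA₁ : 0 < A₁ := div_pos (by positivity) (by linarith)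
  have hA₂ : 0 < A₂ := div_pos (by positivity) (by linarith)
  refine ⟨A₁ ^ (1 / p) + k * A₂ ^ (1 / q), by positivity, fun ε δ hε hδ f hf h1 h2 => ?_⟩
  have b1 := eLpNorm_indicator_le_of_norm_rpow (A := A₁ * δ ^ (d - k * p)) (B := 1) hp (by positivity)
    zero_le_one (T := Metric.ball 0 δ) measurableSet_ball (f := f) (s := k)
    (fun x hx => by simpa using h1 x hx) (lintegral_ball_norm_rpow_neg hs1 hδ).le
  have b2 := eLpNorm_indicator_le_of_norm_rpow (A := A₂ * δ ^ (d - (k + 1) * q)) (B := k * ε) hq0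
    (by positivity) (by positivity) (T := (Metric.ball 0 δ)ᶜ) measurableSet_ball.compl (f := f)
    (s := k + 1) h2 (lintegral_compl_ball_norm_rpow_neg hs2 hδ).le
  have m1 : MemLp ((Metric.ball 0 δ).indicator f) (ENNReal.ofReal p) volume :=
    ⟨(hf.indicator measurableSet_ball).aestronglyMeasurable, b1.trans_lt ENNReal.ofReal_lt_top⟩
  have m2 : MemLp ((Metric.ball 0 δ)ᶜ.indicator f) (ENNReal.ofReal q) volume :=
    ⟨(hf.indicator measurableSet_ball.compl).aestronglyMeasurable,
      b2.trans_lt ENNReal.ofReal_lt_top⟩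
  refine (iInf₂_le_of_le _ _ (iInf₂_le_of_le m1 m2 (iInf_le_of_le
    (Eventually.of_forall fun x => by rw [indicator_self_add_compl]) (add_le_add b1 b2)))).trans ?_
  rw [← ENNReal.ofReal_add (by positivity) (by positivity)]
  refine ENNReal.ofReal_le_ofReal ?_
  have e1 : (A₁ * δ ^ (d - k * p)) ^ (1 / p) = A₁ ^ (1 / p) * δ ^ (d / p - k) := by
    rw [Real.mul_rpow hA₁.le (by positivity), ← Real.rpow_mul hδ.le]
    congr 2
    field_simp
  have e2 : (A₂ * δ ^ (d - (k + 1) * q)) ^ (1 / q) = A₂ ^ (1 / q) / δ ^ (k + 1 - d / q) := by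
    rw [Real.mul_rpow hA₂.le (by positivity), ← Real.rpow_mul hδ.le, div_eq_mul_inv _ (δ ^ _),
      ← Real.rpow_neg hδ.le]
    congr 2
    field_simp
    ring
  rw [e1, e2]
  have t1 : 0 ≤ A₁ ^ (1 / p) * (ε / δ ^ (k + 1 - d / q)) := by positivity
  have t2 : 0 ≤ k * A₂ ^ (1 / q) * δ ^ (d / p - k) := by positivity
  calc _ = A₁ ^ (1 / p) * δ ^ (d / p - k) + k * A₂ ^ (1 / q) * (ε / δ ^ (k + 1 - d / q)) := by ring
    _ ≤ _ := by linarith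

lemma exists_isRegularization (hd : 0 < d) (hk : 0 < k) (hp : 0 < p) (hpk : p < d / k)
    (hq : d / k < q) : ∃ c : ℝ, 0 < c ∧ ∀ (r : ℕ) (ζ : Space d → ℝ), IsCutoff ζ →
      ∃ (Vε : ℝ → Space d → ℝ) (η : ℝ → ℝ), IsRegularization k p q r ζ c Vε η := by
  have : NeZero d := ⟨hd.ne'⟩
  have hd' : (0 : ℝ) < d := by exact_mod_cast hd
  obtain ⟨c, hc, h⟩ := exists_sumSpaceNorm_le (d := d) hk hp hpk hq
  have hq0 : 0 < q := lt_trans (by positivity) hq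
  set α : ℝ := k + 1 - d / q
  set β : ℝ := d / p - k
  have hα : 0 < α := by
    have : d / q < k := by rwa [div_lt_comm₀ hq0 hk]
    simp only [α]; linarith
  have hβ : 0 < β := by
    have : k < d / p := by rwa [lt_div_comm₀ hk hp]
    simp only [β]; linarith
  have hsub : ∀ ε : ℝ, 0 < ε → ∀ x : Space d, x ≠ 0 →
      |smoothPotential d k ε x - rieszPotential d k x| ≤ ‖x‖ ^ (-k) ∧
      |smoothPotential d k ε x - rieszPotential d k x| ≤ k * ε * ‖x‖ ^ (-(k + 1)) := by
    intro ε hε x hx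
    have a1 := smoothPotential_le_rieszPotential (ε := ε) hk hx
    have a2 := smoothPotential_nonneg (k := k) (ε := ε) x
    have a3 := rieszPotential_sub_smoothPotential_le hk hε hx
    rw [abs_sub_comm, abs_of_nonneg (sub_nonneg.2 a1)]
    exact ⟨by rw [← rieszPotential.eq_1]; linarith, a3⟩
  have hm : ∀ ε : ℝ, 0 < ε → Measurable (smoothPotential d k ε) := fun ε hε =>
    (contDiff_smoothPotential hε (n := 0)).continuous.measurable
  -- The rate is the bound of `exists_sumSpaceNorm_le` at δ = ε^{1/(2α)}, which turns ε/δ^α into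
  -- ε^{1/2} and δ^β into ε^{β/(2α)}.
  refine ⟨c, hc, fun r ζ hζ => ⟨smoothPotential d k,
    fun ε => c * (ε ^ (1 / 2 : ℝ) + ε ^ (β / (2 * α))),
    fun ε hε => contDiff_smoothPotential hε.1,
    fun ε hε => hasNonnegFourierTransform_smoothPotential hk hε.1,
    fun ε hε => by have := hε.1; positivity, ?_, fun ε hε => ?_, fun ε hε δ hδ => ?_,
    fun ε hε x hx => by linarith [smoothPotential_le_rieszPotential (ε := ε) hk hx, hε.1],
    fun ε => ε ^ k, ?_, fun ε hε => ⟨Real.rpow_pos_of_pos hε.1 _, fun x => ?_⟩⟩⟩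
  · have h1 : Tendsto (fun ε : ℝ => ε ^ (1 / 2 : ℝ)) (𝓝[>] 0) (𝓝 0) :=
      ((Real.continuous_rpow_const (by norm_num)).tendsto' 0 0 (by norm_num)).mono_left
        nhdsWithin_le_nhds
    have h2 : Tendsto (fun ε : ℝ => ε ^ (β / (2 * α))) (𝓝[>] 0) (𝓝 0) :=
      ((Real.continuous_rpow_const (by positivity)).tendsto' 0 0
        (Real.zero_rpow (by positivity))).mono_left nhdsWithin_le_nhds
    simpa using (h1.add h2).const_mul c
  · have hδ : 0 < ε ^ (1 / (2 * α)) := Real.rpow_pos_of_pos hε.1 _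
    refine (h ε _ hε.1 hδ _ ((hm ε hε.1).sub (measurable_rieszPotential k))
      (fun x hx => (hsub ε hε.1 x hx).1) (fun x hx => (hsub ε hε.1 x hx).2)).trans_eq ?_
    congr 3
    · rw [← Real.rpow_mul hε.1.le, show 1 / (2 * α) * (k + 1 - d / q) = 1 / 2 by
        change 1 / (2 * α) * α = 1 / 2; field_simp, ← Real.sqrt_eq_rpow, Real.div_sqrt]
    · rw [← Real.rpow_mul hε.1.le]
      congr 1
      ring
  · have hz : ∀ x (y : ℝ), |ζ x * y| ≤ |y| := fun x y => by
      rw [abs_mul, abs_of_nonneg (hζ.mem_Icc x).1]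
      exact mul_le_of_le_one_left (abs_nonneg y) (hζ.mem_Icc x).2
    exact h ε δ hε.1 hδ.1 _ ((hζ.smooth.continuous.measurable.comp
      (measurable_const_smul δ⁻¹)).mul ((hm ε hε.1).sub (measurable_rieszPotential k)))
      (fun x hx => (hz _ _).trans (hsub ε hε.1 x hx).1)
      (fun x hx => (hz _ _).trans (hsub ε hε.1 x hx).2)
  · exact ((Real.continuous_rpow_const hk.le).tendsto' 0 0 (Real.zero_rpow hk.ne')).mono_left
      nhdsWithin_le_nhds
  · rw [abs_of_nonneg (smoothPotential_nonneg x), one_div, ← Real.rpow_neg hε.1.le]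
    exact smoothPotential_le hk hε.1 x

end

/-! ### Blow-up of regularizations and choice of the scales -/

section
variable {d : ℕ} {k p q : ℝ}

/-- For any splitting, Hölder on B bounds the integrals of |f₁| and |f₂| over B, whose sum is at
least the volume of B. -/
lemma measure_div_le_sumSpaceNorm (hp : 1 ≤ p) (hq : 1 ≤ q) {f : Space d → ℝ} {B : Set (Space d)}
    (hf : ∀ᵐ x ∂(volume.restrict B), 1 ≤ |f x|) :
    volume B / (volume B ^ (1 - 1 / p) + volume B ^ (1 - 1 / q)) ≤ sumSpaceNorm p q f := by
  have key : ∀ (r : ℝ) (g : Space d → ℝ), 1 ≤ r → MemLp g (ENNReal.ofReal r) volume →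
      ∫⁻ x in B, ‖g x‖ₑ ≤ eLpNorm g (ENNReal.ofReal r) volume * volume B ^ (1 - 1 / r) := by
    intro r g hr hg
    have h := eLpNorm_le_eLpNorm_mul_rpow_measure_univ (μ := volume.restrict B)
      (p := 1) (q := ENNReal.ofReal r) (by simpa using ENNReal.ofReal_le_ofReal hr)
      hg.1.restrict
    rw [eLpNorm_one_eq_lintegral_enorm, Measure.restrict_apply_univ,
      ENNReal.toReal_ofReal (zero_le_one.trans hr), ENNReal.toReal_one, div_one] at h
    exact h.trans (mul_le_mul' (eLpNorm_restrict_le _ _ _ _) le_rfl)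
  refine le_iInf₂ fun f₁ f₂ => le_iInf₂ fun h1 h2 => le_iInf fun h => ?_
  refine ENNReal.div_le_of_le_mul ?_
  calc volume B = ∫⁻ _ in B, 1 := by simp
    _ ≤ ∫⁻ x in B, (‖f₁ x‖ₑ + ‖f₂ x‖ₑ) := by
        refine lintegral_mono_ae ?_
        filter_upwards [hf, ae_restrict_of_ae h] with x hx hx'
        rw [hx'] at hx
        refine le_trans ?_ (enorm_add_le (f₁ x) (f₂ x))
        rw [Real.enorm_eq_ofReal_abs]
        simpa using ENNReal.ofReal_le_ofReal hx
    _ = (∫⁻ x in B, ‖f₁ x‖ₑ) + ∫⁻ x in B, ‖f₂ x‖ₑ := lintegral_add_left' h1.1.restrict.enorm _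
    _ ≤ _ := add_le_add (key p f₁ hp h1) (key q f₂ hq h2)
    _ ≤ _ := by
        rw [mul_add, add_mul, add_mul]
        exact add_le_add le_self_add le_add_self

lemma IsRegularization.abs_le_supNorm {r : ℕ} {ζ : Space d → ℝ} {c : ℝ} {Vε : ℝ → Space d → ℝ}
    {η : ℝ → ℝ} (h : IsRegularization k p q r ζ c Vε η) {ε : ℝ} (hε : ε ∈ Ioo (0 : ℝ) 1)
    (x : Space d) : |Vε ε x| ≤ supNorm (Vε ε) := by
  obtain ⟨Θ, -, hΘ⟩ := h.bounded
  exact le_ciSup (f := fun x => |Vε ε x|) ⟨1 / Θ ε, forall_mem_range.2 (hΘ ε hε).2⟩ x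

/-- Regularizations blow up. -/
lemma IsRegularization.tendsto_supNorm (hd : 0 < d) (hk : 0 < k) (hp : 1 ≤ p) (hq : 1 ≤ q)
    {r : ℕ} {ζ : Space d → ℝ} {c : ℝ} {Vε : ℝ → Space d → ℝ}
    {η : ℝ → ℝ} (h : IsRegularization k p q r ζ c Vε η) :
    Tendsto (fun ε => supNorm (Vε ε)) (𝓝[>] 0) atTop := by
  have hnt : Nontrivial (Space d) := Module.nontrivial_of_finrank_pos (R := ℝ) (by simpa using hd)
  refine tendsto_atTop.2 fun L => ?_
  -- On the ball B the potential is at least T ≥ L + 1. A regularization with supremum below L then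
  -- differs from V by at least 1 on B, and its distance to V has a positive lower bound independent
  -- of ε.
  set T : ℝ := max L 0 + 1
  have hT : 0 < T := by positivity
  set B : Set (Space d) := Metric.ball 0 (T ^ (-(1 / k)))
  have hB : 0 < T ^ (-(1 / k)) := Real.rpow_pos_of_pos hT _
  have hB0 : volume B ≠ 0 := (Metric.measure_ball_pos _ _ hB).ne'
  have hBt : volume B ≠ ∞ := measure_ball_lt_top.ne
  have hpow : ∀ {r : ℝ}, 1 ≤ r → volume B ^ (1 - 1 / r) ≠ ∞ := fun {r} hr =>
    ENNReal.rpow_ne_top_of_nonneg (sub_nonneg.2 ((div_le_one (by linarith)).2 hr)) hBt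
  have hpos := ENNReal.div_pos hB0 (ENNReal.add_ne_top.2 ⟨hpow hp, hpow hq⟩)
  have hη := (ENNReal.continuous_ofReal.tendsto' 0 0 ENNReal.ofReal_zero).comp h.rate_tendsto
  filter_upwards [hη.eventually (gt_mem_nhds hpos), Ioo_mem_nhdsGT (zero_lt_one' ℝ)]
    with ε hε hε1
  by_contra! hlt
  refine absurd ((measure_div_le_sumSpaceNorm hp hq ?_).trans (h.norm_sub_le ε hε1)) hε.not_ge
  have h0 : ∀ᵐ x ∂(volume.restrict B : Measure (Space d)), x ≠ 0 :=
    ae_restrict_of_ae (by simp [ae_iff])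
  filter_upwards [h0, ae_restrict_mem measurableSet_ball] with x hx hxB
  have hx' : 0 < ‖x‖ := norm_pos_iff.2 hx
  have h1 : T ≤ ‖x‖ ^ (-k) := by
    calc T = (T ^ (-(1 / k))) ^ (-k) := by
          rw [← Real.rpow_mul hT.le]
          field_simp
          simp
      _ ≤ _ := Real.rpow_le_rpow_of_nonpos hx' (by simpa using (mem_ball_zero_iff.1 hxB).le)
          (by linarith)
  have h2 := (le_abs_self _).trans (h.abs_le_supNorm hε1 x)
  have h3 := le_max_left L 0
  rw [rieszPotential, abs_sub_comm]
  exact le_trans (by linarith) (le_abs_self _)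

/-- The scale at which a regularization with supremum `L` is compared with the potential. -/
lemma exists_scale {n C₁ : ℝ} (hk : 0 < k) (hkn : k < n) (hC₁ : 0 < C₁) :
    ∃ C₂ : ℝ, 0 < C₂ ∧ ∀ L θ : ℝ, 0 ≤ L → 0 ≤ θ → ∃ a, 0 < a ∧ a ≤ 1 ∧
      C₁ * (a ^ (n - k) + a ^ (-k) * min 1 θ) ≤ θ * L + C₂ * max 1 L ^ (-((n - k) / k)) := by
  -- The scale is a = l s with s = max(1, L)^{-1/k}. This l gives C₁ l^{-k} ≤ 1, so that θL appears
  -- with coefficient one.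
  set l : ℝ := (1 + C₁) ^ (1 / k)
  have hl : 1 < l := Real.one_lt_rpow (by linarith) (by positivity)
  have hlk : l ^ (-k) = (1 + C₁)⁻¹ := by
    rw [← Real.rpow_mul (by linarith), show 1 / k * -k = -1 by field_simp, Real.rpow_neg_one]
  have hl0 : 0 < l := by linarith
  refine ⟨2 * C₁ * l ^ (n - k), by positivity, fun L θ hL hθ => ?_⟩
  have hm1 := le_max_left 1 L
  set m := max 1 L
  have hm : 0 < m := by linarith
  set s : ℝ := m ^ (-(1 / k)) with hs
  have hs0 : 0 < s := Real.rpow_pos_of_pos hm _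
  have hsk : s ^ (-k) = m := by
    rw [hs, ← Real.rpow_mul hm.le, show -(1 / k) * -k = 1 by field_simp, Real.rpow_one]
  have hsn : m ^ (-((n - k) / k)) = s ^ (n - k) := by
    rw [hs, ← Real.rpow_mul hm.le]
    congr 1
    ring
  have hls : (l * s) ^ (n - k) = l ^ (n - k) * s ^ (n - k) := Real.mul_rpow hl0.le hs0.le
  rw [hsn]
  have hpos : 0 < l ^ (n - k) * s ^ (n - k) := by positivity
  have hmin : min 1 θ ≤ 1 := min_le_left _ _
  have hmin0 : 0 ≤ min 1 θ := le_min zero_le_one hθ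
  have hθL : 0 ≤ θ * L := by positivity
  rcases le_or_gt (l * s) 1 with h | h
  · refine ⟨l * s, by positivity, h, ?_⟩
    have hmL : m = L := by
      rcases max_choice 1 L with h' | h'
      · have : s = 1 := by rw [hs, show m = 1 from h', Real.one_rpow]
        rw [this] at h
        linarith
      · exact h'
    have e : (l * s) ^ (-k) = (1 + C₁)⁻¹ * L := by
      rw [Real.mul_rpow hl0.le hs0.le, hlk, hsk, hmL]
    have h1 : C₁ * (1 + C₁)⁻¹ ≤ 1 := by
      rw [← div_eq_mul_inv, div_le_one (by linarith)]
      linarith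
    have h2 : C₁ * (1 + C₁)⁻¹ * (L * min 1 θ) ≤ 1 * (L * θ) := by
      gcongr
      exact min_le_right _ _
    rw [e, hls]
    nlinarith
  -- Here L is bounded and the scale is capped at 1. The left side is at most 2C₁, thanks to the
  -- minimum with 1, and the last term exceeds this because (l s)^{n-k} ≥ 1.
  · refine ⟨1, one_pos, le_rfl, ?_⟩
    have h1 : 1 ≤ (l * s) ^ (n - k) := Real.one_le_rpow h.le (by linarith)
    rw [hls] at h1
    simp only [Real.one_rpow, one_mul]
    nlinarith

/-- Domination of earlier values is needed because the error term evaluates ω at ε/δ, which is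
larger than ε. -/
lemma exists_monotone_envelope {G : ℝ → ℝ} (h0 : ∀ t, 0 ≤ G t) (h1 : ∀ t, G t ≤ 1)
    (hG : Tendsto G (𝓝[>] 0) (𝓝 0)) : ∃ ω : ℝ → ℝ, Tendsto ω (𝓝[>] 0) (𝓝 0) ∧ (∀ t, 0 ≤ ω t) ∧
      ∀ s t, 0 < s → s ≤ t → G s ≤ ω t := by
  have hb : ∀ t, BddAbove (G '' Ioc 0 t) := fun t =>
    ⟨1, forall_mem_image.2 fun s _ => h1 s⟩
  have hω : ∀ t, 0 ≤ sSup (G '' Ioc 0 t) := fun t =>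
    Real.sSup_nonneg (forall_mem_image.2 fun s _ => h0 s)
  refine ⟨fun t => sSup (G '' Ioc 0 t), ?_, hω,
    fun s t hs hst => le_csSup (hb t) (mem_image_of_mem _ ⟨hs, hst⟩)⟩
  refine tendsto_order.2 ⟨fun a ha => Eventually.of_forall fun t => ha.trans_le (hω t),
    fun a ha => ?_⟩
  obtain ⟨τ, hτ, hτ'⟩ := mem_nhdsGT_iff_exists_Ioo_subset.1 (hG.eventually (gt_mem_nhds (half_pos ha)))
  filter_upwards [Ioo_mem_nhdsGT hτ] with t ht
  refine (Real.sSup_le (forall_mem_image.2 fun s hs => ?_) (half_pos ha).le).trans_lt (half_lt_self ha)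
  exact (hτ' ⟨hs.1, hs.2.trans_lt ht.2⟩ : _ < _).le

/-- A slow reindexing: J N is the largest j ≤ N with |c j| (j + 1) ≤ N, so the ratio is at most 1/(J
N + 1). -/
lemma exists_tendsto_atTop_div_tendsto_zero (c : ℕ → ℝ) :
    ∃ J : ℕ → ℕ, Tendsto J atTop atTop ∧ Tendsto (fun N : ℕ => c (J N) / N) atTop (𝓝 0) := by
  classical
  set P : ℕ → ℕ → Prop := fun N j => |c j| * (j + 1) ≤ N
  have hP : ∀ j, ∀ᶠ N in atTop, P N j := fun j =>
    tendsto_natCast_atTop_atTop.eventually_ge_atTop _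
  have hJ : Tendsto (fun N => Nat.findGreatest (P N) N) atTop atTop := by
    refine tendsto_atTop.2 fun j => ?_
    filter_upwards [hP j, eventually_ge_atTop j] with N h1 h2 using Nat.le_findGreatest h2 h1
  refine ⟨_, hJ, ?_⟩
  refine squeeze_zero_norm' ?_ (tendsto_one_div_add_atTop_nhds_zero_nat.comp hJ)
  filter_upwards [hP 0, eventually_gt_atTop 0] with N h0 hN
  have h := Nat.findGreatest_spec (Nat.zero_le N) h0
  set j := Nat.findGreatest (P N) N
  have hN' : (0 : ℝ) < N := by exact_mod_cast hN
  have hj : (0 : ℝ) < j + 1 := by positivity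
  rw [Real.norm_eq_abs, abs_div, abs_of_pos hN', Function.comp_apply, div_le_div_iff₀ hN' hj, one_mul]
  exact h

/-- First δ is fixed, then ε is taken so small that the terms without N which involve ε are below δ,
whatever power of δ multiplies them. A slow reindexing in N then handles L(ε)/N; as M only
multiplies this term, the scales do not depend on M. -/
lemma exists_vanishing_scales {η ω L : ℝ → ℝ} {α β γ : ℝ} (hβ : 0 < β)
    (hη : Tendsto η (𝓝[>] 0) (𝓝 0)) (hω : Tendsto ω (𝓝[>] 0) (𝓝 0)) :
    ∃ ε δ : ℕ → ℝ, (∀ N, ε N ∈ Ioo (0 : ℝ) 1 ∧ δ N ∈ Ioo (0 : ℝ) 1) ∧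
      Tendsto ε atTop (𝓝 0) ∧ Tendsto δ atTop (𝓝 0) ∧ ∀ M : ℝ,
        Tendsto (fun N : ℕ => η (ε N) + (ε N / δ N ^ α + δ N ^ γ * ω (ε N / δ N) +
          M * L (ε N) / N + δ N ^ β)) atTop (𝓝 0) := by
  -- The shift by 2 keeps D 0 strictly below 1.
  set D : ℕ → ℝ := fun j => 1 / ((j : ℝ) + 2)
  have hD0 : ∀ j, 0 < D j := fun j => by positivity
  have hD1 : ∀ j, D j < 1 := fun j => by
    simp only [D]
    rw [div_lt_one (by positivity)]
    have : (0 : ℝ) ≤ j := j.cast_nonneg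
    linarith
  have hD : Tendsto D atTop (𝓝 0) :=
    squeeze_zero (fun j => (hD0 j).le) (fun j => by simp only [D]; gcongr; norm_num)
      (tendsto_one_div_add_atTop_nhds_zero_nat (𝕜 := ℝ))
  have hid : Tendsto (fun e : ℝ => e) (𝓝[>] 0) (𝓝 0) := nhdsWithin_le_nhds
  have hex : ∀ j : ℕ, ∃ e ∈ Ioo (0 : ℝ) 1, |e| < D j ∧ |η e| < D j ∧ |e / D j ^ α| < D j ∧
      |D j ^ γ * ω (e / D j)| < D j := by
    intro j
    have ev : ∀ {g : ℝ → ℝ}, Tendsto g (𝓝[>] 0) (𝓝 0) → ∀ᶠ e in 𝓝[>] 0, |g e| < D j := fun hg =>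
      (abs_zero (α := ℝ) ▸ hg.abs).eventually (gt_mem_nhds (hD0 j))
    have hdiv : Tendsto (fun e => e / D j) (𝓝[>] 0) (𝓝[>] 0) :=
      tendsto_nhdsWithin_iff.2 ⟨by simpa using hid.div_const (D j),
        eventually_mem_nhdsWithin.mono fun e he => div_pos he (hD0 j)⟩
    exact ((Eventually.and (Ioo_mem_nhdsGT (zero_lt_one' ℝ)) ((ev hid).and ((ev hη).and
      ((ev (by simpa using hid.div_const (D j ^ α))).and
        (ev (by simpa using (hω.comp hdiv).const_mul (D j ^ γ)))))))).exists
  choose e he h1 h2 h3 h4 using hex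
  obtain ⟨J, hJ, hJL⟩ := exists_tendsto_atTop_div_tendsto_zero fun j => L (e j)
  have lim : ∀ {g : ℕ → ℝ}, (∀ j, |g j| < D j) → Tendsto (fun N => g (J N)) atTop (𝓝 0) :=
    fun hg => (squeeze_zero_norm (fun j => (hg j).le) hD).comp hJ
  have hDJ := hD.comp hJ
  refine ⟨fun N => e (J N), fun N => D (J N), fun N => ⟨he _, hD0 _, hD1 _⟩, lim h1, hDJ,
    fun M => ?_⟩
  have hβ' : Tendsto (fun N => D (J N) ^ β) atTop (𝓝 0) :=
    ((Real.continuous_rpow_const hβ.le).tendsto' 0 0 (Real.zero_rpow hβ.ne')).comp hDJ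
  simpa [mul_div_assoc] using (lim h2).add ((((lim h3).add (lim h4)).add (hJL.const_mul M)).add hβ')

end

end

/-! ### The functional inequality -/

theorem mainTheorem5 (d : ℕ) (k p q : ℝ) (hk : 0 < k) (hkd : k < d - 1)
    (hp : max (d / (2 * k)) 1 < p) (hpk : p < d / k) (hq : d / k < q) :
    -- regularizations of the potential exist
    (∃ c : ℝ, 0 < c ∧ ∀ (r : ℕ) (ζ : Space d → ℝ), IsCutoff ζ →
      ∃ (Vε : ℝ → Space d → ℝ) (η : ℝ → ℝ), IsRegularization k p q r ζ c Vε η) ∧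
    -- and the functional inequality holds for each of them
    ∀ S : 𝓢(Space d, ℝ), (∀ x, S (-x) = -S x) → ∀ K : ℝ, 0 < K →
      ∃ C : ℝ, 0 < C ∧
        ∀ (r : ℕ) (ζ : Space d → ℝ) (c : ℝ) (Vε : ℝ → Space d → ℝ) (η : ℝ → ℝ) (σ : ℝ),
          IsCutoff ζ → IsRegularization k p q r ζ c Vε η → 2 * d < σ →
          ∃ ω : ℝ → ℝ, Tendsto ω (𝓝[>] 0) (𝓝 0) ∧
            (∀ (μ : Measure (Space d)) [IsProbabilityMeasure μ], HasDensityLE μ K →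
              ∀ (N : ℕ) (x : Fin N → Space d) (m : Fin N → ℝ) (M : ℝ), 0 < N →
                Function.Injective x → (∀ i, 0 ≤ m i) → ∑ i, m i = N → 0 < M → (∀ i, m i ≤ M) →
                let V := rieszPotential d k
                let ν := (empiricalMeasure x m).toSignedMeasure - μ.toSignedMeasure
                let g := sourceTerm S (empiricalMeasure x m) - sourceTerm S μ
                InteractionConverges V ν ν ∧ InteractionConverges V ν g ∧
                  ∀ ε ∈ Ioo (0 : ℝ) 1, ∀ δ ∈ Ioo (0 : ℝ) 1,
                    interaction V ν g ≤
                      C * (interaction V ν ν + η ε + errorTerm k p q σ M Vε ω ε δ N)) ∧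
            -- the error terms can be made `o_N(1)`
            ∃ ε δ : ℕ → ℝ, (∀ N, ε N ∈ Ioo (0 : ℝ) 1 ∧ δ N ∈ Ioo (0 : ℝ) 1) ∧
              Tendsto ε atTop (𝓝 0) ∧ Tendsto δ atTop (𝓝 0) ∧
              ∀ M : ℝ, 0 < M →
                Tendsto (fun N : ℕ => η (ε N) + errorTerm k p q σ M Vε ω (ε N) (δ N) N)
                  atTop (𝓝 0) := by
  have hd1 : (1 : ℝ) < d := by linarith
  have hd : 0 < d := by exact_mod_cast zero_lt_one.trans hd1
  have hkd' : k < d := by linarith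
  have hp1 : 1 < p := (le_max_right _ _).trans_lt hp
  have hp0 : 0 < p := zero_lt_one.trans hp1
  have hq1 : 1 ≤ q := (hp1.trans (hpk.trans hq)).le
  refine ⟨exists_isRegularization hd hk hp0 hpk hq, fun S _ K hK => ?_⟩
  obtain ⟨C₀, C₁, hC₀, hC₁, hmain⟩ := exists_interaction_le hk hkd' S hK
  obtain ⟨C₂, hC₂, hscale⟩ := exists_scale hk hkd' hC₁
  refine ⟨C₀, hC₀, fun r ζ c Vε η σ _ hV hσ => ?_⟩
  have hexp : 0 < (d - k) / k := div_pos (by linarith) hk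
  have hL : ∀ ε, 0 ≤ supNorm (Vε ε) := fun ε => Real.iSup_nonneg fun _ => abs_nonneg _
  have hG : Tendsto (fun ε => max 1 (supNorm (Vε ε)) ^ (-((d - k) / k))) (𝓝[>] 0) (𝓝 0) :=
    (tendsto_rpow_neg_atTop hexp).comp (tendsto_atTop_mono (fun _ => le_max_right _ _)
      (hV.tendsto_supNorm hd hk hp1.le hq1))
  -- Up to the factor C₂, ω is the envelope of the power of the supremum norm left over by
  -- `exists_scale`.
  obtain ⟨ω, hω, hω0, hGω⟩ := exists_monotone_envelope (fun ε => by positivity) (fun ε =>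
    Real.rpow_le_one_of_one_le_of_nonpos (le_max_left _ _) (by linarith)) hG
  have hωt : Tendsto (fun t => C₂ * ω t) (𝓝[>] 0) (𝓝 0) := by simpa using hω.const_mul C₂
  refine ⟨fun t => C₂ * ω t, hωt, fun μ _ hμ N x m M hN hx hm hmN hM hmM => ?_, ?_⟩
  · obtain ⟨h1, h2, h3⟩ := hmain μ hμ N x m M hN hx hm hmN hM hmM
    refine ⟨h1, h2, fun ε hε δ hδ => ?_⟩
    have hε0 := hε.1
    have hδ0 := hδ.1
    obtain ⟨a, ha, ha1, hle⟩ := hscale (supNorm (Vε ε)) (M / N) (hL ε) (by positivity)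
    refine (h3 a ha ha1).trans (mul_le_mul_of_nonneg_left ?_ hC₀.le)
    -- Both occurrences of δ only enlarge the term in ω: ε ≤ ε/δ, and d − k − σ/2 < 0 because σ >
    -- 2d.
    have g1 := hGω ε (ε / δ) hε0 (le_div_self hε0.le hδ0 hδ.2.le)
    have g2 : 1 ≤ δ ^ (d - k - σ / 2) :=
      Real.one_le_rpow_of_pos_of_le_one_of_nonpos hδ0 hδ.2.le (by linarith)
    have g3 := mul_le_mul_of_nonneg_left g1 hC₂.le
    have g4 := le_mul_of_one_le_left (mul_nonneg hC₂.le (hω0 (ε / δ))) g2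
    have g5 : 0 ≤ ε / δ ^ (k + 1 - d / q) := by positivity
    have g6 : 0 ≤ δ ^ (d / p - k) := by positivity
    have g7 := hV.rate_nonneg ε hε
    rw [errorTerm, mul_div_right_comm]
    linarith
  · have hβ : 0 < d / p - k := sub_pos.2 ((lt_div_comm₀ hk hp0).2 hpk)
    obtain ⟨ε, δ, h1, h2, h3, h4⟩ := exists_vanishing_scales (L := fun ε => supNorm (Vε ε))
      (α := k + 1 - d / q) (γ := d - k - σ / 2) hβ hV.rate_tendsto hωt
    exact ⟨ε, δ, h1, h2, h3, fun M _ => h4 M⟩
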